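/- Let $N\ge 2$, let $\Omega\subset\mathbb{R}^N$ be a bounded domain with smooth boundary, let $\alpha\ge 0$, and let $|\Omega|$ be the volume of $\Omega$ and $\omega_N$ the surface area of the unit sphere $\mathbb{S}^{N-1}$. For $\epsilon>0$ let $0<r_\epsilon<\epsilon$ and $$\mathbb{L}_\epsilon=\{\mathbf{x}\in\Omega\cap 2\epsilon\mathbb{Z}^N:\operatorname{dist}(\mathbf{x},\partial\Omega)\ge\epsilon\},\qquad D_\epsilon=\bigcup_{\hat{\mathbf{x}}\in\mathbb{L}_\epsilon}\overline{B}_{r_\epsilon}(\hat{\mathbf{x}}),\qquad \Omega_\epsilon=\Omega\setminus D_\epsilon,$$ and assume that $S:=\lim_{\epsilon\to0}|\mathbb{L}_\epsilon|\,r_\epsilon^{N-1}$ exists and lies in $(0,\infty)$ (so that $r_\epsilon$ is of the order $\epsilon^{N/(N-1)}$). Let $f\in L^2(\Omega)$, $g\in L^2(\partial\Omega)$ and $g^\epsilon\in L^2(\partial\Omega_\epsilon)$ be such that $g^\epsilon|_{\partial\Omega}\to g$ in $L^2(\partial\Omega)$ and $\limsup_{\epsilon\to0}\alpha\|g^\epsilon\|_{L^2(\partial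 D_\epsilon)}<\infty$. Assume that the data are the same on every inclusion: there are $h^\epsilon\in L^2(\mathbb{S}^{N-1})$ with $g^\epsilon(\hat{\mathbf{x}}+r_\epsilon\mathbf{m})=h^\epsilon(\mathbf{m})$ for all $\hat{\mathbf{x}}\in\mathbb{L}_\epsilon$ and almost all $\mathbf{m}\in\mathbb{S}^{N-1}$, and that the limit $$\overline{h}:=\lim_{\epsilon\to0}\frac1{\omega_N}\int_{\mathbb{S}^{N-1}}h^\epsilon\,d\mathbf{m}$$ exists. Let $q_\epsilon=1$ on $\Omega\setminus\bigcup_{\hat{\mathbf{x}}\in\mathbb{L}_\epsilon} B_\epsilon(\hat{\mathbf{x}})$ and, for $\hat{\mathbf{x}}\in\mathbb{L}_\epsilon$ and $r_\epsilon\le s=|\mathbf{x}-\hat{\mathbf{x}}|<\epsilon$, $$q_\epsilon(\mathbf{x})=\frac{1+\alpha r_\epsilon\log(s/r_\epsilon)}{1+\alpha r_\epsilon\log(\epsilon/r_\epsilon)}\ (N=2),\qquad q_\epsilon(\mathbf{x})=\frac{(N-2)+\alpha r_\epsilon\left(1-(r_\epsilon/s)^{N-2}\right)}{(N-2)+\alpha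 r_\epsilon\left(1-(r_\epsilon/\epsilon)^{N-2}\right)}\ (N\ge3),$$ which is the solution of $-\Delta q_\epsilon=0$ in each shell $B_\epsilon(\hat{\mathbf{x}})\setminus\overline{B}_{r_\epsilon}(\hat{\mathbf{x}})$ with $q_\epsilon=1$ on the outer sphere and $\partial q_\epsilon/\partial\mathbf{n}+\alpha q_\epsilon=0$ on the inner sphere, $\mathbf{n}$ being the unit normal that points out of $\Omega_\epsilon$. Put $k:=\alpha\omega_N S/|\Omega|$. (a) For every $\zeta\in C^\infty(\overline\Omega)$, $$\gamma[\zeta]:=\lim_{\epsilon\to0}\alpha\int_{\partial D_\epsilon}\zeta\,g^\epsilon q_\epsilon\,dS=\frac{\alpha S\omega_N}{|\Omega|}\,\overline{h}\int_\Omega\zeta\,d\mathbf{x}.$$ Now let $T^\epsilon:H^1(\Omega_\epsilon)\to H^1(\Omega)$ be bounded linear extension operators with $\limsup_{\epsilon\to0}\|T^\epsilon\|<\infty$, and for each $\epsilon>0$ let $u^\epsilon\in H^1(\Omega_\epsilon)$ be a weak solution of $-\Delta u^\epsilon=f$ in $\Omega_\epsilon$, $\partial u^\epsilon/\partial\mathbf{n}+\alpha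 u^\epsilon=\alpha g^\epsilon$ on $\partial\Omega_\epsilon$. (b) If $T^{\epsilon_n}u^{\epsilon_n}\rightharpoonup u$ in $H^1(\Omega)$ for some sequence $\epsilon_n\downarrow0$ (that is, $\epsilon_n>0$ and $\epsilon_n\to0$), then $u$ is a weak solution of $$(k-\Delta)u=f+k\overline{h}\ \text{ in }\Omega,\qquad \frac{\partial u}{\partial\mathbf{n}}+\alpha u=\alpha g\ \text{ on }\partial\Omega.\qquad(*)$$ (c) If $\alpha>0$, then $(*)$ has exactly one weak solution $u\in H^1(\Omega)$, and $T^\epsilon u^\epsilon\rightharpoonup u$ in $H^1(\Omega)$ as $\epsilon\to0$. (d) If $\alpha>0$ and $g^\epsilon=c$ on $\partial\Omega_\epsilon$ for all $\epsilon>0$, with a constant $c\in\mathbb{R}$, then $\overline{h}=c$ and $g=c$; the functions $v^\epsilon:=u^\epsilon-c$ are weak solutions of $-\Delta v^\epsilon=f$ in $\Omega_\epsilon$, $\partial v^\epsilon/\partial\mathbf{n}+\alpha v^\epsilon=0$ on $\partial\Omega_\epsilon$; $T^\epsilon v^\epsilon$ converges weakly in $H^1(\Omega)$ to a weak solution $v$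 of $(k-\Delta)v=f$ in $\Omega$, $\partial v/\partial\mathbf{n}+\alpha v=0$ on $\partial\Omega$; and $u=v+c$, in agreement with Kaizu's result for the homogeneous problem. -/

import Mathlib

open MeasureTheory Filter Set Topology
open scoped ContDiff NNReal ENNReal

namespace RobinHom

noncomputable section

/-- Euclidean space of dimension `N`. -/
abbrev E (N : ℕ) : Type := EuclideanSpace ℝ (Fin N)

/-! ### The domain, the inclusions and their surface measures -/

/-- A bounded domain with smooth boundary: `Ω` is open, connected, nonempty and bounded, and near
each boundary point it is, after a rigid motion, the strict subgraph of a smooth function: for some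
unit vector `e` and some smooth `φ` that does not depend on the coordinate along `e`,
`Ω` coincides near the point with `{x | ⟪e, x⟫ < φ x}`. -/
structure IsSmoothBoundedDomain {N : ℕ} (Ω : Set (E N)) : Prop where
  isOpen : IsOpen Ω
  isConnected : IsConnected Ω
  isBounded : Bornology.IsBounded Ω
  smooth_boundary : ∀ p ∈ frontier Ω, ∃ (e : E N) (φ : E N → ℝ), ‖e‖ = 1 ∧ ContDiff ℝ ∞ φ ∧
    (∀ (x : E N) (s : ℝ), φ (x + s • e) = φ x) ∧
    ∀ᶠ x in 𝓝 p, (x ∈ Ω ↔ inner ℝ e x < φ x)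

/-- The centres: points of the lattice `2 ε ℤ^N` in `Ω` at distance at least `ε` from `∂Ω`. -/
def centres {N : ℕ} (Ω : Set (E N)) (ε : ℝ) : Set (E N) :=
  {x | x ∈ Ω ∧ (∃ z : Fin N → ℤ, ∀ i, x i = 2 * ε * (z i : ℝ)) ∧
    ε ≤ Metric.infDist x (frontier Ω)}

/-- The inclusions: closed balls of radius `ρ` around the centres. -/
def inclusions {N : ℕ} (Ω : Set (E N)) (ρ ε : ℝ) : Set (E N) :=
  ⋃ x ∈ centres Ω ε, Metric.closedBall x ρ

/-- The perforated domain `Ω_ε`. -/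
def perforated {N : ℕ} (Ω : Set (E N)) (ρ ε : ℝ) : Set (E N) :=
  Ω \ inclusions Ω ρ ε

/-- The surface measure of the unit sphere. -/
def sphereMeasure (N : ℕ) : Measure (Metric.sphere (0 : E N) 1) :=
  (volume : Measure (E N)).toSphere

/-- The surface area of the unit sphere of `ℝ^N`. -/
def sphereArea (N : ℕ) : ℝ := (sphereMeasure N).real univ

/-- The surface measure of the sphere with centre `x` and radius `ρ`: the surface measure of the
unit sphere, transported by `m ↦ x + ρ m` and multiplied by `ρ^(N-1)`. -/
def sphereSurface {N : ℕ} (x : E N) (ρ : ℝ) : Measure (E N) :=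
  ENNReal.ofReal (ρ ^ (N - 1)) •
    (sphereMeasure N).map (fun m : Metric.sphere (0 : E N) 1 => x + ρ • (m : E N))

/-- The surface measure of `∂Ω`: the normalised `(N-1)`-dimensional Hausdorff measure on `∂Ω`. -/
def outerSurface {N : ℕ} (Ω : Set (E N)) : Measure (E N) :=
  (μHE[N - 1] : Measure (E N)).restrict (frontier Ω)

/-- The surface measure of `∂D_ε`, the disjoint union of the spheres that bound the inclusions. -/
def innerSurface {N : ℕ} (Ω : Set (E N)) (ρ ε : ℝ) : Measure (E N) :=
  Measure.sum fun x : centres Ω ε => sphereSurface (x : E N) ρ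

/-- The surface measure of `∂Ω_ε`, the disjoint union of `∂Ω` and `∂D_ε`. -/
def perforatedSurface {N : ℕ} (Ω : Set (E N)) (ρ ε : ℝ) : Measure (E N) :=
  outerSurface Ω + innerSurface Ω ρ ε

/-! ### The Sobolev space `H¹(U)` -/

/-- `G` is the weak gradient of `f` in `U`. -/
def IsWeakGradient {N : ℕ} (U : Set (E N)) (f : E N → ℝ) (G : E N → E N) : Prop :=
  ∀ φ : E N → ℝ, ContDiff ℝ ∞ φ → HasCompactSupport φ → tsupport φ ⊆ U → ∀ w : E N,
    ∫ x in U, f x * fderiv ℝ φ x w = - ∫ x in U, inner ℝ (G x) w * φ x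

theorem integrable_mul_test {N : ℕ} {U : Set (E N)} (f : Lp ℝ 2 (volume.restrict U))
    {ψ : E N → ℝ} (hψ : Continuous ψ) (hc : HasCompactSupport ψ) :
    Integrable (fun x => f x * ψ x) (volume.restrict U) := by
  have h : MemLp ψ 2 (volume.restrict U) := hψ.memLp_of_hasCompactSupport hc
  exact (Lp.memLp f).integrable_mul h

theorem integrable_inner_mul_test {N : ℕ} {U : Set (E N)} (G : Lp (E N) 2 (volume.restrict U))
    {ψ : E N → ℝ} (hψ : Continuous ψ) (hc : HasCompactSupport ψ) (w : E N) :
    Integrable (fun x => inner ℝ (G x) w * ψ x) (volume.restrict U) := by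
  have h : MemLp ψ 2 (volume.restrict U) := hψ.memLp_of_hasCompactSupport hc
  exact ((Lp.memLp G).inner_const w).integrable_mul h

theorem continuous_fderiv_test {N : ℕ} {φ : E N → ℝ} (hφ : ContDiff ℝ ∞ φ) (w : E N) :
    Continuous fun x => fderiv ℝ φ x w :=
  (hφ.continuous_fderiv (by simp)).clm_apply continuous_const

/-- The Sobolev space `H¹(U)`, as the space of pairs `(v, ∇v)` in `L²(U) × L²(U; ℝ^N)` in which the
second component is the weak gradient of the first. The norm is
`(‖v‖² + ‖∇v‖²)^{1/2}`. -/
def H1 {N : ℕ} (U : Set (E N)) :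
    Submodule ℝ (WithLp 2 (Lp ℝ 2 (volume.restrict U) × Lp (E N) 2 (volume.restrict U))) where
  carrier := {p | IsWeakGradient U p.fst p.snd}
  zero_mem' := by
    intro φ _ _ _ w
    have h1 : ∫ x in U, (0 : Lp ℝ 2 (volume.restrict U)) x * fderiv ℝ φ x w = 0 := by
      refine integral_eq_zero_of_ae ?_
      filter_upwards [Lp.coeFn_zero ℝ 2 (volume.restrict U)] with x hx
      rw [hx, Pi.zero_apply, zero_mul]
    have h2 : ∫ x in U,
        inner ℝ ((0 : Lp (E N) 2 (volume.restrict U)) x) w * φ x = 0 := by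
      refine integral_eq_zero_of_ae ?_
      filter_upwards [Lp.coeFn_zero (E N) 2 (volume.restrict U)] with x hx
      rw [hx, Pi.zero_apply, Pi.zero_apply, inner_zero_left, zero_mul]
    change ∫ x in U, (0 : Lp ℝ 2 (volume.restrict U)) x * fderiv ℝ φ x w
      = - ∫ x in U, inner ℝ ((0 : Lp (E N) 2 (volume.restrict U)) x) w * φ x
    rw [h1, h2, neg_zero]
  add_mem' := by
    intro p q hp hq φ hφ hc hs w
    have hd := continuous_fderiv_test hφ w
    have hdc : HasCompactSupport fun x => fderiv ℝ φ x w := hc.fderiv_apply ℝ w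
    have h1 : ∫ x in U, (p.fst + q.fst : Lp ℝ 2 (volume.restrict U)) x * fderiv ℝ φ x w
        = ∫ x in U, p.fst x * fderiv ℝ φ x w + q.fst x * fderiv ℝ φ x w := by
      refine integral_congr_ae ?_
      filter_upwards [Lp.coeFn_add p.fst q.fst] with x hx
      rw [hx, Pi.add_apply, add_mul]
    have h2 : ∫ x in U, inner ℝ ((p.snd + q.snd : Lp (E N) 2 (volume.restrict U)) x) w * φ x
        = ∫ x in U, inner ℝ (p.snd x) w * φ x + inner ℝ (q.snd x) w * φ x := by
      refine integral_congr_ae ?_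
      filter_upwards [Lp.coeFn_add p.snd q.snd] with x hx
      rw [hx, Pi.add_apply, inner_add_left, add_mul]
    have h3 := hp φ hφ hc hs w
    have h4 := hq φ hφ hc hs w
    change ∫ x in U, (p.fst + q.fst : Lp ℝ 2 (volume.restrict U)) x * fderiv ℝ φ x w
      = - ∫ x in U, inner ℝ ((p.snd + q.snd : Lp (E N) 2 (volume.restrict U)) x) w * φ x
    rw [h1, h2, integral_add (integrable_mul_test _ hd hdc) (integrable_mul_test _ hd hdc),
      integral_add (integrable_inner_mul_test _ hφ.continuous hc w)
        (integrable_inner_mul_test _ hφ.continuous hc w), h3, h4]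
    ring
  smul_mem' := by
    intro c p hp φ hφ hc hs w
    have h1 : ∫ x in U, (c • p.fst : Lp ℝ 2 (volume.restrict U)) x * fderiv ℝ φ x w
        = ∫ x in U, c * (p.fst x * fderiv ℝ φ x w) := by
      refine integral_congr_ae ?_
      filter_upwards [Lp.coeFn_smul c p.fst] with x hx
      rw [hx, Pi.smul_apply, smul_eq_mul, mul_assoc]
    have h2 : ∫ x in U, inner ℝ ((c • p.snd : Lp (E N) 2 (volume.restrict U)) x) w * φ x
        = ∫ x in U, c * (inner ℝ (p.snd x) w * φ x) := by
      refine integral_congr_ae ?_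
      filter_upwards [Lp.coeFn_smul c p.snd] with x hx
      rw [hx, Pi.smul_apply, real_inner_smul_left, mul_assoc]
    have h3 := hp φ hφ hc hs w
    change ∫ x in U, (c • p.fst : Lp ℝ 2 (volume.restrict U)) x * fderiv ℝ φ x w
      = - ∫ x in U, inner ℝ ((c • p.snd : Lp (E N) 2 (volume.restrict U)) x) w * φ x
    rw [h1, h2, integral_const_mul, integral_const_mul, h3]
    ring

/-- The function underlying an element of `H¹(U)`. -/
def toFn {N : ℕ} {U : Set (E N)} (v : H1 U) : Lp ℝ 2 (volume.restrict U) := v.1.fst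

/-- The weak gradient of an element of `H¹(U)`. -/
def weakGrad {N : ℕ} {U : Set (E N)} (v : H1 U) : Lp (E N) 2 (volume.restrict U) := v.1.snd

/-- `t ∈ L²(ν)` is the trace of `v ∈ H¹(U)` on the boundary of `U`, whose surface measure is `ν`:
there are functions, smooth up to the boundary, that converge to `v` in `H¹(U)` and whose boundary
values converge to `t` in `L²(ν)`. -/
def HasTrace {N : ℕ} {U : Set (E N)} (ν : Measure (E N)) (v : H1 U) (t : Lp ℝ 2 ν) : Prop :=
  ∃ (φ : ℕ → E N → ℝ) (V : ℕ → H1 U),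
    (∀ n, ContDiff ℝ ∞ (φ n)) ∧
    (∀ n, toFn (V n) =ᵐ[volume.restrict U] φ n) ∧
    (∀ n, weakGrad (V n) =ᵐ[volume.restrict U] gradient (φ n)) ∧
    Tendsto V atTop (𝓝 v) ∧
    Tendsto (fun n => eLpNorm (fun x => φ n x - t x) 2 ν) atTop (𝓝 0)

/-- Weak convergence in a real normed space, along a filter. -/
def WeaklyTendsto {ι H : Type*} [NormedAddCommGroup H] [NormedSpace ℝ H]
    (w : ι → H) (l : Filter ι) (w₀ : H) : Prop :=
  ∀ L : H →L[ℝ] ℝ, Tendsto (fun i => L (w i)) l (𝓝 (L w₀))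

/-! ### The Robin problems -/

/-- `u ∈ H¹(U)` is a weak solution of `(k - Δ) u = F` in `U`, `∂u/∂n + α u = α g` on `∂U`, where `ν`
is the surface measure of `∂U`: for all `v ∈ H¹(U)`,
`∫_U ∇u·∇v + k ∫_U u v + α ∫_{∂U} (u - g) v = ∫_U F v`. -/
def IsRobinSolution {N : ℕ} (U : Set (E N)) (ν : Measure (E N)) (k α : ℝ)
    (F g : E N → ℝ) (u : H1 U) : Prop :=
  ∃ t : Lp ℝ 2 ν, HasTrace ν u t ∧ ∀ (v : H1 U) (s : Lp ℝ 2 ν), HasTrace ν v s →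
    (∫ x in U, inner ℝ (weakGrad u x) (weakGrad v x)) + k * (∫ x in U, toFn u x * toFn v x)
      + α * (∫ x, (t x - g x) * s x ∂ν) = ∫ x in U, F x * toFn v x

/-- The radial profile, on `ρ ≤ s ≤ ε`, of the solution of the cell problem: harmonic in the shell
`B_ε \ B_ρ`, equal to `1` at `s = ε`, with `∂q/∂n + α q = 0` at `s = ρ`, where `n` points into
the inclusion. -/
def cellProfile (N : ℕ) (α ρ ε s : ℝ) : ℝ :=
  if N = 2 then (1 + α * ρ * Real.log (s / ρ)) / (1 + α * ρ * Real.log (ε / ρ))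
  else ((N : ℝ) - 2 + α * ρ * (1 - (ρ / s) ^ (N - 2))) /
    ((N : ℝ) - 2 + α * ρ * (1 - (ρ / ε) ^ (N - 2)))

open Classical in
/-- The auxiliary function `q_ε`: equal to the solution of the cell problem in the shells around
the centres and to `1` outside the balls of radius `ε` around the centres. These balls are
pairwise disjoint, so within each of them `infDist x (centres Ω ε)` is the distance to its centre. -/
def auxiliary {N : ℕ} (Ω : Set (E N)) (α ρ ε : ℝ) (x : E N) : ℝ :=
  if ∃ c ∈ centres Ω ε, dist x c < ε then
    cellProfile N α ρ ε (Metric.infDist x (centres Ω ε))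
  else 1

/-- `T` is a family of extension operators `H¹(Ω_ε) → H¹(Ω)`, `ε > 0`, whose operator
norms stay bounded as `ε → 0`. -/
def IsExtensionFamily {N : ℕ} (Ω : Set (E N)) (r : ℝ → ℝ)
    (T : ∀ ε : ℝ, H1 (perforated Ω (r ε) ε) →L[ℝ] H1 Ω) : Prop :=
  (∀ ε > 0, ∀ v : H1 (perforated Ω (r ε) ε),
    toFn (T ε v) =ᵐ[volume.restrict (perforated Ω (r ε) ε)] toFn v) ∧
  ∃ C : ℝ, ∀ᶠ ε in 𝓝[>] (0 : ℝ), ‖T ε‖ ≤ C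

end

end RobinHom

namespace RobinHom

/-! ### Square-integrable functions -/

/-! The weak formulation in `Ω_ε` is tested with a fixed smooth `ζ`, and every term is passed to the
limit. The terms over `Ω_ε` converge because the volume of the inclusions tends to zero, and those
over `∂Ω` because the trace is a bounded operator. What remains are the two integrals over `∂D_ε`,
whose total area stays bounded at the critical scale. They produce the terms `k u` and `k hbar`.

For the solution, `∫_{∂D_ε} u ζ` is compared with an integral over `Ω` in two steps. (1) Each sphere
is replaced by the annulus `B_ε \ B_{ε/2}` around the same centre, weighted so that the masses
agree. Sphere and annulus are images of one product measure, so the difference is an integral of the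
gradient along radii, that is, against a measure on the shell with density `(ρ/|x-a|)^(N-1) ≤ 1` and
mass at most `ε` times the area of the sphere. By Cauchy-Schwarz the error is `O(√ε)` in terms of
the `H¹` norm (`enorm_sub_sq_le_lintegral_perforated`). (2) The union of the annuli around the whole
lattice is periodic, so its indicator, averaged over translations by the points of a cell, is
constant. A translation by `y` costs at most `|y| ‖∇P‖_{L¹}`. With `P = χ ψ²`, where `χ` is a
cut-off and the boundary layer is small in terms of the energy, the quadratic form of the annuli is
close to a multiple of `∫_Ω ψ²`, uniformly on bounded sets of `H¹`
(`eventually_abs_annuli_sub_le_smooth`). Polarization yields products. Weak convergence is therefore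
enough, and no compact embedding is used.

For the data, which repeat on every inclusion, `∫_{∂D_ε} ζ gε` is up to `o(1)` a Riemann sum of `ζ`
over the centres times the integral of `h ε`. The function `q_ε` is constant on `∂D_ε`, with a value
that tends to `1`, so it does not alter the limit. This gives (a) and also the data term in (b).

Traces are defined by smooth approximation. A graph-patch estimate makes the relation between a
smooth function and its boundary values bounded. Its closure is then an operator on a closed, hence
weakly closed, subspace (`exists_traceOperator`), so the weak limit has a trace. The extensions `T ε
(uε ε)` lie in that subspace because a trace on `∂Ω_ε` can be carried to `∂Ω` by a cut-off and a
mollification inside `Ω` (`HasTrace.of_sdiff`).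

For `α > 0`, testing with the solution bounds `‖∇u‖² + (α/2) ∫_{∂D_ε} u²`. Comparing the surface
term with `∫_Ω u²` as above turns this into a bound in `H¹` (`exists_norm_le`). Every ultrafilter
finer than `𝓝[>] 0` then has a weak limit, which solves the limit problem. That problem has at most
one solution because `k > 0`, so the whole family converges. For constant data, subtracting the
constant reduces to zero data, and uniqueness identifies `u` with `v + c`. -/

theorem tendsto_integral_inner {X ι F : Type*} [MeasurableSpace X] [NormedAddCommGroup F]
    [InnerProductSpace ℝ F] {μ : Measure X} {l : Filter ι}
    {f g : ι → X → F} {f₀ g₀ : X → F}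
    (hf : ∀ i, MemLp (f i) 2 μ) (hg : ∀ i, MemLp (g i) 2 μ) (hf₀ : MemLp f₀ 2 μ)
    (hg₀ : MemLp g₀ 2 μ)
    (hfl : Tendsto (fun i => eLpNorm (f i - f₀) 2 μ) l (𝓝 0))
    (hgl : Tendsto (fun i => eLpNorm (g i - g₀) 2 μ) l (𝓝 0)) :
    Tendsto (fun i => ∫ x, inner ℝ (f i x) (g i x) ∂μ) l (𝓝 (∫ x, inner ℝ (f₀ x) (g₀ x) ∂μ)) := by
  have key : ∀ (a b : X → F) (ha : MemLp a 2 μ) (hb : MemLp b 2 μ),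
      ∫ x, inner ℝ (a x) (b x) ∂μ = inner ℝ (ha.toLp a) (hb.toLp b) := by
    intro a b ha hb
    rw [L2.inner_def]
    refine integral_congr_ae ?_
    filter_upwards [ha.coeFn_toLp, hb.coeFn_toLp] with x h1 h2
    rw [h1, h2]
  rw [key _ _ hf₀ hg₀]
  simp_rw [fun i => key _ _ (hf i) (hg i)]
  exact ((Lp.tendsto_Lp_iff_tendsto_eLpNorm'' _ hf _ hf₀).2 hfl).inner
    ((Lp.tendsto_Lp_iff_tendsto_eLpNorm'' _ hg _ hg₀).2 hgl)

theorem tendsto_integral_mul {X ι : Type*} [MeasurableSpace X] {μ : Measure X} {l : Filter ι}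
    {f g : ι → X → ℝ} {f₀ g₀ : X → ℝ}
    (hf : ∀ i, MemLp (f i) 2 μ) (hg : ∀ i, MemLp (g i) 2 μ) (hf₀ : MemLp f₀ 2 μ)
    (hg₀ : MemLp g₀ 2 μ)
    (hfl : Tendsto (fun i => eLpNorm (f i - f₀) 2 μ) l (𝓝 0))
    (hgl : Tendsto (fun i => eLpNorm (g i - g₀) 2 μ) l (𝓝 0)) :
    Tendsto (fun i => ∫ x, f i x * g i x ∂μ) l (𝓝 (∫ x, f₀ x * g₀ x ∂μ)) := by
  have := tendsto_integral_inner hf hg hf₀ hg₀ hfl hgl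
  simpa [mul_comm] using this

theorem integral_sq_eq_norm_sq {X F : Type*} [MeasurableSpace X] [NormedAddCommGroup F]
    [InnerProductSpace ℝ F] {μ : Measure X} (f : Lp F 2 μ) :
    ∫ x, ‖f x‖ ^ 2 ∂μ = ‖f‖ ^ 2 := by
  rw [← real_inner_self_eq_norm_sq f, L2.inner_def]
  simp_rw [real_inner_self_eq_norm_sq]

theorem integral_mul_eq_inner {X : Type*} [MeasurableSpace X] {μ : Measure X} (f g : Lp ℝ 2 μ) :
    ∫ x, f x * g x ∂μ = inner ℝ f g := by
  rw [L2.inner_def]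
  simp [mul_comm]

theorem memLp_of_continuous {X F : Type*} [TopologicalSpace X] [MeasurableSpace X] [BorelSpace X]
    [SecondCountableTopology X] [NormedAddCommGroup F]
    {ν : Measure X} [IsFiniteMeasure ν] {K : Set X} (hK : IsCompact K)
    (hν : ν Kᶜ = 0) {ψ : X → F} (hψ : Continuous ψ) (p : ℝ≥0∞) : MemLp ψ p ν := by
  obtain ⟨C, hC⟩ := hK.exists_bound_of_continuousOn hψ.continuousOn
  refine MemLp.of_bound hψ.aestronglyMeasurable C ?_
  rw [ae_iff]
  refine measure_mono_null (fun x hx hxK => hx (hC x hxK)) hν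

theorem isFiniteMeasure_restrict_of_isBounded {N : ℕ} {U : Set (E N)}
    (hU : Bornology.IsBounded U) : IsFiniteMeasure (volume.restrict U : Measure (E N)) :=
  ⟨by rw [Measure.restrict_apply_univ]; exact hU.measure_lt_top⟩

theorem memLp_restrict_of_continuous {N : ℕ} {F : Type*} [NormedAddCommGroup F] {U : Set (E N)}
    (hU : Bornology.IsBounded U) {ψ : E N → F} (hψ : Continuous ψ) (p : ℝ≥0∞) :
    MemLp ψ p (volume.restrict U) := by
  have := isFiniteMeasure_restrict_of_isBounded hU
  refine memLp_of_continuous hU.isCompact_closure ?_ hψ p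
  rw [Measure.restrict_apply isClosed_closure.measurableSet.compl]
  refine measure_mono_null (t := ∅) ?_ measure_empty
  rintro x ⟨h1, h2⟩
  exact h1 (subset_closure h2)

/-! ### Gradients of smooth functions -/

theorem inner_gradient {N : ℕ} (φ : E N → ℝ) (x w : E N) :
    inner ℝ (gradient φ x) w = fderiv ℝ φ x w := by
  rw [gradient, InnerProductSpace.toDual_symm_apply]

theorem continuous_gradient {N : ℕ} {φ : E N → ℝ} (hφ : ContDiff ℝ ∞ φ) :
    Continuous (gradient φ) :=
  (LinearIsometryEquiv.continuous _).comp (hφ.continuous_fderiv (by simp))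

theorem gradient_add' {N : ℕ} {φ ψ : E N → ℝ} (hφ : ContDiff ℝ ∞ φ) (hψ : ContDiff ℝ ∞ ψ)
    (x : E N) : gradient (fun y => φ y + ψ y) x = gradient φ x + gradient ψ x := by
  refine ext_inner_right ℝ fun w => ?_
  rw [inner_add_left, inner_gradient, inner_gradient, inner_gradient,
    fderiv_fun_add (hφ.differentiable (by simp) x) (hψ.differentiable (by simp) x)]
  rfl

theorem gradient_sub' {N : ℕ} {φ ψ : E N → ℝ} (hφ : ContDiff ℝ ∞ φ) (hψ : ContDiff ℝ ∞ ψ)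
    (x : E N) : gradient (fun y => φ y - ψ y) x = gradient φ x - gradient ψ x := by
  refine ext_inner_right ℝ fun w => ?_
  rw [inner_sub_left, inner_gradient, inner_gradient, inner_gradient,
    fderiv_fun_sub (hφ.differentiable (by simp) x) (hψ.differentiable (by simp) x)]
  rfl

theorem gradient_mul' {N : ℕ} {φ ψ : E N → ℝ} (hφ : ContDiff ℝ ∞ φ) (hψ : ContDiff ℝ ∞ ψ)
    (x : E N) : gradient (fun y => φ y * ψ y) x = φ x • gradient ψ x + ψ x • gradient φ x := by
  refine ext_inner_right ℝ fun w => ?_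
  rw [inner_add_left, inner_smul_left, inner_smul_left, inner_gradient, inner_gradient,
    inner_gradient, fderiv_fun_mul (hφ.differentiable (by simp) x) (hψ.differentiable (by simp) x)]
  rfl

theorem gradient_const' {N : ℕ} (c : ℝ) (x : E N) : gradient (fun _ : E N => c) x = 0 := by
  refine ext_inner_right ℝ fun w => ?_
  rw [inner_gradient]; simp

theorem gradient_const_mul' {N : ℕ} (c : ℝ) {φ : E N → ℝ} (hφ : ContDiff ℝ ∞ φ)
    (x : E N) : gradient (fun y => c * φ y) x = c • gradient φ x := by
  rw [gradient_mul' contDiff_const hφ, gradient_const', smul_zero, add_zero]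

/-! ### The space `H¹(U)` -/

section H1

variable {N : ℕ} {U : Set (E N)}

theorem IsWeakGradient.congr_ae {f f' : E N → ℝ} {G G' : E N → E N}
    (h : IsWeakGradient U f G) (hf : f =ᵐ[volume.restrict U] f')
    (hG : G =ᵐ[volume.restrict U] G') : IsWeakGradient U f' G' := by
  intro φ hφ hc hs w
  have h1 : ∫ x in U, f' x * fderiv ℝ φ x w = ∫ x in U, f x * fderiv ℝ φ x w :=
    integral_congr_ae (by filter_upwards [hf] with x hx; rw [hx])
  have h2 : ∫ x in U, inner ℝ (G' x) w * φ x = ∫ x in U, inner ℝ (G x) w * φ x :=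
    integral_congr_ae (by filter_upwards [hG] with x hx; rw [hx])
  rw [h1, h2]
  exact h φ hφ hc hs w

/-- The element of `H¹(U)` given by a square-integrable function and its weak gradient. -/
noncomputable def H1.mk' {f : E N → ℝ} {G : E N → E N} (hf : MemLp f 2 (volume.restrict U))
    (hG : MemLp G 2 (volume.restrict U)) (h : IsWeakGradient U f G) : H1 U :=
  ⟨WithLp.toLp 2 (hf.toLp f, hG.toLp G),
    h.congr_ae hf.coeFn_toLp.symm hG.coeFn_toLp.symm⟩

theorem toFn_mk' {f : E N → ℝ} {G : E N → E N} (hf : MemLp f 2 (volume.restrict U))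
    (hG : MemLp G 2 (volume.restrict U)) (h : IsWeakGradient U f G) :
    toFn (H1.mk' hf hG h) =ᵐ[volume.restrict U] f := hf.coeFn_toLp

theorem weakGrad_mk' {f : E N → ℝ} {G : E N → E N} (hf : MemLp f 2 (volume.restrict U))
    (hG : MemLp G 2 (volume.restrict U)) (h : IsWeakGradient U f G) :
    weakGrad (H1.mk' hf hG h) =ᵐ[volume.restrict U] G := hG.coeFn_toLp

theorem isWeakGradient (v : H1 U) : IsWeakGradient U (toFn v) (weakGrad v) := v.2

theorem toFn_sub (u v : H1 U) : toFn (u - v) = toFn u - toFn v := rfl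
theorem toFn_add (u v : H1 U) : toFn (u + v) = toFn u + toFn v := rfl
theorem toFn_smul (c : ℝ) (v : H1 U) : toFn (c • v) = c • toFn v := rfl
theorem weakGrad_add (u v : H1 U) : weakGrad (u + v) = weakGrad u + weakGrad v := rfl
theorem weakGrad_smul (c : ℝ) (v : H1 U) : weakGrad (c • v) = c • weakGrad v := rfl

theorem H1.ext' {u v : H1 U} (h1 : toFn u = toFn v) (h2 : weakGrad u = weakGrad v) : u = v := by
  refine Subtype.ext ((WithLp.ofLp_injective 2) (Prod.ext h1 h2))

theorem H1.inner_eq (u v : H1 U) :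
    inner ℝ u v = inner ℝ (toFn u) (toFn v) + inner ℝ (weakGrad u) (weakGrad v) := rfl

theorem H1.norm_sq (v : H1 U) : ‖v‖ ^ 2 = ‖toFn v‖ ^ 2 + ‖weakGrad v‖ ^ 2 := by
  rw [← real_inner_self_eq_norm_sq, H1.inner_eq, real_inner_self_eq_norm_sq,
    real_inner_self_eq_norm_sq]

theorem norm_toFn_le (v : H1 U) : ‖toFn v‖ ≤ ‖v‖ :=
  abs_le_of_sq_le_sq' (by rw [H1.norm_sq v]; nlinarith [sq_nonneg ‖weakGrad v‖]) (norm_nonneg _)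
    |>.2

theorem norm_weakGrad_le (v : H1 U) : ‖weakGrad v‖ ≤ ‖v‖ :=
  abs_le_of_sq_le_sq' (by rw [H1.norm_sq v]; nlinarith [sq_nonneg ‖toFn v‖]) (norm_nonneg _)
    |>.2

theorem H1.tendsto_iff {ι : Type*} {l : Filter ι} {V : ι → H1 U} {v : H1 U} :
    Tendsto V l (𝓝 v) ↔ Tendsto (fun i => toFn (V i)) l (𝓝 (toFn v)) ∧
      Tendsto (fun i => weakGrad (V i)) l (𝓝 (weakGrad v)) := by
  rw [tendsto_iff_norm_sub_tendsto_zero, tendsto_iff_norm_sub_tendsto_zero (f := fun i => toFn _),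
    tendsto_iff_norm_sub_tendsto_zero (f := fun i => weakGrad _)]
  constructor
  · intro h
    exact ⟨squeeze_zero (fun _ => norm_nonneg _) (fun i => norm_toFn_le (V i - v)) h,
      squeeze_zero (fun _ => norm_nonneg _) (fun i => norm_weakGrad_le (V i - v)) h⟩
  · rintro ⟨h1, h2⟩
    have h3 : Tendsto (fun i => ‖V i - v‖ ^ 2) l (𝓝 0) := by
      have := (h1.pow 2).add (h2.pow 2)
      simp only [ne_eq, OfNat.ofNat_ne_zero, not_false_eq_true, zero_pow, add_zero] at this
      refine this.congr fun i => ?_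
      rw [H1.norm_sq]; rfl
    have := h3.sqrt
    simpa [Real.sqrt_sq (norm_nonneg _)] using this

/-- For a fixed test function both sides of the defining identity are inner products with fixed
elements of `L²`, so `H1 U` is an intersection of closed conditions. Completeness is needed for the
weak compactness and for the projection in the trace operator. -/
theorem H1.isClosed : IsClosed (H1 U : Set (WithLp 2 (Lp ℝ 2 (volume.restrict U) ×
    Lp (E N) 2 (volume.restrict U)))) := by
  have : (H1 U : Set (WithLp 2 (Lp ℝ 2 (volume.restrict U) ×
      Lp (E N) 2 (volume.restrict U)))) = {p | ∀ φ : E N → ℝ, ContDiff ℝ ∞ φ →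
        HasCompactSupport φ → tsupport φ ⊆ U → ∀ w : E N,
        ∫ x in U, p.fst x * fderiv ℝ φ x w = - ∫ x in U, inner ℝ (p.snd x) w * φ x} := rfl
  rw [this]
  simp only [ofPred_forall]
  refine isClosed_iInter fun φ => isClosed_iInter fun hφ => isClosed_iInter fun hc =>
    isClosed_iInter fun hs => isClosed_iInter fun w => ?_
  have hm1 : MemLp (fun x => fderiv ℝ φ x w) 2 (volume.restrict U) :=
    (continuous_fderiv_test hφ w).memLp_of_hasCompactSupport (hc.fderiv_apply ℝ w)
  have hm2 : MemLp (fun x => φ x • w) 2 (volume.restrict U) :=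
    (hφ.continuous.smul continuous_const).memLp_of_hasCompactSupport hc.smul_right
  have e1 : ∀ p : WithLp 2 (Lp ℝ 2 (volume.restrict U) × Lp (E N) 2 (volume.restrict U)),
      ∫ x in U, p.fst x * fderiv ℝ φ x w = inner ℝ p.fst (hm1.toLp _) := by
    intro p
    rw [← integral_mul_eq_inner]
    refine integral_congr_ae ?_
    filter_upwards [hm1.coeFn_toLp] with x hx
    rw [hx]
  have e2 : ∀ p : WithLp 2 (Lp ℝ 2 (volume.restrict U) × Lp (E N) 2 (volume.restrict U)),
      ∫ x in U, inner ℝ (p.snd x) w * φ x = inner ℝ p.snd (hm2.toLp _) := by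
    intro p
    rw [L2.inner_def]
    refine integral_congr_ae ?_
    filter_upwards [hm2.coeFn_toLp] with x hx
    rw [hx, inner_smul_right, mul_comm]
  simp_rw [e1, e2]
  refine isClosed_eq ?_ ?_
  · exact (WithLp.prod_continuous_ofLp 2 _ _).fst.inner continuous_const
  · exact ((WithLp.prod_continuous_ofLp 2 _ _).snd.inner continuous_const).neg

instance : CompleteSpace (H1 U) := H1.isClosed.completeSpace_coe

theorem isWeakGradient_gradient {φ : E N → ℝ} (hφ : ContDiff ℝ ∞ φ) :
    IsWeakGradient U φ (gradient φ) := by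
  intro ψ hψ hc hs w
  have h0 : ∀ x, x ∉ U → ψ x = 0 := fun x hx => image_eq_zero_of_notMem_tsupport fun h => hx (hs h)
  have h0' : ∀ x, x ∉ U → fderiv ℝ ψ x w = 0 := fun x hx => by
    rw [image_eq_zero_of_notMem_tsupport (f := fderiv ℝ ψ)
      fun h => hx (hs (tsupport_fderiv_subset ℝ h))]
    rfl
  rw [setIntegral_eq_integral_of_forall_compl_eq_zero (fun x hx => by rw [h0' x hx, mul_zero]),
    setIntegral_eq_integral_of_forall_compl_eq_zero (fun x hx => by rw [h0 x hx, mul_zero])]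
  simp_rw [inner_gradient]
  refine integral_mul_fderiv_eq_neg_fderiv_mul_of_integrable ?_ ?_ ?_
    (fun x _ => hφ.differentiable (by simp) x) (fun x _ => hψ.differentiable (by simp) x)
  · exact ((continuous_fderiv_test hφ w).mul hψ.continuous).integrable_of_hasCompactSupport
      hc.mul_left
  · exact (hφ.continuous.mul (continuous_fderiv_test hψ w)).integrable_of_hasCompactSupport
      (hc.fderiv_apply ℝ w).mul_left
  · exact (hφ.continuous.mul hψ.continuous).integrable_of_hasCompactSupport hc.mul_left

/-- The restriction to a bounded set of a smooth function, as an element of `H¹`. -/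
noncomputable def ofSmooth (hU : Bornology.IsBounded U) {φ : E N → ℝ} (hφ : ContDiff ℝ ∞ φ) :
    H1 U :=
  H1.mk' (memLp_restrict_of_continuous hU hφ.continuous 2)
    (memLp_restrict_of_continuous hU (continuous_gradient hφ) 2) (isWeakGradient_gradient hφ)

theorem toFn_ofSmooth (hU : Bornology.IsBounded U) {φ : E N → ℝ} (hφ : ContDiff ℝ ∞ φ) :
    toFn (ofSmooth hU hφ) =ᵐ[volume.restrict U] φ := toFn_mk' _ _ _

theorem weakGrad_ofSmooth (hU : Bornology.IsBounded U) {φ : E N → ℝ} (hφ : ContDiff ℝ ∞ φ) :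
    weakGrad (ofSmooth hU hφ) =ᵐ[volume.restrict U] gradient φ := weakGrad_mk' _ _ _

theorem IsWeakGradient.mono {U' : Set (E N)} {f : E N → ℝ} {G : E N → E N}
    (h : IsWeakGradient U f G) (hU : U' ⊆ U) : IsWeakGradient U' f G := by
  intro ψ hψ hc hs w
  have key : ∀ V : Set (E N), tsupport ψ ⊆ V →
      ∫ x in V, f x * fderiv ℝ ψ x w = ∫ x, f x * fderiv ℝ ψ x w ∧
      ∫ x in V, inner ℝ (G x) w * ψ x = ∫ x, inner ℝ (G x) w * ψ x := by
    intro V hV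
    have h0 : ∀ x, x ∉ V → ψ x = 0 :=
      fun x hx => image_eq_zero_of_notMem_tsupport fun h => hx (hV h)
    have h0' : ∀ x, x ∉ V → fderiv ℝ ψ x w = 0 := fun x hx => by
      rw [image_eq_zero_of_notMem_tsupport (f := fderiv ℝ ψ)
        fun h => hx (hV (tsupport_fderiv_subset ℝ h))]
      rfl
    exact ⟨setIntegral_eq_integral_of_forall_compl_eq_zero (fun x hx => by rw [h0' x hx, mul_zero]),
      setIntegral_eq_integral_of_forall_compl_eq_zero (fun x hx => by rw [h0 x hx, mul_zero])⟩
  rw [(key U' hs).1, (key U' hs).2, ← (key U (hs.trans hU)).1, ← (key U (hs.trans hU)).2]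
  exact h ψ hψ hc (hs.trans hU) w

theorem IsWeakGradient.ae_unique (hU : IsOpen U) {f : E N → ℝ} {G G' : E N → E N}
    (hG : MemLp G 2 (volume.restrict U)) (hG' : MemLp G' 2 (volume.restrict U))
    (h : IsWeakGradient U f G) (h' : IsWeakGradient U f G') : G =ᵐ[volume.restrict U] G' := by
  have hd : MemLp (fun x => G x - G' x) 2 (volume.restrict U) := hG.sub hG'
  have hw : ∀ w : E N, ∀ᵐ x ∂(volume : Measure (E N)), x ∈ U → inner ℝ (G x - G' x) w = 0 := by
    intro w
    have hdw : MemLp (fun x => inner ℝ (G x - G' x) w) 2 (volume.restrict U) := hd.inner_const w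
    refine hU.ae_eq_zero_of_integral_contDiff_smul_eq_zero ?_ ?_
    · have := hdw.locallyIntegrable (by norm_num : (1 : ℝ≥0∞) ≤ 2)
      exact locallyIntegrableOn_of_locallyIntegrable_restrict this
    · intro ψ hψ hc hs
      have h1 : ∫ x in U, inner ℝ (G x) w * ψ x = ∫ x in U, inner ℝ (G' x) w * ψ x := by
        have a := h ψ hψ hc hs w
        have b := h' ψ hψ hc hs w
        linarith
      have hi : ∀ H : E N → E N, MemLp H 2 (volume.restrict U) →
          Integrable (fun x => inner ℝ (H x) w * ψ x) (volume.restrict U) := fun H hH =>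
        (hH.inner_const w).integrable_mul
          (hψ.continuous.memLp_of_hasCompactSupport hc : MemLp ψ 2 (volume.restrict U))
      have h0 : ∀ x, x ∉ U → ψ x = 0 :=
        fun x hx => image_eq_zero_of_notMem_tsupport fun h => hx (hs h)
      rw [← setIntegral_eq_integral_of_forall_compl_eq_zero (s := U)
        (fun x hx => by rw [h0 x hx, zero_smul])]
      have : ∫ x in U, ψ x • inner ℝ (G x - G' x) w
          = ∫ x in U, (inner ℝ (G x) w * ψ x - inner ℝ (G' x) w * ψ x) := by
        congr 1; ext x; rw [inner_sub_left, smul_eq_mul]; ring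
      rw [this, integral_sub (hi G hG) (hi G' hG'), h1, sub_self]
  have hb := (ae_all_iff.2 fun i => hw (EuclideanSpace.basisFun (Fin N) ℝ i))
  have hb' := (ae_restrict_iff' hU.measurableSet).2 (by
    filter_upwards [hb] with x hx hxU using fun i => hx i hxU :
    ∀ᵐ x ∂(volume : Measure (E N)), x ∈ U → ∀ i,
      inner ℝ (G x - G' x) (EuclideanSpace.basisFun (Fin N) ℝ i) = 0)
  filter_upwards [hb'] with x hx
  rw [← sub_eq_zero]
  ext i
  have := hx i
  rw [real_inner_comm, EuclideanSpace.basisFun_apply, EuclideanSpace.inner_single_left] at this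
  simpa using this

/-- Weak gradients are local and unique on open sets. This is what allows the gradient of an
extension to stand for the gradient of the original function. -/
theorem H1.ae_weakGrad_eq {U' : Set (E N)} (hU' : IsOpen U') (h : U' ⊆ U) (v : H1 U) (w : H1 U')
    (hvw : toFn v =ᵐ[volume.restrict U'] toFn w) :
    weakGrad v =ᵐ[volume.restrict U'] weakGrad w := by
  refine IsWeakGradient.ae_unique hU' (f := toFn v)
    ((Lp.memLp (weakGrad v)).mono_measure (Measure.restrict_mono h le_rfl))
    (Lp.memLp _) ((isWeakGradient v).mono h) ?_
  exact (isWeakGradient w).congr_ae hvw.symm (ae_eq_refl _)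

theorem H1.eq_of_ae_eq (hU : IsOpen U) {v w : H1 U} (hvw : toFn v =ᵐ[volume.restrict U] toFn w) :
    v = w :=
  H1.ext' (Lp.ext hvw) (Lp.ext (H1.ae_weakGrad_eq hU subset_rfl v w hvw))

/-! ### Traces -/

theorem hasTrace_iff (hU : Bornology.IsBounded U) {ν : Measure (E N)} {v : H1 U} {t : Lp ℝ 2 ν} :
    HasTrace ν v t ↔ ∃ φ : ℕ → E N → ℝ, (∀ n, ContDiff ℝ ∞ (φ n)) ∧
      Tendsto (fun n => eLpNorm (fun x => φ n x - toFn v x) 2 (volume.restrict U)) atTop (𝓝 0) ∧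
      Tendsto (fun n => eLpNorm (fun x => gradient (φ n) x - weakGrad v x) 2
        (volume.restrict U)) atTop (𝓝 0) ∧
      Tendsto (fun n => eLpNorm (fun x => φ n x - t x) 2 ν) atTop (𝓝 0) := by
  constructor
  · rintro ⟨φ, V, h1, h2, h3, h4, h5⟩
    rw [H1.tendsto_iff, Lp.tendsto_Lp_iff_tendsto_eLpNorm', Lp.tendsto_Lp_iff_tendsto_eLpNorm']
      at h4
    refine ⟨φ, h1, h4.1.congr fun n => ?_, h4.2.congr fun n => ?_, h5⟩
    · exact eLpNorm_congr_ae ((h2 n).sub (ae_eq_refl _))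
    · exact eLpNorm_congr_ae ((h3 n).sub (ae_eq_refl _))
  · rintro ⟨φ, h1, h2, h3, h5⟩
    refine ⟨φ, fun n => ofSmooth hU (h1 n), h1, fun n => toFn_ofSmooth _ _,
      fun n => weakGrad_ofSmooth _ _, ?_, h5⟩
    rw [H1.tendsto_iff, Lp.tendsto_Lp_iff_tendsto_eLpNorm', Lp.tendsto_Lp_iff_tendsto_eLpNorm']
    refine ⟨h2.congr fun n => ?_, h3.congr fun n => ?_⟩
    · exact eLpNorm_congr_ae ((toFn_ofSmooth hU (h1 n)).symm.sub (ae_eq_refl _))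
    · exact eLpNorm_congr_ae ((weakGrad_ofSmooth hU (h1 n)).symm.sub (ae_eq_refl _))

end H1

/-! ### Inequalities along lines -/

theorem ennreal_add_sq_le (a b : ℝ≥0∞) : (a + b) ^ 2 ≤ 2 * a ^ 2 + 2 * b ^ 2 := by
  rw [← mul_add]
  induction a with
  | top => simp
  | coe a =>
    induction b with
    | top => simp
    | coe b => exact_mod_cast add_sq_le (a := a) (b := b)

theorem sq_lintegral_le {X : Type*} [MeasurableSpace X] (μ : Measure X) {f : X → ℝ≥0∞}
    (hf : AEMeasurable f μ) : (∫⁻ x, f x ∂μ) ^ 2 ≤ μ univ * ∫⁻ x, f x ^ 2 ∂μ := by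
  have h := ENNReal.lintegral_mul_le_Lp_mul_Lq μ Real.HolderConjugate.two_two
    (f := fun _ => 1) (g := f) aemeasurable_const hf
  simp only [Pi.mul_apply, one_mul, ENNReal.one_rpow, lintegral_const] at h
  calc (∫⁻ x, f x ∂μ) ^ 2 ≤ (μ univ ^ (1 / 2 : ℝ) * (∫⁻ x, f x ^ (2 : ℝ) ∂μ) ^ (1 / 2 : ℝ)) ^ 2 := by
        gcongr
    _ = μ univ * ∫⁻ x, f x ^ 2 ∂μ := by
        rw [mul_pow, ← ENNReal.rpow_natCast, ← ENNReal.rpow_natCast, ← ENNReal.rpow_mul,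
          ← ENNReal.rpow_mul]
        norm_num

theorem enorm_sub_le_lintegral_gradient {N : ℕ} {ψ : E N → ℝ} (hψ : ContDiff ℝ ∞ ψ) (x d : E N)
    (hd : ‖d‖ = 1) {a b : ℝ} (hab : a ≤ b) :
    ‖ψ (x + b • d) - ψ (x + a • d)‖ₑ ≤ ∫⁻ σ in Icc a b, ‖gradient ψ (x + σ • d)‖ₑ := by
  have hc : ContDiff ℝ 1 fun σ : ℝ => ψ (x + σ • d) :=
    (hψ.of_le (by simp)).comp (contDiff_const.add (contDiff_id.smul contDiff_const))
  refine (enorm_sub_le_lintegral_deriv_of_contDiffOn_Icc hc.contDiffOn hab).trans ?_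
  refine lintegral_mono fun σ => ?_
  have h1 : HasDerivAt (fun σ : ℝ => x + σ • d) d σ := by
    simpa using ((hasDerivAt_id σ).smul_const d).const_add x
  have h2 : HasDerivAt (fun σ : ℝ => ψ (x + σ • d)) (fderiv ℝ ψ (x + σ • d) d) σ :=
    ((hψ.differentiable (by simp) _).hasFDerivAt).comp_hasDerivAt σ h1
  rw [h2.deriv, ← inner_gradient, enorm_le_iff_norm_le]
  calc ‖inner ℝ (gradient ψ (x + σ • d)) d‖ ≤ ‖gradient ψ (x + σ • d)‖ * ‖d‖ :=
        norm_inner_le_norm _ _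
    _ = _ := by rw [hd, mul_one]

theorem continuous_enorm_gradient_line {N : ℕ} {ψ : E N → ℝ} (hψ : ContDiff ℝ ∞ ψ) (x d : E N) :
    Continuous fun σ : ℝ => ‖gradient ψ (x + σ • d)‖ₑ :=
  continuous_enorm.comp ((continuous_gradient hψ).comp (by fun_prop))

theorem enorm_sub_sq_le {N : ℕ} {ψ : E N → ℝ} (hψ : ContDiff ℝ ∞ ψ) (x d : E N)
    (hd : ‖d‖ = 1) {s : ℝ} (hs : 0 ≤ s) :
    ‖ψ (x + s • d) - ψ x‖ₑ ^ 2 ≤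
      ENNReal.ofReal s * ∫⁻ σ in Icc 0 s, ‖gradient ψ (x + σ • d)‖ₑ ^ 2 := by
  have h := enorm_sub_le_lintegral_gradient hψ x d hd hs
  rw [zero_smul, add_zero] at h
  refine (pow_le_pow_left' h 2).trans ?_
  refine (sq_lintegral_le _ (continuous_enorm_gradient_line hψ x d).measurable.aemeasurable).trans ?_
  simp

theorem enorm_sq_le_add {N : ℕ} {ψ : E N → ℝ} (hψ : ContDiff ℝ ∞ ψ) (x d : E N)
    (hd : ‖d‖ = 1) {s : ℝ} (hs : 0 ≤ s) :
    ‖ψ (x + s • d)‖ₑ ^ 2 ≤ 2 * ‖ψ x‖ₑ ^ 2 +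
      2 * (ENNReal.ofReal s * ∫⁻ σ in Icc 0 s, ‖gradient ψ (x + σ • d)‖ₑ ^ 2) := by
  have h1 : ‖ψ (x + s • d)‖ₑ ≤ ‖ψ x‖ₑ + ‖ψ (x + s • d) - ψ x‖ₑ := by
    have := enorm_add_le (ψ x) (ψ (x + s • d) - ψ x)
    simpa using this
  refine (pow_le_pow_left' h1 2).trans ((ennreal_add_sq_le _ _).trans ?_)
  gcongr
  exact enorm_sub_sq_le hψ x d hd hs

theorem enorm_sq_le_add' {N : ℕ} {ψ : E N → ℝ} (hψ : ContDiff ℝ ∞ ψ) (x d : E N)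
    (hd : ‖d‖ = 1) {s : ℝ} (hs : 0 ≤ s) :
    ‖ψ x‖ₑ ^ 2 ≤ 2 * ‖ψ (x + s • d)‖ₑ ^ 2 +
      2 * (ENNReal.ofReal s * ∫⁻ σ in Icc 0 s, ‖gradient ψ (x + σ • d)‖ₑ ^ 2) := by
  have h1 : ‖ψ x‖ₑ ≤ ‖ψ (x + s • d)‖ₑ + ‖ψ (x + s • d) - ψ x‖ₑ := by
    have := enorm_sub_le (a := ψ (x + s • d)) (b := ψ (x + s • d) - ψ x)
    simpa using this
  refine (pow_le_pow_left' h1 2).trans ((ennreal_add_sq_le _ _).trans ?_)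
  gcongr
  exact enorm_sub_sq_le hψ x d hd hs

/-- The square of the `H¹(U)` norm of a smooth function. -/
noncomputable def energy {N : ℕ} (U : Set (E N)) (ψ : E N → ℝ) : ℝ≥0∞ :=
  (∫⁻ x in U, ‖ψ x‖ₑ ^ 2) + ∫⁻ x in U, ‖gradient ψ x‖ₑ ^ 2

/-! ### Graph patches of the boundary -/

section Patch

variable {N : ℕ}

/-- `U` is, in the ball of radius `ρ` around `p`, the strict subgraph of `φ` in direction `e`. -/
structure IsPatch (U : Set (E N)) (p e : E N) (φ : E N → ℝ) (ρ : ℝ) : Prop where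
  norm_e : ‖e‖ = 1
  smooth : ContDiff ℝ ∞ φ
  inv : ∀ (x : E N) (s : ℝ), φ (x + s • e) = φ x
  pos : 0 < ρ
  mem_iff : ∀ x ∈ Metric.ball p ρ, (x ∈ U ↔ inner ℝ e x < φ x)

theorem IsSmoothBoundedDomain.exists_patch {Ω : Set (E N)} (hΩ : IsSmoothBoundedDomain Ω)
    {p : E N} (hp : p ∈ frontier Ω) : ∃ e φ ρ, IsPatch Ω p e φ ρ := by
  obtain ⟨e, φ, h1, h2, h3, h4⟩ := hΩ.smooth_boundary p hp
  obtain ⟨ρ, hρ, h⟩ := Metric.eventually_nhds_iff_ball.1 h4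
  exact ⟨e, φ, ρ, h1, h2, h3, hρ, h⟩

variable {U : Set (E N)} {p e : E N} {φ : E N → ℝ} {ρ : ℝ}

theorem IsPatch.inner_add_smul (h : IsPatch U p e φ ρ) (x : E N) (s : ℝ) :
    inner ℝ e (x + s • e) = inner ℝ e x + s := by
  rw [inner_add_right, inner_smul_right, real_inner_self_eq_norm_sq, h.norm_e]; ring

theorem IsPatch.inner_eq_of_mem_frontier (h : IsPatch U p e φ ρ) (hU : IsOpen U) {x : E N}
    (hx : x ∈ frontier U) (hxp : x ∈ Metric.ball p ρ) : inner ℝ e x = φ x := by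
  have hxU : x ∉ U := by
    rw [hU.frontier_eq] at hx; exact hx.2
  refine le_antisymm ?_ (not_lt.1 fun hlt => hxU ((h.mem_iff x hxp).2 hlt))
  by_contra hlt
  rw [not_le] at hlt
  have hopen : IsOpen (Metric.ball p ρ ∩ {y | φ y < inner ℝ e y}) :=
    Metric.isOpen_ball.inter (isOpen_lt h.smooth.continuous (by fun_prop))
  obtain ⟨y, hy1, hy2⟩ := mem_closure_iff.1 (frontier_subset_closure hx) _ hopen ⟨hxp, hlt⟩
  exact absurd ((h.mem_iff y hy1.1).1 hy2) (not_lt.2 (le_of_lt hy1.2))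

/-- The projection onto the graph along its direction. -/
noncomputable def graphProj (e : E N) (φ : E N → ℝ) (x : E N) : E N :=
  x + (φ x - inner ℝ e x) • e

theorem IsPatch.contDiff_graphProj (h : IsPatch U p e φ ρ) : ContDiff ℝ ∞ (graphProj e φ) :=
  contDiff_id.add ((h.smooth.sub (contDiff_const.inner ℝ contDiff_id)).smul contDiff_const)

/-- The points below the graph that lie in a slab and are projected into `A`. -/
def slab (p e : E N) (φ : E N → ℝ) (R : ℝ) (A : Set (E N)) : Set (E N) :=
  {y | inner ℝ e y ∈ Ioo (inner ℝ e p - 3 * R) (inner ℝ e p - 2 * R) ∧ graphProj e φ y ∈ A}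

theorem IsPatch.measurableSet_slab (h : IsPatch U p e φ ρ) (R : ℝ) {A : Set (E N)}
    (hA : MeasurableSet A) : MeasurableSet (slab p e φ R A) :=
  (measurableSet_Ioo.preimage (by fun_prop : Measurable fun y : E N => inner ℝ e y)).inter
    (hA.preimage h.contDiff_graphProj.continuous.measurable)

/-- Each slice of the slab at fixed height is carried onto all of `A` by the Lipschitz map
`graphProj e φ`, so the surface of `A` is at most a constant times the measure of that slice.
Averaging over heights in an interval of length `R` turns slices into volume. This bounds the
Hausdorff measure of the graph without an area formula. -/
theorem IsPatch.exists_surface_le (h : IsPatch U p e φ ρ) {R : ℝ} (hR : 0 < R) :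
    ∃ C : ℝ≥0∞, C ≠ ⊤ ∧ ∀ A : Set (E N), MeasurableSet A → A ⊆ Metric.ball p R →
      (∀ a ∈ A, inner ℝ e a = φ a) →
      (μHE[N - 1] : Measure (E N)) A ≤ C * volume (slab p e φ R A) := by
  -- A point of `A` is within `R` of `p`, and moving it to a height of the slab shifts it by at most
  -- `4 * R`. The radius `5 * R` therefore contains all preimages that are used.
  obtain ⟨K, hK⟩ := (h.contDiff_graphProj.contDiffOn (s := Metric.closedBall p (5 * R))
    ).exists_lipschitzOnWith (by simp) (convex_closedBall p (5 * R)) (isCompact_closedBall p _)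
  refine ⟨(K : ℝ≥0∞) ^ ((N - 1 : ℕ) : ℝ) * (ENNReal.ofReal R)⁻¹, ?_, ?_⟩
  · refine ENNReal.mul_ne_top (ENNReal.rpow_ne_top_of_nonneg (by positivity) ENNReal.coe_ne_top) ?_
    simpa using hR
  intro A hA hAR hAφ
  have he0 : e ≠ 0 := fun h0 => by simpa [h0] using h.norm_e
  have hfin : Module.finrank ℝ (E N) = N := by simp
  have hvol : volume (slab p e φ R A) = ∫⁻ x : ℝ, (μHE[N - 1] : Measure (E N))
      (slab p e φ R A ∩ AffineSubspace.mk' (x • e +ᵥ (0 : E N)) (ℝ ∙ e)ᗮ) := by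
    have := EuclideanGeometry.euclideanHausdorffMeasure_eq_lintegral (V := E N) (0 : E N) he0
      (h.measurableSet_slab R hA)
    rw [InnerProductSpace.euclideanHausdorffMeasure_eq_volume, hfin] at this
    rw [this, ← ofReal_norm, h.norm_e]
    simp
  have hslice : ∀ x ∈ Ioo (inner ℝ e p - 3 * R) (inner ℝ e p - 2 * R),
      (μHE[N - 1] : Measure (E N)) A ≤ (K : ℝ≥0∞) ^ ((N - 1 : ℕ) : ℝ) *
      (μHE[N - 1] : Measure (E N))
        (slab p e φ R A ∩ AffineSubspace.mk' (x • e +ᵥ (0 : E N)) (ℝ ∙ e)ᗮ) := by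
    intro x hx
    set T := slab p e φ R A ∩ AffineSubspace.mk' (x • e +ᵥ (0 : E N)) (ℝ ∙ e)ᗮ with hT
    have hsub : A ⊆ graphProj e φ '' (T ∩ Metric.closedBall p (5 * R)) := by
      intro a ha
      have hap := hAR ha
      rw [Metric.mem_ball, dist_eq_norm] at hap
      have hin : |inner ℝ e a - inner ℝ e p| < R := by
        rw [← inner_sub_right]
        calc |inner ℝ e (a - p)| ≤ ‖e‖ * ‖a - p‖ := abs_real_inner_le_norm _ _
          _ < R := by rw [h.norm_e, one_mul]; exact hap
      rw [abs_lt] at hin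
      have hy1 : inner ℝ e (a + (x - inner ℝ e a) • e) = x := by
        rw [h.inner_add_smul]; ring
      have hy2 : graphProj e φ (a + (x - inner ℝ e a) • e) = a := by
        rw [graphProj, h.inv, hy1, ← hAφ a ha, add_assoc, ← add_smul]
        simp
      refine ⟨a + (x - inner ℝ e a) • e, ⟨⟨⟨by rw [hy1]; exact hx, by rw [hy2]; exact ha⟩, ?_⟩, ?_⟩,
        hy2⟩
      · rw [SetLike.mem_coe, AffineSubspace.mem_mk', Submodule.mem_orthogonal_singleton_iff_inner_right]
        simp only [vsub_eq_sub, vadd_eq_add, add_zero]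
        rw [inner_sub_right, hy1, inner_smul_right, real_inner_self_eq_norm_sq, h.norm_e]
        ring
      · rw [Metric.mem_closedBall, dist_eq_norm]
        calc ‖a + (x - inner ℝ e a) • e - p‖ = ‖(a - p) + (x - inner ℝ e a) • e‖ := by congr 1; abel
          _ ≤ ‖a - p‖ + ‖(x - inner ℝ e a) • e‖ := norm_add_le _ _
          _ = ‖a - p‖ + |x - inner ℝ e a| := by rw [norm_smul, h.norm_e, mul_one, Real.norm_eq_abs]
          _ ≤ R + 4 * R := by
            refine add_le_add hap.le (abs_le.2 ⟨?_, ?_⟩) <;> linarith [hx.1, hx.2]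
          _ = 5 * R := by ring
    calc (μHE[N - 1] : Measure (E N)) A
        ≤ (μHE[N - 1] : Measure (E N)) (graphProj e φ '' (T ∩ Metric.closedBall p (5 * R))) :=
          measure_mono hsub
      _ ≤ (K : ℝ≥0∞) ^ ((N - 1 : ℕ) : ℝ) *
          (μHE[N - 1] : Measure (E N)) (T ∩ Metric.closedBall p (5 * R)) := by
          rw [Measure.euclideanHausdorffMeasure_def, Measure.smul_apply, Measure.smul_apply,
            ENNReal.smul_def, ENNReal.smul_def, smul_eq_mul, smul_eq_mul, mul_left_comm]
          gcongr
          exact (hK.mono inter_subset_right).hausdorffMeasure_image_le (by positivity)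
      _ ≤ _ := by gcongr; exact inter_subset_left
  have hRne : ENNReal.ofReal R ≠ 0 := by simpa using hR
  have hKne : (K : ℝ≥0∞) ^ ((N - 1 : ℕ) : ℝ) ≠ ⊤ :=
    ENNReal.rpow_ne_top_of_nonneg (by positivity) ENNReal.coe_ne_top
  have hmain : ENNReal.ofReal R * (μHE[N - 1] : Measure (E N)) A ≤
      (K : ℝ≥0∞) ^ ((N - 1 : ℕ) : ℝ) * volume (slab p e φ R A) := by
    calc ENNReal.ofReal R * (μHE[N - 1] : Measure (E N)) A
        = ∫⁻ _ in Ioo (inner ℝ e p - 3 * R) (inner ℝ e p - 2 * R),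
            (μHE[N - 1] : Measure (E N)) A := by
          rw [setLIntegral_const, Real.volume_Ioo, mul_comm]
          congr 2; ring
      _ ≤ ∫⁻ x in Ioo (inner ℝ e p - 3 * R) (inner ℝ e p - 2 * R),
            (K : ℝ≥0∞) ^ ((N - 1 : ℕ) : ℝ) * (μHE[N - 1] : Measure (E N))
              (slab p e φ R A ∩ AffineSubspace.mk' (x • e +ᵥ (0 : E N)) (ℝ ∙ e)ᗮ) :=
          setLIntegral_mono' measurableSet_Ioo hslice
      _ ≤ _ := by
          refine (setLIntegral_le_lintegral _ _).trans ?_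
          rw [lintegral_const_mul' _ _ hKne, hvol]
  calc (μHE[N - 1] : Measure (E N)) A
      = (ENNReal.ofReal R)⁻¹ * (ENNReal.ofReal R * (μHE[N - 1] : Measure (E N)) A) := by
        rw [← mul_assoc, ENNReal.inv_mul_cancel hRne ENNReal.ofReal_ne_top, one_mul]
    _ ≤ (ENNReal.ofReal R)⁻¹ * ((K : ℝ≥0∞) ^ ((N - 1 : ℕ) : ℝ) * volume (slab p e φ R A)) := by
        gcongr
    _ = _ := by ring

/-- The bound for sets is an inequality between the surface measure and the image of the volume
under the projection, and such an inequality can be integrated. -/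
theorem IsPatch.exists_lintegral_surface_le (h : IsPatch U p e φ ρ) {R : ℝ}
    (hR : 0 < R) :
    ∃ C : ℝ≥0∞, C ≠ ⊤ ∧ ∀ A : Set (E N), MeasurableSet A → A ⊆ Metric.ball p R →
      (∀ a ∈ A, inner ℝ e a = φ a) → ∀ F : E N → ℝ≥0∞,
      ∫⁻ a in A, F a ∂(μHE[N - 1] : Measure (E N)) ≤
        C * ∫⁻ y in slab p e φ R A, F (graphProj e φ y) := by
  obtain ⟨C, hC, hle⟩ := h.exists_surface_le hR
  refine ⟨C, hC, fun A hA hAR hAφ F => ?_⟩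
  have hm := h.contDiff_graphProj.continuous.measurable
  have hmeas : (μHE[N - 1] : Measure (E N)).restrict A ≤
      C • (volume.restrict (slab p e φ R A)).map (graphProj e φ) := by
    rw [Measure.le_iff]
    intro s hs
    rw [Measure.restrict_apply hs, Measure.smul_apply, Measure.map_apply hm hs,
      Measure.restrict_apply (hm hs), smul_eq_mul]
    refine (hle (s ∩ A) (hs.inter hA) (inter_subset_right.trans hAR)
      fun a ha => hAφ a ha.2).trans ?_
    gcongr
    exact fun y hy => ⟨hy.2.1, hy.1, hy.2.2⟩
  calc ∫⁻ a in A, F a ∂(μHE[N - 1] : Measure (E N))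
      ≤ ∫⁻ a, F a ∂(C • (volume.restrict (slab p e φ R A)).map (graphProj e φ)) :=
        lintegral_mono' hmeas le_rfl
    _ = C * ∫⁻ a, F a ∂((volume.restrict (slab p e φ R A)).map (graphProj e φ)) := by
        rw [lintegral_smul_measure, smul_eq_mul]
    _ ≤ _ := mul_le_mul_right (lintegral_map_le F _) C

theorem lintegral_shift_le {G : E N → ℝ≥0∞} (hG : Measurable G) (e : E N) (I : Set ℝ) :
    ∫⁻ y, ∫⁻ σ in I, G (y + σ • e) = volume I * ∫⁻ y, G y := by
  rw [lintegral_lintegral_swap (μ := (volume : Measure (E N))) (ν := volume.restrict I)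
    (f := fun y σ => G (y + σ • e)) (by
    exact (hG.comp (by fun_prop : Measurable fun q : E N × ℝ => q.1 + q.2 • e)).aemeasurable)]
  simp_rw [fun σ : ℝ => lintegral_add_right_eq_self (μ := (volume : Measure (E N))) G (σ • e)]
  rw [setLIntegral_const, mul_comm]

/-- From a point of the slab, which lies strictly below the patch, follow the direction `e` up to
the graph. The boundary value is controlled by the value at the start and by the gradient along the
segment. Integration over the slab gives the trace inequality. With `R = ρ / 6` the segments stay in
the ball where `U` is a subgraph. -/
theorem IsPatch.exists_trace_le (hU : IsOpen U) (h : IsPatch U p e φ ρ) :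
    ∃ R > 0, ∃ C : ℝ≥0∞, C ≠ ⊤ ∧ ∀ ψ : E N → ℝ, ContDiff ℝ ∞ ψ →
      ∫⁻ a in frontier U ∩ Metric.ball p R, ‖ψ a‖ₑ ^ 2 ∂(μHE[N - 1] : Measure (E N)) ≤
        C * energy U ψ := by
  have hR : 0 < ρ / 6 := by have := h.pos; positivity
  obtain ⟨C, hC, hle⟩ := h.exists_lintegral_surface_le hR
  set R := ρ / 6 with hRdef
  set A := frontier U ∩ Metric.ball p R with hA
  have hAm : MeasurableSet A := isClosed_frontier.measurableSet.inter Metric.isOpen_ball.measurableSet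
  have hball : Metric.ball p R ⊆ Metric.ball p ρ := Metric.ball_subset_ball (by linarith [h.pos])
  have hAφ : ∀ a ∈ A, inner ℝ e a = φ a := fun a ha =>
    h.inner_eq_of_mem_frontier hU ha.1 (hball ha.2)
  refine ⟨R, hR, C * (2 + 2 * (ENNReal.ofReal (4 * R) * ENNReal.ofReal (4 * R))), ?_, ?_⟩
  · exact ENNReal.mul_ne_top hC (by finiteness)
  intro ψ hψ
  set W := slab p e φ R A with hW
  have hWm : MeasurableSet W := h.measurableSet_slab R hAm
  set G : E N → ℝ≥0∞ := U.indicator fun x => ‖gradient ψ x‖ₑ ^ 2 with hG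
  have hGm : Measurable G :=
    ((continuous_gradient hψ).enorm.measurable.pow_const 2).indicator hU.measurableSet
  -- points of the slab and the segments above them
  have hseg : ∀ y ∈ W, 0 ≤ φ y - inner ℝ e y ∧ φ y - inner ℝ e y ≤ 4 * R ∧
      ∀ σ ∈ Ico 0 (φ y - inner ℝ e y), y + σ • e ∈ U := by
    intro y hy
    set τ := φ y - inner ℝ e y with hτ
    have ha : y + τ • e ∈ A := hy.2
    have hap := ha.2
    rw [Metric.mem_ball, dist_eq_norm] at hap
    have hin : |inner ℝ e (y + τ • e) - inner ℝ e p| < R := by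
      rw [← inner_sub_right]
      calc |inner ℝ e (y + τ • e - p)| ≤ ‖e‖ * ‖y + τ • e - p‖ := abs_real_inner_le_norm _ _
        _ < R := by rw [h.norm_e, one_mul]; exact hap
    rw [h.inner_add_smul, abs_lt] at hin
    have hy1 := hy.1
    have h0 : 0 ≤ τ := by linarith [hy1.2]
    have h4 : τ ≤ 4 * R := by linarith [hy1.1]
    refine ⟨h0, h4, fun σ hσ => (h.mem_iff _ ?_).2 ?_⟩
    · rw [Metric.mem_ball, dist_eq_norm]
      calc ‖y + σ • e - p‖ = ‖(y + τ • e - p) - (τ - σ) • e‖ := by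
            congr 1; rw [sub_smul τ σ e]; clear_value τ; abel
        _ ≤ ‖y + τ • e - p‖ + ‖(τ - σ) • e‖ := norm_sub_le _ _
        _ = ‖y + τ • e - p‖ + |τ - σ| := by rw [norm_smul, h.norm_e, mul_one, Real.norm_eq_abs]
        _ < R + 5 * R := by
            refine add_lt_add_of_lt_of_le hap (abs_le.2 ⟨?_, ?_⟩) <;> linarith [hσ.1, hσ.2]
        _ = ρ := by rw [hRdef]; ring
    · rw [h.inv, h.inner_add_smul]; linarith [hσ.2]
  have hpt : ∀ y ∈ W, ‖ψ (graphProj e φ y)‖ₑ ^ 2 ≤ 2 * U.indicator (fun x => ‖ψ x‖ₑ ^ 2) y +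
      2 * (ENNReal.ofReal (4 * R) * ∫⁻ σ in Icc 0 (4 * R), G (y + σ • e)) := by
    intro y hy
    obtain ⟨h0, h4, hin⟩ := hseg y hy
    refine (enorm_sq_le_add hψ y e h.norm_e h0).trans ?_
    -- The segment could degenerate only if `y` were itself on the graph. Then `y ∈ A` would be at
    -- height above `inner ℝ e p - R`, whereas the slab is below `inner ℝ e p - 2 * R`.
    have hyU : y ∈ U := by
      rcases h0.eq_or_lt with h00 | h00
      · have ha : graphProj e φ y ∈ A := hy.2
        have : graphProj e φ y = y := by rw [graphProj, ← h00, zero_smul, add_zero]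
        rw [this] at ha
        have hin : |inner ℝ e y - inner ℝ e p| < R := by
          rw [← inner_sub_right]
          have hap := ha.2
          rw [Metric.mem_ball, dist_eq_norm] at hap
          calc |inner ℝ e (y - p)| ≤ ‖e‖ * ‖y - p‖ := abs_real_inner_le_norm _ _
            _ < R := by rw [h.norm_e, one_mul]; exact hap
        rw [abs_lt] at hin
        exact absurd hy.1.2 (by linarith)
      · have := hin 0 ⟨le_rfl, h00⟩
        simpa using this
    rw [indicator_of_mem hyU]
    refine add_le_add le_rfl (mul_le_mul_right (mul_le_mul' (ENNReal.ofReal_le_ofReal h4) ?_) 2)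
    -- The upper endpoint of the segment is on the boundary and not in `U`. Dropping it changes no
    -- integral.
    · rw [restrict_Ico_eq_restrict_Icc.symm]
      calc ∫⁻ σ in Ico 0 (φ y - inner ℝ e y), ‖gradient ψ (y + σ • e)‖ₑ ^ 2
          = ∫⁻ σ in Ico 0 (φ y - inner ℝ e y), G (y + σ • e) := by
            refine setLIntegral_congr_fun measurableSet_Ico fun σ hσ => ?_
            rw [hG, indicator_of_mem (hin σ hσ)]
        _ ≤ _ := lintegral_mono_set (Ico_subset_Icc_self.trans (Icc_subset_Icc_right h4))
  have hind : Measurable (U.indicator fun x => ‖ψ x‖ₑ ^ 2) :=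
    (hψ.continuous.enorm.measurable.pow_const 2).indicator hU.measurableSet
  calc ∫⁻ a in A, ‖ψ a‖ₑ ^ 2 ∂(μHE[N - 1] : Measure (E N))
      ≤ C * ∫⁻ y in W, ‖ψ (graphProj e φ y)‖ₑ ^ 2 := hle A hAm inter_subset_right hAφ _
    _ ≤ C * ∫⁻ y, (2 * U.indicator (fun x => ‖ψ x‖ₑ ^ 2) y +
          2 * (ENNReal.ofReal (4 * R) * ∫⁻ σ in Icc 0 (4 * R), G (y + σ • e))) := by
        exact mul_le_mul_right
          ((setLIntegral_mono' hWm hpt).trans (setLIntegral_le_lintegral _ _)) C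
    _ = C * (2 * (∫⁻ x in U, ‖ψ x‖ₑ ^ 2) + 2 * (ENNReal.ofReal (4 * R) *
          (ENNReal.ofReal (4 * R) * ∫⁻ x in U, ‖gradient ψ x‖ₑ ^ 2))) := by
        rw [lintegral_add_left (by fun_prop), lintegral_const_mul _ hind,
          lintegral_indicator hU.measurableSet, lintegral_const_mul' _ _ (by finiteness),
          lintegral_const_mul' _ _ (by finiteness), lintegral_shift_le hGm, Real.volume_Icc, sub_zero,
          hG, lintegral_indicator hU.measurableSet]
    _ ≤ _ := by
        rw [mul_assoc, energy]
        gcongr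
        rw [add_mul, mul_add, mul_add, add_assoc]
        have e1 : ∀ a b c d : ℝ≥0∞, a + d ≤ a + (b + (c + d)) := fun a b c d => by
          gcongr; exact le_add_left (le_add_left le_rfl)
        refine le_trans (le_of_eq ?_) (e1 _ _ _ _)
        ring

/-- The value at a point of the layer is bounded by averages of the function and its gradient over
the inward segment of length `R`. When this is integrated over the layer and the order of
integration exchanged, each point is counted only for shifts in an interval of length `δ`, which is
the origin of the small factor. -/
theorem IsPatch.exists_layer_le (hU : IsOpen U) (h : IsPatch U p e φ ρ) :
    ∃ R > 0, R ≤ ρ ∧ ∃ C : ℝ≥0∞, C ≠ ⊤ ∧ ∀ δ > 0, ∀ ψ : E N → ℝ, ContDiff ℝ ∞ ψ →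
      ∫⁻ x in U ∩ {x | x ∈ Metric.ball p R ∧ φ x - inner ℝ e x < δ}, ‖ψ x‖ₑ ^ 2 ≤
        C * ENNReal.ofReal δ * energy U ψ := by
  have hR : 0 < ρ / 6 := by have := h.pos; positivity
  set R := ρ / 6 with hRdef
  have hRne : ENNReal.ofReal R ≠ 0 := by simpa using hR
  set M : ℝ≥0∞ := 2 + 2 * (ENNReal.ofReal R * ENNReal.ofReal R) with hM
  refine ⟨R, hR, by linarith [h.pos], (ENNReal.ofReal R)⁻¹ * M, ?_, ?_⟩
  · exact ENNReal.mul_ne_top (by simpa using hR) (by finiteness)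
  intro δ hδ ψ hψ
  set Λ := U ∩ {x | x ∈ Metric.ball p R ∧ φ x - inner ℝ e x < δ} with hΛ
  have hΛm : MeasurableSet Λ := hU.measurableSet.inter (Metric.isOpen_ball.measurableSet.inter
    (isOpen_lt (h.smooth.continuous.sub (by fun_prop)) continuous_const).measurableSet)
  have hne : ‖-e‖ = 1 := by rw [norm_neg, h.norm_e]
  set G : E N → ℝ≥0∞ := U.indicator fun x => ‖ψ x‖ₑ ^ 2 + ‖gradient ψ x‖ₑ ^ 2 with hG
  have hGm : Measurable G :=
    ((hψ.continuous.enorm.measurable.pow_const 2).add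
      ((continuous_gradient hψ).enorm.measurable.pow_const 2)).indicator hU.measurableSet
  have hGE : ∫⁻ x, G x = energy U ψ := by
    rw [hG, lintegral_indicator hU.measurableSet, energy,
      lintegral_add_left (hψ.continuous.enorm.measurable.pow_const 2)]
  have hin : ∀ x ∈ Λ, ∀ s ∈ Icc 0 R, x + s • -e ∈ U := by
    intro x hx s hs
    have hxp := hx.2.1
    rw [Metric.mem_ball, dist_eq_norm] at hxp
    have hxρ : x ∈ Metric.ball p ρ := Metric.ball_subset_ball (by linarith [h.pos]) hx.2.1
    rw [show x + s • -e = x + (-s) • e by simp]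
    refine (h.mem_iff _ ?_).2 ?_
    · rw [Metric.mem_ball, dist_eq_norm]
      calc ‖x + (-s) • e - p‖ = ‖(x - p) + (-s) • e‖ := by congr 1; abel
        _ ≤ ‖x - p‖ + ‖(-s) • e‖ := norm_add_le _ _
        _ = ‖x - p‖ + s := by
          rw [norm_smul, h.norm_e, mul_one, Real.norm_eq_abs, abs_neg, abs_of_nonneg hs.1]
        _ < R + R := by linarith [hs.2]
        _ ≤ ρ := by rw [hRdef]; linarith [h.pos]
    · rw [h.inv, h.inner_add_smul]
      linarith [(h.mem_iff x hxρ).1 hx.1, hs.1]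
  have hpt : ∀ x ∈ Λ, ENNReal.ofReal R * ‖ψ x‖ₑ ^ 2 ≤ M * ∫⁻ s in Icc 0 R, G (x + s • -e) := by
    intro x hx
    set J := ∫⁻ s in Icc 0 R, G (x + s • -e) with hJ
    have h1 : ∀ s ∈ Icc 0 R, ‖ψ x‖ₑ ^ 2 ≤ 2 * G (x + s • -e) + 2 * (ENNReal.ofReal R * J) := by
      intro s hs
      refine (enorm_sq_le_add' hψ x (-e) hne hs.1).trans ?_
      refine add_le_add (mul_le_mul_right ?_ 2)
        (mul_le_mul_right (mul_le_mul' (ENNReal.ofReal_le_ofReal hs.2) ?_) 2)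
      · rw [hG, indicator_of_mem (hin x hx s hs)]
        exact le_self_add
      · calc ∫⁻ σ in Icc 0 s, ‖gradient ψ (x + σ • -e)‖ₑ ^ 2
            ≤ ∫⁻ σ in Icc 0 s, G (x + σ • -e) := by
              refine setLIntegral_mono' measurableSet_Icc fun σ hσ => ?_
              rw [hG, indicator_of_mem (hin x hx σ ⟨hσ.1, hσ.2.trans hs.2⟩)]
              exact le_add_self
          _ ≤ J := lintegral_mono_set (Icc_subset_Icc_right hs.2)
    calc ENNReal.ofReal R * ‖ψ x‖ₑ ^ 2 = ∫⁻ _ in Icc 0 R, ‖ψ x‖ₑ ^ 2 := by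
          rw [setLIntegral_const, Real.volume_Icc, sub_zero, mul_comm]
      _ ≤ ∫⁻ s in Icc 0 R, (2 * G (x + s • -e) + 2 * (ENNReal.ofReal R * J)) :=
          setLIntegral_mono' measurableSet_Icc h1
      _ = 2 * J + 2 * (ENNReal.ofReal R * J) * ENNReal.ofReal R := by
          rw [lintegral_add_right _ measurable_const, lintegral_const_mul' _ _ (by finiteness),
            setLIntegral_const, Real.volume_Icc, sub_zero]
      _ = M * J := by rw [hM]; ring
  have hmain : ENNReal.ofReal R * ∫⁻ x in Λ, ‖ψ x‖ₑ ^ 2 ≤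
      M * (ENNReal.ofReal δ * energy U ψ) := by
    rw [← lintegral_const_mul' _ _ ENNReal.ofReal_ne_top]
    refine (setLIntegral_mono' hΛm hpt).trans ?_
    rw [lintegral_const_mul' _ _ (by finiteness)]
    refine mul_le_mul_right ?_ M
    calc ∫⁻ x in Λ, ∫⁻ s in Icc 0 R, G (x + s • -e)
        = ∫⁻ x, ∫⁻ s in Icc 0 R, Λ.indicator 1 x * G (x + s • -e) := by
          rw [← lintegral_indicator hΛm]
          refine lintegral_congr fun x => ?_
          by_cases hx : x ∈ Λ <;> simp [hx]
      _ = ∫⁻ s in Icc 0 R, ∫⁻ x, Λ.indicator 1 x * G (x + s • -e) := by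
          rw [lintegral_lintegral_swap (μ := (volume : Measure (E N)))
            (ν := volume.restrict (Icc 0 R)) (f := fun x s => Λ.indicator 1 x * G (x + s • -e))]
          refine Measurable.aemeasurable (Measurable.mul ?_ ?_)
          · exact (measurable_one.indicator hΛm).comp measurable_fst
          · exact hGm.comp (by fun_prop : Measurable fun q : E N × ℝ => q.1 + q.2 • -e)
      _ = ∫⁻ s in Icc 0 R, ∫⁻ x, Λ.indicator 1 (x + s • e) * G x := by
          refine lintegral_congr fun s => ?_
          rw [← lintegral_add_right_eq_self (μ := (volume : Measure (E N)))
            (fun x => Λ.indicator 1 x * G (x + s • -e)) (s • e)]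
          refine lintegral_congr fun x => ?_
          congr 2
          rw [smul_neg]; abel
      _ = ∫⁻ x, ∫⁻ s in Icc 0 R, Λ.indicator 1 (x + s • e) * G x := by
          rw [lintegral_lintegral_swap (μ := (volume : Measure (E N)))
            (ν := volume.restrict (Icc 0 R)) (f := fun x s => Λ.indicator 1 (x + s • e) * G x)]
          refine Measurable.aemeasurable (Measurable.mul ?_ (hGm.comp measurable_fst))
          exact (measurable_one.indicator hΛm).comp
            (by fun_prop : Measurable fun q : E N × ℝ => q.1 + q.2 • e)
      -- A line in direction `e` meets the layer only for `0 < φ x - inner ℝ e x - s < δ`, since `φ`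
      -- does not vary along `e`.
      _ ≤ ∫⁻ x, ENNReal.ofReal δ * G x := by
          refine lintegral_mono fun x => ?_
          set a := φ x - inner ℝ e x with ha
          calc ∫⁻ s in Icc 0 R, Λ.indicator 1 (x + s • e) * G x
              ≤ ∫⁻ s, (Ioo (a - δ) a).indicator (fun _ => G x) s := by
                refine (setLIntegral_le_lintegral _ _).trans (lintegral_mono fun s => ?_)
                by_cases hs : x + s • e ∈ Λ
                · have h2 := hs.2.2
                  have h3 := (h.mem_iff _ (Metric.ball_subset_ball (by linarith [h.pos])
                    hs.2.1)).1 hs.1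
                  rw [h.inv, h.inner_add_smul] at h2 h3
                  have hs' : s ∈ Ioo (a - δ) a := ⟨by rw [ha]; linarith, by rw [ha]; linarith⟩
                  rw [indicator_of_mem hs, indicator_of_mem hs']
                  simp
                · simp [indicator_of_notMem hs]
            _ = ENNReal.ofReal δ * G x := by
                rw [lintegral_indicator measurableSet_Ioo, setLIntegral_const, Real.volume_Ioo,
                  mul_comm]
                congr 2; ring
      _ = ENNReal.ofReal δ * energy U ψ := by
          rw [lintegral_const_mul' _ _ (by finiteness), hGE]
  calc ∫⁻ x in Λ, ‖ψ x‖ₑ ^ 2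
      = (ENNReal.ofReal R)⁻¹ * (ENNReal.ofReal R * ∫⁻ x in Λ, ‖ψ x‖ₑ ^ 2) := by
        rw [← mul_assoc, ENNReal.inv_mul_cancel hRne ENNReal.ofReal_ne_top, one_mul]
    _ ≤ (ENNReal.ofReal R)⁻¹ * (M * (ENNReal.ofReal δ * energy U ψ)) := mul_le_mul_right hmain _
    _ = _ := by ring

end Patch

theorem isCompact_frontier {N : ℕ} {Ω : Set (E N)} (hΩ : IsSmoothBoundedDomain Ω) :
    IsCompact (frontier Ω) :=
  Metric.isCompact_of_isClosed_isBounded isClosed_frontier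
    (hΩ.isBounded.closure.subset frontier_subset_closure)

/-- Finitely many patches cover the compact boundary, and the property is monotone and stable under
unions with the constants added. -/
theorem exists_trace_le {N : ℕ} {Ω : Set (E N)} (hΩ : IsSmoothBoundedDomain Ω) :
    ∃ C : ℝ≥0∞, C ≠ ⊤ ∧ ∀ ψ : E N → ℝ, ContDiff ℝ ∞ ψ →
      ∫⁻ a, ‖ψ a‖ₑ ^ 2 ∂(outerSurface Ω) ≤ C * energy Ω ψ := by
  have := (isCompact_frontier hΩ).induction_on (p := fun s => ∃ C : ℝ≥0∞, C ≠ ⊤ ∧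
    ∀ ψ : E N → ℝ, ContDiff ℝ ∞ ψ →
      ∫⁻ a in s, ‖ψ a‖ₑ ^ 2 ∂(μHE[N - 1] : Measure (E N)) ≤ C * energy Ω ψ)
    ⟨0, by simp, by simp⟩
    (fun s t hst ⟨C, h1, h2⟩ => ⟨C, h1, fun ψ hψ => (lintegral_mono_set hst).trans (h2 ψ hψ)⟩)
    (fun s t ⟨C, h1, h2⟩ ⟨D, h3, h4⟩ => ⟨C + D, by finiteness, fun ψ hψ =>
      (lintegral_union_le _ _ _).trans (by rw [add_mul]; exact add_le_add (h2 ψ hψ) (h4 ψ hψ))⟩)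
    (fun p hp => by
      obtain ⟨e, φ, ρ, h⟩ := hΩ.exists_patch hp
      obtain ⟨R, hR, C, hC, hle⟩ := h.exists_trace_le hΩ.isOpen
      exact ⟨_, inter_mem self_mem_nhdsWithin
        (mem_nhdsWithin_of_mem_nhds (Metric.ball_mem_nhds p hR)), C, hC, hle⟩)
  exact this

theorem energy_const {N : ℕ} (U : Set (E N)) (c : ℝ) :
    energy U (fun _ => c) = ‖c‖ₑ ^ 2 * volume U := by
  have : ∀ x : E N, gradient (fun _ : E N => c) x = 0 := gradient_const' c
  simp [energy, this]

/-- The trace inequality for the constant function `1` bounds the area of the boundary by a multiple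
of the volume. -/
theorem isFiniteMeasure_outerSurface {N : ℕ} {Ω : Set (E N)}
    (hΩ : IsSmoothBoundedDomain Ω) : IsFiniteMeasure (outerSurface Ω) := by
  obtain ⟨C, hC, hle⟩ := exists_trace_le hΩ
  have := hle (fun _ => 1) contDiff_const
  rw [energy_const] at this
  simp only [enorm_one, one_pow, lintegral_const, one_mul] at this
  exact ⟨this.trans_lt (ENNReal.mul_lt_top hC.lt_top hΩ.isBounded.measure_lt_top)⟩

/-- A set of positive `N`-dimensional Hausdorff measure has infinite `(N-1)`-dimensional measure,
and the latter is finite here. Pointwise convergence of the Riemann sums almost everywhere depends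
on it. -/
theorem volume_frontier {N : ℕ} (hN : 1 ≤ N) {Ω : Set (E N)}
    (hΩ : IsSmoothBoundedDomain Ω) : volume (frontier Ω) = 0 := by
  have h := Measure.euclideanHausdorffMeasure_zero_or_top (X := E N) (d₁ := N - 1) (d₂ := N)
    (by omega) (frontier Ω)
  rw [EuclideanSpace.euclideanHausdorffMeasure_eq_volume] at h
  refine h.resolve_right fun htop => ?_
  have := (isFiniteMeasure_outerSurface hΩ).measure_univ_lt_top
  rw [outerSurface, Measure.restrict_apply_univ, htop] at this
  exact lt_irrefl _ this

theorem exists_compact_layer_le {N : ℕ} {Ω : Set (E N)} (hΩ : IsSmoothBoundedDomain Ω)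
    {η : ℝ≥0∞} (hη : 0 < η) : ∃ K : Set (E N), IsCompact K ∧ K ⊆ Ω ∧
      ∀ ψ : E N → ℝ, ContDiff ℝ ∞ ψ → ∫⁻ x in Ω \ K, ‖ψ x‖ₑ ^ 2 ≤ η * energy Ω ψ := by
  -- The statement is for all `η` at once, so that a union can give half of `η` to each part.
  have key := (isCompact_frontier hΩ).induction_on (p := fun s => ∀ η : ℝ≥0∞, 0 < η →
    ∃ V : Set (E N), IsOpen V ∧ s ⊆ V ∧ ∀ ψ : E N → ℝ, ContDiff ℝ ∞ ψ →
      ∫⁻ x in Ω ∩ V, ‖ψ x‖ₑ ^ 2 ≤ η * energy Ω ψ)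
    (fun η _ => ⟨∅, isOpen_empty, subset_rfl, by simp⟩)
    (fun s t hst h η hη => by
      obtain ⟨V, h1, h2, h3⟩ := h η hη
      exact ⟨V, h1, hst.trans h2, h3⟩)
    (fun s t h h' η hη => by
      obtain ⟨V, h1, h2, h3⟩ := h (η / 2) (ENNReal.half_pos hη.ne')
      obtain ⟨V', h1', h2', h3'⟩ := h' (η / 2) (ENNReal.half_pos hη.ne')
      refine ⟨V ∪ V', h1.union h1', union_subset_union h2 h2', fun ψ hψ => ?_⟩
      rw [inter_union_distrib_left]
      refine (lintegral_union_le _ _ _).trans ((add_le_add (h3 ψ hψ) (h3' ψ hψ)).trans ?_)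
      rw [← add_mul, ENNReal.add_halves])
    (fun p hp => by
      obtain ⟨e, φ, ρ, h⟩ := hΩ.exists_patch hp
      obtain ⟨R, hR, hRρ, C, hC, hle⟩ := h.exists_layer_le hΩ.isOpen
      refine ⟨_, inter_mem self_mem_nhdsWithin
        (mem_nhdsWithin_of_mem_nhds (Metric.ball_mem_nhds p hR)), fun η hη => ?_⟩
      obtain ⟨δ, hδ, hδη⟩ : ∃ δ : ℝ, 0 < δ ∧ C * ENNReal.ofReal δ ≤ η := by
        have ht : Tendsto (fun δ : ℝ => C * ENNReal.ofReal δ) (𝓝[>] 0) (𝓝 (C * 0)) := by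
          refine ENNReal.Tendsto.const_mul ?_ (Or.inr hC)
          have := (ENNReal.continuous_ofReal.tendsto 0).mono_left
            (nhdsWithin_le_nhds (s := Ioi (0 : ℝ)))
          simpa using this
        rw [mul_zero] at ht
        obtain ⟨δ, h1, h2⟩ := ((ht.eventually (gt_mem_nhds hη)).and self_mem_nhdsWithin).exists
        exact ⟨δ, h2, h1.le⟩
      refine ⟨{x | x ∈ Metric.ball p R ∧ φ x - inner ℝ e x < δ},
        Metric.isOpen_ball.inter (isOpen_lt (h.smooth.continuous.sub (by fun_prop))
          continuous_const), ?_, fun ψ hψ => (hle δ hδ ψ hψ).trans (mul_le_mul_left hδη _)⟩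
      rintro x ⟨hx1, hx2⟩
      refine ⟨hx2, ?_⟩
      rw [h.inner_eq_of_mem_frontier hΩ.isOpen hx1 (Metric.ball_subset_ball hRρ hx2), sub_self]
      exact hδ)
  obtain ⟨V, h1, h2, h3⟩ := key η hη
  refine ⟨closure Ω \ V, hΩ.isBounded.isCompact_closure.diff h1, ?_, fun ψ hψ => ?_⟩
  · rintro x ⟨hx1, hx2⟩
    by_contra hx
    exact hx2 (h2 (by rw [hΩ.isOpen.frontier_eq]; exact ⟨hx1, hx⟩))
  · refine (lintegral_mono_set ?_).trans (h3 ψ hψ)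
    rintro x ⟨hx1, hx2⟩
    exact ⟨hx1, by_contra fun hx => hx2 ⟨subset_closure hx1, hx⟩⟩

/-! ### Mollification -/

section Mollify

variable {N : ℕ} {F : Type*} [NormedAddCommGroup F] [NormedSpace ℝ F]

open scoped Manifold in
theorem exists_cutoff {K Ω : Set (E N)} (hK : IsCompact K) (hΩ : IsOpen Ω) (hKΩ : K ⊆ Ω) :
    ∃ χ : E N → ℝ, ContDiff ℝ ∞ χ ∧ HasCompactSupport χ ∧ tsupport χ ⊆ Ω ∧
      (∀ᶠ x in 𝓝ˢ K, χ x = 1) ∧ ∀ x, χ x ∈ Icc 0 1 := by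
  obtain ⟨L, hL, hKL, hLΩ⟩ := exists_compact_between hK hΩ hKΩ
  obtain ⟨f, hf1, hf0, hf⟩ := exists_contMDiffMap_one_nhds_of_subset_interior 𝓘(ℝ, E N)
    (n := (⊤ : ℕ∞)) hK.isClosed hKL
  have hsupp : tsupport f ⊆ L := closure_minimal
    (fun x hx => by_contra fun hxL => hx (hf0 x hxL)) hL.isClosed
  exact ⟨f, f.contMDiff.contDiff, hL.of_isClosed_subset (isClosed_tsupport _) hsupp,
    hsupp.trans hLΩ, hf1, hf⟩

/-- The mollification of `f` by `ρ`. -/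
noncomputable def mollify (ρ : E N → ℝ) (f : E N → F) (x : E N) : F := ∫ t, ρ t • f (x - t)

theorem mollify_eq_convolution (ρ : E N → ℝ) (f : E N → F) :
    mollify ρ f = convolution ρ f (ContinuousLinearMap.lsmul ℝ ℝ) volume := rfl

/-- This is the continuity at `0` of the action of translations on `L²`. With the convention of
`DomAddAct`, the element `-t` acts as `f ↦ f (· - t)`. -/
theorem tendsto_eLpNorm_translation {N : ℕ} {F : Type*} [NormedAddCommGroup F] {f : E N → F} (hf : MemLp f 2 volume) :
    Tendsto (fun t : E N => eLpNorm (fun x => f (x - t) - f x) 2 volume) (𝓝 0) (𝓝 0) := by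
  have : Fact ((2 : ℝ≥0∞) ≠ ⊤) := ⟨by norm_num⟩
  have hcont : Tendsto (fun t : E N => DomAddAct.mk (-t) +ᵥ hf.toLp f) (𝓝 0)
      (𝓝 (DomAddAct.mk (-(0 : E N)) +ᵥ hf.toLp f)) := by
    have : Continuous fun t : E N => DomAddAct.mk (-t) +ᵥ hf.toLp f :=
      (DomAddAct.continuous_mk.comp continuous_neg).vadd continuous_const
    exact this.tendsto 0
  rw [neg_zero, DomAddAct.mk_zero, zero_vadd, Lp.tendsto_Lp_iff_tendsto_eLpNorm'] at hcont
  refine hcont.congr fun t => eLpNorm_congr_ae ?_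
  have h1 := DomAddAct.vadd_Lp_ae_eq (DomAddAct.mk (-t)) (hf.toLp f)
  have h2 := (quasiMeasurePreserving_add_left (volume : Measure (E N)) (-t)).ae_eq_comp
    hf.coeFn_toLp
  filter_upwards [h1, h2, hf.coeFn_toLp] with x e1 e2 e3
  rw [Pi.sub_apply, e1, e3]
  have : (hf.toLp f) ((DomAddAct.mk.symm (DomAddAct.mk (-t))) +ᵥ x) = f (-t + x) := e2
  rw [this, neg_add_eq_sub]

theorem eLpNorm_two_sq {X F : Type*} [NormedAddCommGroup F] [MeasurableSpace X] (μ : Measure X)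
    (f : X → F) :
    eLpNorm f 2 μ ^ 2 = ∫⁻ x, ‖f x‖ₑ ^ 2 ∂μ := by
  rw [eLpNorm_eq_lintegral_rpow_enorm_toReal (by norm_num) (by norm_num), ← ENNReal.rpow_natCast,
    ← ENNReal.rpow_mul]
  norm_num

/-- The mollifier is the density of a probability measure `P`. Cauchy-Schwarz for `P` bounds the
squared difference by the mean of `‖f (x - t) - f x‖²`, and after exchanging the integrals only
translations in the support of the mollifier occur. -/
theorem eLpNorm_mollify_sub_le [CompleteSpace F] {f : E N → F} (hf : MemLp f 2 volume)
    (φ : ContDiffBump (0 : E N)) {η : ℝ≥0∞}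
    (hη : ∀ t ∈ Metric.ball (0 : E N) φ.rOut, eLpNorm (fun x => f (x - t) - f x) 2 volume ≤ η) :
    eLpNorm (fun x => mollify (φ.normed volume) f x - f x) 2 volume ≤ η := by
  set ρ := φ.normed volume with hρ
  have hρm : Measurable ρ := φ.continuous_normed.measurable
  have hρ1 : ∫⁻ t, ENNReal.ofReal (ρ t) = 1 := by
    rw [← ofReal_integral_eq_lintegral_ofReal φ.integrable_normed
      (Eventually.of_forall φ.nonneg_normed), φ.integral_normed, ENNReal.ofReal_one]
  set P := (volume : Measure (E N)).withDensity fun t => ENNReal.ofReal (ρ t) with hP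
  have hPuniv : P univ = 1 := by rw [hP, withDensity_apply _ MeasurableSet.univ]; simpa using hρ1
  have hfl : LocallyIntegrable f volume := hf.locallyIntegrable (by norm_num)
  have hjoint : AEStronglyMeasurable (fun q : E N × E N => f (q.1 - q.2) - f q.1)
      (volume.prod volume) := by
    have h1 : AEStronglyMeasurable (fun q : E N × E N => f (q.1 - q.2)) (volume.prod volume) :=
      hf.1.comp_quasiMeasurePreserving (quasiMeasurePreserving_sub volume volume)
    exact h1.sub hf.1.comp_fst
  have hpt : ∀ x, AEStronglyMeasurable (fun t => f (x - t) - f x) volume →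
      ‖mollify ρ f x - f x‖ₑ ^ 2 ≤ ∫⁻ t, ENNReal.ofReal (ρ t) * ‖f (x - t) - f x‖ₑ ^ 2 := by
    intro x hx
    have hi : Integrable (fun t => ρ t • f (x - t)) volume :=
      φ.hasCompactSupport_normed.convolutionExists_left (ContinuousLinearMap.lsmul ℝ ℝ)
        φ.continuous_normed hfl x
    have e1 : mollify ρ f x - f x = ∫ t, ρ t • (f (x - t) - f x) := by
      simp_rw [smul_sub]
      rw [integral_sub hi (φ.integrable_normed.smul_const _), integral_smul_const,
        φ.integral_normed, one_smul, mollify]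
    have e2 : ‖mollify ρ f x - f x‖ₑ ≤ ∫⁻ t, ‖f (x - t) - f x‖ₑ ∂P := by
      rw [e1, hP, lintegral_withDensity_eq_lintegral_mul₀ (by fun_prop) hx.enorm]
      refine (enorm_integral_le_lintegral_enorm _).trans (lintegral_mono fun t => ?_)
      rw [enorm_smul, Pi.mul_apply, Real.enorm_of_nonneg (φ.nonneg_normed t)]
    refine (pow_le_pow_left' e2 2).trans ?_
    refine (sq_lintegral_le P (hx.enorm.mono_ac (withDensity_absolutelyContinuous _ _))).trans ?_
    rw [hPuniv, one_mul, hP, lintegral_withDensity_eq_lintegral_mul₀ (by fun_prop)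
      (hx.enorm.pow_const 2)]
    rfl
  -- As `f` is only almost everywhere strongly measurable, the slices are measurable for almost
  -- every `x`, which suffices under the integral.
  have hsec : ∀ᵐ x ∂(volume : Measure (E N)),
      AEStronglyMeasurable (fun t => f (x - t) - f x) volume := hjoint.prodMk_left
  have hsq : eLpNorm (fun x => mollify ρ f x - f x) 2 volume ^ 2 ≤ η ^ 2 := by
    rw [eLpNorm_two_sq]
    calc ∫⁻ x, ‖mollify ρ f x - f x‖ₑ ^ 2
        ≤ ∫⁻ x, ∫⁻ t, ENNReal.ofReal (ρ t) * ‖f (x - t) - f x‖ₑ ^ 2 := by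
          refine lintegral_mono_ae ?_
          filter_upwards [hsec] with x hx using hpt x hx
      _ = ∫⁻ t, ∫⁻ x, ENNReal.ofReal (ρ t) * ‖f (x - t) - f x‖ₑ ^ 2 := by
          refine lintegral_lintegral_swap
            (f := fun x t => ENNReal.ofReal (ρ t) * ‖f (x - t) - f x‖ₑ ^ 2) ?_
          exact ((hρm.comp measurable_snd).ennreal_ofReal.aemeasurable).mul
            (hjoint.enorm.pow_const 2)
      _ ≤ ∫⁻ t, ENNReal.ofReal (ρ t) * η ^ 2 := by
          refine lintegral_mono fun t => ?_
          rw [lintegral_const_mul' _ _ ENNReal.ofReal_ne_top, ← eLpNorm_two_sq]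
          by_cases ht : t ∈ Metric.ball (0 : E N) φ.rOut
          · gcongr
            exact hη t ht
          · have : ρ t = 0 := by
              rw [← φ.support_normed_eq (μ := volume), Function.notMem_support] at ht
              exact ht
            simp [this]
      _ = η ^ 2 := by rw [lintegral_mul_const _ (by fun_prop), hρ1, one_mul]
  exact (ENNReal.pow_le_pow_left_iff two_ne_zero).1 hsq

theorem tendsto_eLpNorm_mollify [CompleteSpace F] {f : E N → F} (hf : MemLp f 2 volume)
    {φ : ℕ → ContDiffBump (0 : E N)} (hφ : Tendsto (fun n => (φ n).rOut) atTop (𝓝 0)) :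
    Tendsto (fun n => eLpNorm (fun x => mollify ((φ n).normed volume) f x - f x) 2 volume)
      atTop (𝓝 0) := by
  rw [ENNReal.tendsto_atTop_zero]
  intro η hη
  have h1 := (tendsto_eLpNorm_translation hf).eventually (ge_mem_nhds hη)
  obtain ⟨δ, hδ, h2⟩ := Metric.eventually_nhds_iff_ball.1 h1
  obtain ⟨n₀, hn₀⟩ := eventually_atTop.1 (hφ.eventually (gt_mem_nhds hδ))
  exact ⟨n₀, fun n hn => eLpNorm_mollify_sub_le hf (φ n) fun t ht =>
    h2 t (Metric.ball_subset_ball (hn₀ n hn).le ht)⟩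

theorem contDiff_mollify {f : E N → ℝ} (hf : LocallyIntegrable f volume)
    (φ : ContDiffBump (0 : E N)) : ContDiff ℝ ∞ (mollify (φ.normed volume) f) :=
  HasCompactSupport.contDiff_convolution_left (n := (⊤ : ℕ∞)) (ContinuousLinearMap.lsmul ℝ ℝ)
    φ.hasCompactSupport_normed φ.contDiff_normed hf

theorem fderiv_mollify_apply {f : E N → ℝ} (hf : LocallyIntegrable f volume) {ρ : E N → ℝ}
    (hρ : ContDiff ℝ ∞ ρ) (hρc : HasCompactSupport ρ) (x w : E N) :
    fderiv ℝ (mollify ρ f) x w = ∫ t, fderiv ℝ ρ t w * f (x - t) := by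
  have hd := hρc.hasFDerivAt_convolution_left (μ := volume) (ContinuousLinearMap.lsmul ℝ ℝ)
    (hρ.of_le (by simp)) hf x
  have hc : Continuous (fderiv ℝ ρ) := hρ.continuous_fderiv (by simp)
  have hi1 := HasCompactSupport.convolutionExists_left
    ((ContinuousLinearMap.lsmul ℝ ℝ).precompL (E N)) (hρc.fderiv ℝ) hc hf x
  unfold ConvolutionExistsAt at hi1
  rw [mollify_eq_convolution, hd.fderiv, convolution_def, ContinuousLinearMap.integral_apply hi1]
  refine integral_congr_ae (Eventually.of_forall fun t => ?_)
  simp only [ContinuousLinearMap.precompL_apply, ContinuousLinearMap.lsmul_apply, smul_eq_mul]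

theorem inner_mollify {G : E N → E N} (hG : LocallyIntegrable G volume) {ρ : E N → ℝ}
    (hρ : Continuous ρ) (hρc : HasCompactSupport ρ) (x w : E N) :
    inner ℝ (mollify ρ G x) w = ∫ t, ρ t * inner ℝ (G (x - t)) w := by
  have hi2 : Integrable (fun t => ρ t • G (x - t)) volume :=
    hρc.convolutionExists_left (ContinuousLinearMap.lsmul ℝ ℝ) hρ hG x
  rw [mollify, real_inner_comm, ← integral_inner hi2]
  refine integral_congr_ae (Eventually.of_forall fun t => ?_)
  simp only [inner_smul_right]
  rw [real_inner_comm]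

/-- The weak gradient is tested with `y ↦ ρ (x - y)`. The sign from the inner derivative cancels the
sign of the integration by parts. -/
theorem gradient_mollify {f : E N → ℝ} {G : E N → E N} (hf : LocallyIntegrable f volume)
    (hG : LocallyIntegrable G volume) (h : IsWeakGradient univ f G) {ρ : E N → ℝ}
    (hρs : ContDiff ℝ ∞ ρ) (hρc : HasCompactSupport ρ) (x : E N) :
    gradient (mollify ρ f) x = mollify ρ G x := by
  refine ext_inner_right ℝ fun w => ?_
  have hτ : ContDiff ℝ ∞ fun y => ρ (x - y) := hρs.comp (contDiff_const.sub contDiff_id)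
  have hτc : HasCompactSupport fun y => ρ (x - y) :=
    hρc.comp_homeomorph (Homeomorph.subLeft x)
  have hτd : ∀ y, fderiv ℝ (fun y => ρ (x - y)) y w = - fderiv ℝ ρ (x - y) w := by
    intro y
    have h1 : HasFDerivAt (fun y : E N => x - y) (-ContinuousLinearMap.id ℝ (E N)) y :=
      (hasFDerivAt_id y).const_sub x
    have h2 := ((hρs.differentiable (by simp) (x - y)).hasFDerivAt).comp y h1
    have h3 : fderiv ℝ (fun y => ρ (x - y)) y = _ := h2.fderiv
    rw [h3]
    simp
  have key := h _ hτ hτc (subset_univ _) w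
  simp_rw [hτd, setIntegral_univ, mul_neg, integral_neg, neg_inj] at key
  rw [inner_gradient, fderiv_mollify_apply hf hρs hρc, inner_mollify hG hρs.continuous hρc,
    ← integral_sub_left_eq_self (fun t => fderiv ℝ ρ t w * _) volume x,
    ← integral_sub_left_eq_self (fun t => ρ t * _) volume x]
  simp only [sub_sub_cancel]
  calc ∫ y, fderiv ℝ ρ (x - y) w * f y = ∫ y, f y * fderiv ℝ ρ (x - y) w := by
        simp only [mul_comm]
    _ = _ := by rw [key]; simp only [mul_comm]

/-- A cut-off of a function in `H¹(U)` has a weak gradient on the whole space. -/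
theorem isWeakGradient_cutoff {U : Set (E N)} (v : H1 U) {χ : E N → ℝ} (hχ : ContDiff ℝ ∞ χ)
    (hχc : HasCompactSupport χ) (hχU : tsupport χ ⊆ U) :
    IsWeakGradient univ (fun x => χ x * toFn v x)
      (fun x => χ x • weakGrad v x + toFn v x • gradient χ x) := by
  intro ψ hψ hc _ w
  have h0 : ∀ x, x ∉ U → χ x = 0 := fun x hx =>
    image_eq_zero_of_notMem_tsupport fun h => hx (hχU h)
  have h0' : ∀ x, x ∉ U → gradient χ x = 0 := fun x hx => by
    rw [gradient, image_eq_zero_of_notMem_tsupport (f := fderiv ℝ χ)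
      fun h => hx (hχU (tsupport_fderiv_subset ℝ h)), map_zero]
  -- For an arbitrary `ψ` on the whole space, `χ * ψ` is an admissible test function in `U`. The
  -- product rule moves the derivative of `χ` to the other side.
  have key := isWeakGradient v (fun x => χ x * ψ x) (hχ.mul hψ) (hχc.mul_right)
    ((tsupport_mul_subset_left).trans hχU) w
  have hd : ∀ x, fderiv ℝ (fun x => χ x * ψ x) x w
      = χ x * fderiv ℝ ψ x w + ψ x * inner ℝ (gradient χ x) w := by
    intro x
    rw [← inner_gradient, gradient_mul' hχ hψ, inner_add_left, inner_smul_left, inner_smul_left,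
      inner_gradient]
    rfl
  simp_rw [hd] at key
  have z1 : ∫ x in univ, χ x * toFn v x * fderiv ℝ ψ x w
      = ∫ x in U, χ x * toFn v x * fderiv ℝ ψ x w := by
    rw [setIntegral_univ]
    exact (setIntegral_eq_integral_of_forall_compl_eq_zero
      fun x hx => by rw [h0 x hx, zero_mul, zero_mul]).symm
  have z2 : ∫ x in univ, inner ℝ (χ x • weakGrad v x + toFn v x • gradient χ x) w * ψ x
      = ∫ x in U, inner ℝ (χ x • weakGrad v x + toFn v x • gradient χ x) w * ψ x := by
    rw [setIntegral_univ]
    exact (setIntegral_eq_integral_of_forall_compl_eq_zero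
      fun x hx => by rw [h0 x hx, h0' x hx]; simp).symm
  change ∫ x in univ, χ x * toFn v x * fderiv ℝ ψ x w
    = - ∫ x in univ, inner ℝ (χ x • weakGrad v x + toFn v x • gradient χ x) w * ψ x
  rw [z1, z2]
  have hgχ : Continuous fun x => ψ x * inner ℝ (gradient χ x) w :=
    hψ.continuous.mul ((continuous_gradient hχ).inner continuous_const)
  have i1 := integrable_mul_test (toFn v) (hχ.continuous.mul (continuous_fderiv_test hψ w))
    (hχc.mul_right (f' := fun x => fderiv ℝ ψ x w))
  have i2 := integrable_mul_test (toFn v) hgχ (hc.mul_right (f' := fun x => inner ℝ (gradient χ x) w))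
  have i3 := integrable_inner_mul_test (weakGrad v) (hχ.continuous.mul hψ.continuous)
    (hχc.mul_right (f' := ψ)) w
  simp_rw [mul_add] at key
  simp only [Pi.mul_apply] at i1 i3
  rw [integral_add i1 i2] at key
  have e1 : ∫ x in U, χ x * toFn v x * fderiv ℝ ψ x w
      = ∫ x in U, toFn v x * (χ x * fderiv ℝ ψ x w) := by
    congr 1; ext x; ring
  have e2 : ∫ x in U, inner ℝ (χ x • weakGrad v x + toFn v x • gradient χ x) w * ψ x
      = ∫ x in U, (inner ℝ (weakGrad v x) w * (χ x * ψ x)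
        + toFn v x * (ψ x * inner ℝ (gradient χ x) w)) := by
    congr 1; ext x
    rw [inner_add_left, inner_smul_left, inner_smul_left]
    simp only [conj_trivial]
    ring
  rw [e1, e2, integral_add i3 i2]
  linarith

theorem memLp_continuous_mul {X : Type*} [MeasurableSpace X] {μ : Measure X}
    {a : X → ℝ} {f : X → F} (ha : MemLp a ⊤ μ) (hf : MemLp f 2 μ) :
    MemLp (fun x => a x • f x) 2 μ := hf.smul ha

theorem memLp_top_of_hasCompactSupport {G : Type*} [NormedAddCommGroup G] {μ : Measure (E N)}
    {a : E N → G} (ha : Continuous a) (hc : HasCompactSupport a) : MemLp a ⊤ μ := by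
  obtain ⟨C, hC⟩ := hc.exists_bound_of_continuous ha
  exact memLp_top_of_bound ha.aestronglyMeasurable C (Eventually.of_forall hC)

theorem memLp_volume_of_restrict {N : ℕ} {F : Type*} [NormedAddCommGroup F] {U : Set (E N)} (hU : MeasurableSet U) {f : E N → F}
    (hf : MemLp f 2 (volume.restrict U)) (h0 : ∀ x, x ∉ U → f x = 0) : MemLp f 2 volume := by
  have : f = U.indicator f := by
    ext x
    by_cases hx : x ∈ U
    · rw [indicator_of_mem hx]
    · rw [indicator_of_notMem hx, h0 x hx]
  rw [this, memLp_indicator_iff_restrict hU]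
  exact hf

/-- The cut-off function, extended by zero, is mollified. Once the radius is below the distance from
the support of `χ` to the complement of `U`, the approximants vanish off `U` and so contribute no
boundary values. -/
theorem exists_smooth_cutoff_approx {U : Set (E N)} (hU : IsOpen U) (v : H1 U) {χ : E N → ℝ}
    (hχ : ContDiff ℝ ∞ χ) (hχc : HasCompactSupport χ) (hχU : tsupport χ ⊆ U) :
    ∃ ψ : ℕ → E N → ℝ, (∀ n, ContDiff ℝ ∞ (ψ n)) ∧
      Tendsto (fun n => eLpNorm (fun x => ψ n x - χ x * toFn v x) 2 (volume.restrict U))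
        atTop (𝓝 0) ∧
      Tendsto (fun n => eLpNorm (fun x => gradient (ψ n) x -
        (χ x • weakGrad v x + toFn v x • gradient χ x)) 2 (volume.restrict U)) atTop (𝓝 0) ∧
      ∀ᶠ n in atTop, ∀ x ∉ U, ψ n x = 0 := by
  set f : E N → ℝ := fun x => χ x * toFn v x with hf
  set G : E N → E N := fun x => χ x • weakGrad v x + toFn v x • gradient χ x with hG
  have h0 : ∀ x, x ∉ U → χ x = 0 := fun x hx =>
    image_eq_zero_of_notMem_tsupport fun h => hx (hχU h)
  have h0' : ∀ x, x ∉ U → gradient χ x = 0 := fun x hx => by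
    rw [gradient, image_eq_zero_of_notMem_tsupport (f := fderiv ℝ χ)
      fun h => hx (hχU (tsupport_fderiv_subset ℝ h)), map_zero]
  have hgc : HasCompactSupport (gradient χ) := by
    have := (hχc.fderiv ℝ).comp_left (g := (InnerProductSpace.toDual ℝ (E N)).symm) (map_zero _)
    exact this
  have hfm : MemLp f 2 volume := by
    refine memLp_volume_of_restrict hU.measurableSet ?_ fun x hx => by simp [hf, h0 x hx]
    exact memLp_continuous_mul (memLp_top_of_hasCompactSupport hχ.continuous hχc) (Lp.memLp (toFn v))
  have hGm : MemLp G 2 volume := by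
    refine memLp_volume_of_restrict hU.measurableSet ?_ fun x hx => by
      simp [hG, h0 x hx, h0' x hx]
    refine (memLp_continuous_mul (memLp_top_of_hasCompactSupport hχ.continuous hχc)
      (Lp.memLp (weakGrad v))).add ?_
    exact (memLp_top_of_hasCompactSupport (continuous_gradient hχ) hgc).smul (r := 2)
      (Lp.memLp (toFn v))
  have hwg := isWeakGradient_cutoff v hχ hχc hχU
  let φ : ℕ → ContDiffBump (0 : E N) := fun n =>
    ⟨1 / (n + 2 : ℝ), 1 / (n + 1 : ℝ), by positivity, by gcongr; norm_num⟩
  have hφ : Tendsto (fun n => (φ n).rOut) atTop (𝓝 0) := tendsto_one_div_add_atTop_nhds_zero_nat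
  have hgrad : ∀ n x, gradient (mollify ((φ n).normed volume) f) x
      = mollify ((φ n).normed volume) G x := fun n x =>
    gradient_mollify (hfm.locallyIntegrable (by norm_num)) (hGm.locallyIntegrable (by norm_num))
      hwg (φ n).contDiff_normed (φ n).hasCompactSupport_normed x
  refine ⟨fun n => mollify ((φ n).normed volume) f,
    fun n => contDiff_mollify (hfm.locallyIntegrable (by norm_num)) _, ?_, ?_, ?_⟩
  · exact tendsto_of_tendsto_of_tendsto_of_le_of_le tendsto_const_nhds
      (tendsto_eLpNorm_mollify hfm hφ) (fun n => zero_le)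
      (fun n => eLpNorm_mono_measure _ Measure.restrict_le_self)
  · simp_rw [hgrad]
    exact tendsto_of_tendsto_of_tendsto_of_le_of_le tendsto_const_nhds
      (tendsto_eLpNorm_mollify hGm hφ) (fun n => zero_le)
      (fun n => eLpNorm_mono_measure _ Measure.restrict_le_self)
  · obtain ⟨δ, hδ, hthick⟩ := hχc.exists_thickening_subset_open hU hχU
    filter_upwards [hφ.eventually (gt_mem_nhds hδ)] with n hn x hx
    rw [mollify]
    refine integral_eq_zero_of_ae (Eventually.of_forall fun t => ?_)
    by_cases ht : t ∈ Metric.ball (0 : E N) (φ n).rOut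
    · have : χ (x - t) = 0 := by
        refine image_eq_zero_of_notMem_tsupport fun hmem => hx (hthick ?_)
        refine Metric.mem_thickening_iff.2 ⟨x - t, hmem, ?_⟩
        rw [dist_eq_norm, sub_sub_cancel]
        rw [mem_ball_zero_iff] at ht
        exact ht.trans hn
      simp [hf, this]
    · rw [← (φ n).support_normed_eq (μ := volume), Function.notMem_support] at ht
      simp [ht]

theorem eLpNorm_restrict_le_of_eq_zero {F : Type*} [NormedAddCommGroup F] {Ω D : Set (E N)}
    (hD : MeasurableSet D) {f : E N → F} {g : E N → ℝ}
    (hf : ∀ x ∈ D, f x = 0) (hfg : ∀ᵐ x ∂volume.restrict (Ω \ D), ‖f x‖ ≤ g x) :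
    eLpNorm f 2 (volume.restrict Ω) ≤ eLpNorm g 2 (volume.restrict (Ω \ D)) := by
  have h1 : f = Dᶜ.indicator f := by
    ext x
    by_cases hx : x ∈ D
    · rw [indicator_of_notMem (by simpa using hx), hf x hx]
    · rw [indicator_of_mem (by simpa using hx)]
  rw [h1, eLpNorm_indicator_eq_eLpNorm_restrict hD.compl, Measure.restrict_restrict hD.compl,
    inter_comm, ← sdiff_eq]
  exact eLpNorm_mono_ae (hfg.mono fun x hx => hx.trans (le_abs_self _))

/-- If the restriction of `v ∈ H¹(Ω)` to the complement of a compact subset of `Ω` has a trace, then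
`v` has the same trace on the boundary of `Ω`. -/
theorem HasTrace.of_sdiff {Ω D : Set (E N)} (hΩ : IsOpen Ω) (hΩb : Bornology.IsBounded Ω)
    (hD : IsCompact D) (hDΩ : D ⊆ Ω) {v : H1 Ω} {w : H1 (Ω \ D)}
    (hvw : toFn v =ᵐ[volume.restrict (Ω \ D)] toFn w) {ν ν' : Measure (E N)} (hν : ν ≤ ν')
    (hν0 : ν (frontier Ω)ᶜ = 0) {t' : Lp ℝ 2 ν'} (hw : HasTrace ν' w t') {t : Lp ℝ 2 ν}
    (ht : t =ᵐ[ν] t') : HasTrace ν v t := by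
  have hUb : Bornology.IsBounded (Ω \ D) := hΩb.subset sdiff_subset
  have hUo : IsOpen (Ω \ D) := hΩ.sdiff hD.isClosed
  obtain ⟨φ, hφ, h1, h2, h3⟩ := (hasTrace_iff hUb).1 hw
  obtain ⟨χ, hχ, hχc, hχΩ, hχ1, hχI⟩ := exists_cutoff hD hΩ hDΩ
  obtain ⟨ψ, hψ, h4, h5, h6⟩ := exists_smooth_cutoff_approx hΩ v hχ hχc hχΩ
  have hvw' := H1.ae_weakGrad_eq hUo sdiff_subset v w hvw
  have hχD : ∀ x ∈ D, χ x = 1 := fun x hx => hχ1.self_of_nhdsSet x hx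
  have hχD' : ∀ x ∈ D, gradient χ x = 0 := fun x hx => by
    have : χ =ᶠ[𝓝 x] fun _ => 1 := (eventually_nhdsSet_iff_forall.1 hχ1) x hx
    rw [gradient, this.fderiv_eq]
    simp
  have hgc : HasCompactSupport (gradient χ) :=
    (hχc.fderiv ℝ).comp_left (g := (InnerProductSpace.toDual ℝ (E N)).symm) (map_zero _)
  obtain ⟨C, hC⟩ := hgc.exists_bound_of_continuous (continuous_gradient hχ)
  have h1χ : ContDiff ℝ ∞ fun x => 1 - χ x := contDiff_const.sub hχ
  have hg1χ : ∀ x, gradient (fun x => 1 - χ x) x = - gradient χ x := fun x => by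
    rw [gradient_sub' contDiff_const hχ, gradient_const', zero_sub]
  have h1χφ : ∀ n, ContDiff ℝ ∞ fun x => (1 - χ x) * φ n x := fun n => h1χ.mul (hφ n)
  have hae : ∀ n, AEStronglyMeasurable (φ n) volume := fun n =>
    (hφ n).continuous.aestronglyMeasurable
  have hgae : ∀ n, AEStronglyMeasurable (gradient (φ n)) volume := fun n =>
    (continuous_gradient (hφ n)).aestronglyMeasurable
  -- The approximants `φ n` of `w` are good only outside `D`. The factor `1 - χ` removes them near
  -- `D`, where the mollifications `ψ n` of `χ v` take over. On `∂Ω` the cut-off vanishes and `φ n`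
  -- alone remains, eventually in `n`.
  refine (hasTrace_iff hΩb).2 ⟨fun n x => (1 - χ x) * φ n x + ψ n x,
    fun n => (h1χφ n).add (hψ n), ?_, ?_, ?_⟩
  · refine tendsto_of_tendsto_of_tendsto_of_le_of_le tendsto_const_nhds
      (by simpa using h1.add h4) (fun n => zero_le) (fun n => ?_)
    have e : (fun x => (1 - χ x) * φ n x + ψ n x - toFn v x)
        = (fun x => (1 - χ x) * (φ n x - toFn v x)) + fun x => ψ n x - χ x * toFn v x := by
      ext x; simp only [Pi.add_apply]; ring
    rw [e]
    refine (eLpNorm_add_le ?_ ?_ (by norm_num)).trans (add_le_add ?_ le_rfl)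
    · exact h1χ.continuous.aestronglyMeasurable.mul
        ((hae n).restrict.sub (Lp.aestronglyMeasurable _))
    · exact (hψ n).continuous.aestronglyMeasurable.sub
        (hχ.continuous.aestronglyMeasurable.mul (Lp.aestronglyMeasurable _))
    · rw [← eLpNorm_norm (fun x => φ n x - toFn w x)]
      refine eLpNorm_restrict_le_of_eq_zero hD.isClosed.measurableSet
        (fun x hx => by rw [hχD x hx]; simp) ?_
      filter_upwards [hvw] with x hx
      rw [hx, norm_mul]
      refine mul_le_of_le_one_left (norm_nonneg _) ?_
      rw [Real.norm_eq_abs, abs_le]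
      constructor <;> linarith [(hχI x).1, (hχI x).2]
  · have hlim : Tendsto (fun n => (eLpNorm (fun x => gradient (φ n) x - weakGrad w x) 2
        (volume.restrict (Ω \ D)) + ENNReal.ofReal C *
        eLpNorm (fun x => φ n x - toFn w x) 2 (volume.restrict (Ω \ D)))
        + eLpNorm (fun x => gradient (ψ n) x - (χ x • weakGrad v x + toFn v x • gradient χ x)) 2
          (volume.restrict Ω)) atTop (𝓝 0) := by
      simpa using (h2.add (ENNReal.Tendsto.const_mul h1
        (Or.inr (ENNReal.ofReal_ne_top (r := C))))).add h5
    refine tendsto_of_tendsto_of_tendsto_of_le_of_le tendsto_const_nhds hlim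
      (fun n => zero_le) (fun n => ?_)
    have e : (fun x => gradient (fun x => (1 - χ x) * φ n x + ψ n x) x - weakGrad v x)
        = (fun x => (1 - χ x) • (gradient (φ n) x - weakGrad v x)
            - (φ n x - toFn v x) • gradient χ x)
          + fun x => gradient (ψ n) x - (χ x • weakGrad v x + toFn v x • gradient χ x) := by
      ext1 x
      simp only [Pi.add_apply]
      rw [gradient_add' (h1χφ n) (hψ n), gradient_mul' h1χ (hφ n), hg1χ]
      module
    rw [e]
    refine (eLpNorm_add_le ?_ ?_ (by norm_num)).trans (add_le_add ?_ le_rfl)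
    · exact (h1χ.continuous.aestronglyMeasurable.smul
        ((hgae n).restrict.sub (Lp.aestronglyMeasurable _))).sub
        (((hae n).restrict.sub (Lp.aestronglyMeasurable _)).smul
          (continuous_gradient hχ).aestronglyMeasurable)
    · exact (continuous_gradient (hψ n)).aestronglyMeasurable.sub
        ((hχ.continuous.aestronglyMeasurable.smul (Lp.aestronglyMeasurable _)).add
        ((Lp.aestronglyMeasurable (toFn v)).smul (continuous_gradient hχ).aestronglyMeasurable))
    · refine (eLpNorm_restrict_le_of_eq_zero hD.isClosed.measurableSet
        (g := (fun x => ‖gradient (φ n) x - weakGrad w x‖) + fun x => C * ‖φ n x - toFn w x‖)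
        (fun x hx => by rw [hχD x hx, hχD' x hx]; simp) ?_).trans
        ((eLpNorm_add_le ?_ ?_ (by norm_num)).trans (add_le_add ?_ ?_))
      · filter_upwards [hvw, hvw'] with x hx hx'
        rw [hx, hx']
        refine (norm_sub_le _ _).trans (add_le_add ?_ ?_)
        · rw [norm_smul]
          refine mul_le_of_le_one_left (norm_nonneg _) ?_
          rw [Real.norm_eq_abs, abs_le]
          constructor <;> linarith [(hχI x).1, (hχI x).2]
        · rw [norm_smul, mul_comm]
          exact mul_le_mul_of_nonneg_right (hC x) (norm_nonneg _)
      · exact ((hgae n).restrict.sub (Lp.aestronglyMeasurable _)).norm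
      · exact (((hae n).restrict.sub (Lp.aestronglyMeasurable _)).norm).const_mul C
      · rw [eLpNorm_norm]
      · refine (eLpNorm_const_smul_le (c := C)
          (f := fun x => ‖φ n x - toFn w x‖)).trans ?_
        rw [eLpNorm_norm, ← ofReal_norm C, Real.norm_of_nonneg ((norm_nonneg _).trans (hC 0))]
  · refine tendsto_of_tendsto_of_tendsto_of_le_of_le' tendsto_const_nhds h3
      (Eventually.of_forall fun n => zero_le) ?_
    filter_upwards [h6] with n hn
    refine le_trans (le_of_eq (eLpNorm_congr_ae ?_)) (eLpNorm_mono_measure _ hν)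
    have hfr : ∀ᵐ x ∂ν, x ∈ frontier Ω := hν0
    filter_upwards [hfr, ht] with x hx hxt
    have hxΩ : x ∉ Ω := by rw [hΩ.frontier_eq] at hx; exact hx.2
    rw [hn x hxΩ, hxt, image_eq_zero_of_notMem_tsupport fun h => hxΩ (hχΩ h)]
    ring

end Mollify

/-! ### The lattice `2 ε ℤ^N` -/

section Lattice

variable {N : ℕ}

open Classical in
/-- The basis `(2 ε e_i)` of `ℝ^N`, for `ε ≠ 0`. -/
noncomputable def gridBasis (N : ℕ) (ε : ℝ) : Module.Basis (Fin N) ℝ (E N) :=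
  (EuclideanSpace.basisFun (Fin N) ℝ).toBasis.unitsSMul fun _ =>
    if h : 2 * ε ≠ 0 then Units.mk0 (2 * ε) h else 1

/-- The lattice `2 ε ℤ^N`, for `ε ≠ 0`. -/
noncomputable abbrev grid (N : ℕ) (ε : ℝ) : Submodule ℤ (E N) :=
  Submodule.span ℤ (range (gridBasis N ε))

/-- The half-open cell `[0, 2 ε)^N`, for `ε > 0`. -/
noncomputable abbrev gridCell (N : ℕ) (ε : ℝ) : Set (E N) :=
  ZSpan.fundamentalDomain (gridBasis N ε)

theorem gridBasis_apply {ε : ℝ} (hε : 0 < ε) (i : Fin N) :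
    gridBasis N ε i = (2 * ε) • EuclideanSpace.basisFun (Fin N) ℝ i := by
  rw [gridBasis, Module.Basis.unitsSMul_apply, dif_pos (by positivity)]
  simp [Units.smul_def]

theorem gridBasis_repr {ε : ℝ} (hε : 0 < ε) (x : E N) (i : Fin N) :
    (gridBasis N ε).repr x i = (2 * ε)⁻¹ * x i := by
  rw [gridBasis, Module.Basis.repr_unitsSMul, dif_pos (by positivity)]
  simp [Units.smul_def]

theorem mem_grid_iff {ε : ℝ} (hε : 0 < ε) {x : E N} :
    x ∈ grid N ε ↔ ∃ z : Fin N → ℤ, ∀ i, x i = 2 * ε * (z i : ℝ) := by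
  rw [grid, Module.Basis.mem_span_iff_repr_mem]
  simp only [gridBasis_repr hε, mem_range, algebraMap_int_eq, eq_intCast]
  constructor
  · intro h
    choose z hz using h
    exact ⟨z, fun i => by rw [hz i]; field_simp⟩
  · rintro ⟨z, hz⟩ i
    exact ⟨z i, by rw [hz i]; field_simp⟩

theorem le_dist_of_mem_grid {ε : ℝ} (hε : 0 < ε) {x y : E N} (hx : x ∈ grid N ε)
    (hy : y ∈ grid N ε) (hxy : x ≠ y) : 2 * ε ≤ dist x y := by
  obtain ⟨z, hz⟩ := (mem_grid_iff hε).1 (sub_mem hx hy)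
  have : ∃ i, z i ≠ 0 := by
    by_contra! h0
    apply hxy
    rw [← sub_eq_zero]
    ext i
    rw [hz i, h0 i]; simp
  obtain ⟨i, hi⟩ := this
  rw [dist_eq_norm]
  refine le_trans ?_ (PiLp.norm_apply_le (x - y) i)
  rw [hz i, norm_mul, Real.norm_of_nonneg (by positivity), Real.norm_eq_abs, ← Int.cast_abs]
  have : (1 : ℝ) ≤ ((|z i| : ℤ) : ℝ) := by exact_mod_cast Int.one_le_abs hi
  nlinarith

theorem norm_le_of_mem_gridCell {ε : ℝ} (hε : 0 < ε) {x : E N} (hx : x ∈ gridCell N ε) :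
    ‖x‖ ≤ 2 * ε * N := by
  have h := ZSpan.norm_fract_le (gridBasis N ε) x
  rw [(ZSpan.fract_eq_self (b := gridBasis N ε)).2 hx] at h
  refine h.trans (le_of_eq ?_)
  simp only [gridBasis_apply hε, norm_smul]
  simp [abs_of_pos hε]
  ring

theorem measurableSet_gridCell {ε : ℝ} : MeasurableSet (gridCell N ε) :=
  ZSpan.fundamentalDomain_measurableSet _

theorem volume_gridCell_ne_zero (ε : ℝ) : volume (gridCell N ε) ≠ 0 :=
  ZSpan.measure_fundamentalDomain_ne_zero _

theorem volume_gridCell_ne_top (ε : ℝ) : volume (gridCell N ε) ≠ ⊤ :=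
  (ZSpan.fundamentalDomain_isBounded _).measure_lt_top.ne

theorem volume_gridCell_le {ε : ℝ} (hε : 0 < ε) :
    volume.real (gridCell N ε) ≤ (2 * N) ^ N * volume.real (Metric.ball (0 : E N) 1) * ε ^ N := by
  have h1 : gridCell N ε ⊆ Metric.closedBall 0 (2 * ε * N) := fun x hx => by
    simpa using norm_le_of_mem_gridCell hε hx
  refine (measureReal_mono h1 Metric.isBounded_closedBall.measure_lt_top.ne).trans (le_of_eq ?_)
  rw [measureReal_def, Measure.addHaar_closedBall _ _ (by positivity), finrank_euclideanSpace_fin,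
    ENNReal.toReal_mul, ENNReal.toReal_ofReal (by positivity), measureReal_def]
  ring

theorem lintegral_eq_lintegral_gridCell {ε : ℝ} {G : E N → ℝ≥0∞} (hG : Measurable G) :
    ∫⁻ x, G x = ∫⁻ y in gridCell N ε, ∑' a : grid N ε, G (a + y) := by
  have : Countable (grid N ε).toAddSubgroup := inferInstanceAs (Countable (grid N ε))
  refine ((ZSpan.isAddFundamentalDomain' (gridBasis N ε) volume).lintegral_eq_tsum'' G).trans ?_
  exact (lintegral_tsum (μ := volume.restrict (gridCell N ε)) (f := fun (a : grid N ε) y => G (a + y))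
    fun a => (hG.comp (measurable_const_add _)).aemeasurable).symm

/-- The point of `2 ε ℤ^N` in whose cell `x` lies. -/
noncomputable def gridFloor (ε : ℝ) (x : E N) : E N := ZSpan.floor (gridBasis N ε) x

theorem gridFloor_mem (ε : ℝ) (x : E N) : gridFloor ε x ∈ grid N ε :=
  (ZSpan.floor (gridBasis N ε) x).2

theorem sub_gridFloor_mem (ε : ℝ) (x : E N) : x - gridFloor ε x ∈ gridCell N ε :=
  ZSpan.fract_mem_fundamentalDomain (gridBasis N ε) x

theorem dist_gridFloor_le {ε : ℝ} (hε : 0 < ε) (x : E N) : dist x (gridFloor ε x) ≤ 2 * ε * N := by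
  rw [dist_eq_norm]
  exact norm_le_of_mem_gridCell hε (sub_gridFloor_mem ε x)

theorem gridFloor_eq_iff {ε : ℝ} {x a : E N} (ha : a ∈ grid N ε) :
    gridFloor ε x = a ↔ x - a ∈ gridCell N ε := by
  constructor
  · rintro rfl
    exact sub_gridFloor_mem ε x
  · intro h
    have h1 := (ZSpan.fract_eq_self (b := gridBasis N ε)).2 h
    rw [sub_eq_add_neg, ZSpan.fract_add_ZSpan _ _ (neg_mem ha), ZSpan.fract_apply] at h1
    have : x - gridFloor ε x = x - a := by rw [sub_eq_add_neg x a]; exact h1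
    simpa using this

end Lattice

/-! ### The centres -/

section Centres

variable {N : ℕ} {Ω : Set (E N)} {ε : ℝ}

theorem mem_centres_iff (hε : 0 < ε) {x : E N} :
    x ∈ centres Ω ε ↔ x ∈ Ω ∧ x ∈ grid N ε ∧ ε ≤ Metric.infDist x (frontier Ω) := by
  rw [mem_grid_iff hε]; rfl

theorem centres_finite (hΩ : Bornology.IsBounded Ω) (hε : 0 < ε) : (centres Ω ε).Finite := by
  refine (ZSpan.setFinite_inter (gridBasis N ε) hΩ).subset fun x hx => ?_
  exact ⟨hx.1, ((mem_centres_iff hε).1 hx).2.1⟩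

theorem le_dist_of_mem_centres (hε : 0 < ε) {x y : E N} (hx : x ∈ centres Ω ε)
    (hy : y ∈ centres Ω ε) (hxy : x ≠ y) : 2 * ε ≤ dist x y :=
  le_dist_of_mem_grid hε ((mem_centres_iff hε).1 hx).2.1 ((mem_centres_iff hε).1 hy).2.1 hxy

/-- A segment from a point of `Ω` to a point outside is connected, so it meets the boundary. For an
endpoint within `ε` of the centre this contradicts the distance condition. -/
theorem ball_subset_of_mem_centres {x : E N} (hx : x ∈ centres Ω ε) :
    Metric.ball x ε ⊆ Ω := by
  intro y hy
  by_contra hyΩ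
  obtain ⟨z, hz, hzf⟩ : ∃ z ∈ segment ℝ x y, z ∈ frontier Ω := by
    by_contra! h
    obtain ⟨z, -, h1, h2⟩ := (convex_segment x y).isPreconnected (interior Ω) (closure Ω)ᶜ
      isOpen_interior isClosed_closure.isOpen_compl
      (fun z hz => or_iff_not_imp_left.2 fun hi hc => h z hz ⟨hc, hi⟩)
      ⟨x, left_mem_segment ℝ x y, by_contra fun hi =>
        h x (left_mem_segment ℝ x y) ⟨subset_closure hx.1, hi⟩⟩
      ⟨y, right_mem_segment ℝ x y, fun hc =>
        h y (right_mem_segment ℝ x y) ⟨hc, fun hi => hyΩ (interior_subset hi)⟩⟩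
    exact h2 (subset_closure (interior_subset h1))
  have h1 := hx.2.2.trans (Metric.infDist_le_dist_of_mem hzf)
  have h2 : z ∈ Metric.ball x ε :=
    (convex_ball x ε).segment_subset (Metric.mem_ball_self (dist_nonneg.trans_lt hy)) hy hz
  rw [Metric.mem_ball, dist_comm] at h2
  linarith

theorem isCompact_inclusions (hΩ : Bornology.IsBounded Ω) (hε : 0 < ε) (ρ : ℝ) :
    IsCompact (inclusions Ω ρ ε) :=
  (centres_finite hΩ hε).isCompact_biUnion fun x _ => isCompact_closedBall x ρ

theorem inclusions_subset {ρ : ℝ} (hρ : ρ < ε) : inclusions Ω ρ ε ⊆ Ω :=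
  iUnion₂_subset fun _ hx =>
    (Metric.closedBall_subset_ball hρ).trans (ball_subset_of_mem_centres hx)

theorem tendsto_dist_gridFloor (x : E N) :
    Tendsto (fun ε : ℝ => dist x (gridFloor ε x)) (𝓝[>] 0) (𝓝 0) := by
  have h1 : Tendsto (fun ε : ℝ => 2 * ε * N) (𝓝[>] 0) (𝓝 0) := by
    have : Continuous fun ε : ℝ => 2 * ε * N := by fun_prop
    simpa using (this.tendsto 0).mono_left nhdsWithin_le_nhds
  refine tendsto_of_tendsto_of_tendsto_of_le_of_le' tendsto_const_nhds h1
    (Eventually.of_forall fun _ => dist_nonneg) ?_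
  filter_upwards [self_mem_nhdsWithin] with ε hε using dist_gridFloor_le hε x

theorem frontier_nonempty_of_isBounded (hN : 1 ≤ N) (hΩ : IsSmoothBoundedDomain Ω) :
    (frontier Ω).Nonempty := by
  have : Nonempty (Fin N) := ⟨⟨0, by omega⟩⟩
  rw [nonempty_frontier_iff]
  refine ⟨hΩ.isConnected.nonempty, fun h => ?_⟩
  have := hΩ.isBounded
  rw [h] at this
  exact NormedSpace.unbounded_univ ℝ (E N) this

theorem eventually_gridFloor_mem_centres (hΩ : IsOpen Ω) (hf : (frontier Ω).Nonempty) {x : E N}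
    (hx : x ∈ Ω) : ∀ᶠ ε in 𝓝[>] (0 : ℝ), gridFloor ε x ∈ centres Ω ε := by
  have hd : 0 < Metric.infDist x (frontier Ω) := by
    rw [← isClosed_frontier.notMem_iff_infDist_pos hf]
    exact fun h => (hΩ.frontier_eq ▸ h).2 hx
  have hfl : Tendsto (fun ε : ℝ => gridFloor ε x) (𝓝[>] 0) (𝓝 x) := by
    rw [tendsto_iff_dist_tendsto_zero]
    simpa [dist_comm] using tendsto_dist_gridFloor x
  have h2 : Tendsto (fun ε : ℝ => Metric.infDist (gridFloor ε x) (frontier Ω) - ε) (𝓝[>] 0)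
      (𝓝 (Metric.infDist x (frontier Ω) - 0)) :=
    ((Metric.continuous_infDist_pt _).continuousAt.tendsto.comp hfl).sub
      (tendsto_id.mono_left nhdsWithin_le_nhds)
  rw [sub_zero] at h2
  filter_upwards [self_mem_nhdsWithin, hfl.eventually (hΩ.mem_nhds hx), h2.eventually_const_lt hd]
    with ε hε h3 h4
  exact (mem_centres_iff hε).2 ⟨h3, gridFloor_mem ε x, by linarith⟩

open Classical in
theorem indicator_gridFloor_eq (hΩ : Bornology.IsBounded Ω) (hε : 0 < ε) (ζ : E N → ℝ) (x : E N) :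
    (centres Ω ε).indicator ζ (gridFloor ε x) =
      ∑ a ∈ (centres_finite hΩ hε).toFinset,
        ((fun x => x - a) ⁻¹' gridCell N ε).indicator (fun _ => ζ a) x := by
  have h0 : ∀ a ∈ (centres_finite hΩ hε).toFinset,
      ((fun x => x - a) ⁻¹' gridCell N ε).indicator (fun _ => ζ a) x =
        if gridFloor ε x = a then ζ a else 0 := by
    intro a ha
    rw [Set.Finite.mem_toFinset, mem_centres_iff hε] at ha
    rw [indicator_apply]
    simp [gridFloor_eq_iff ha.2.1]
  rw [Finset.sum_congr rfl h0, Finset.sum_ite_eq, indicator_apply]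
  simp

/-- The sum over the centres is the integral of a step function. In this form its limit follows from
dominated convergence. -/
theorem integral_indicator_gridFloor (hΩ : Bornology.IsBounded Ω) (hε : 0 < ε) (ζ : E N → ℝ) :
    ∫ x, (centres Ω ε).indicator ζ (gridFloor ε x) =
      volume.real (gridCell N ε) * ∑ a ∈ (centres_finite hΩ hε).toFinset, ζ a := by
  have hm : ∀ a : E N, MeasurableSet ((fun x => x - a) ⁻¹' gridCell N ε) := fun a =>
    measurable_sub_const a measurableSet_gridCell
  have hv : ∀ a : E N, volume ((fun x => x - a) ⁻¹' gridCell N ε) = volume (gridCell N ε) :=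
    fun a => (measurePreserving_sub_right volume a).measure_preimage
      measurableSet_gridCell.nullMeasurableSet
  simp_rw [indicator_gridFloor_eq hΩ hε]
  rw [integral_finsetSum, Finset.mul_sum]
  · refine Finset.sum_congr rfl fun a _ => ?_
    rw [integral_indicator_const _ (hm a), measureReal_def, hv a, smul_eq_mul, measureReal_def]
  · intro a _
    refine (integrable_indicator_iff (hm a)).2 (integrableOn_const ?_)
    rw [hv a]
    exact volume_gridCell_ne_top ε

/-- Riemann sums over the centres. -/
theorem tendsto_sum_centres (hN : 1 ≤ N) (hΩ : IsSmoothBoundedDomain Ω) {ζ : E N → ℝ}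
    (hζ : Continuous ζ) :
    Tendsto (fun ε => volume.real (gridCell N ε) * ∑ᶠ a ∈ centres Ω ε, ζ a) (𝓝[>] 0)
      (𝓝 (∫ x in Ω, ζ x)) := by
  have hf := frontier_nonempty_of_isBounded hN hΩ
  obtain ⟨C, hC⟩ := hΩ.isBounded.isCompact_closure.exists_bound_of_continuousOn hζ.continuousOn
  have h1 : ∀ᶠ ε in 𝓝[>] (0 : ℝ), ∫ x, (centres Ω ε).indicator ζ (gridFloor ε x) =
      volume.real (gridCell N ε) * ∑ᶠ a ∈ centres Ω ε, ζ a := by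
    filter_upwards [self_mem_nhdsWithin] with ε hε
    rw [integral_indicator_gridFloor hΩ.isBounded hε, finsum_mem_eq_finite_toFinset_sum]
  refine Tendsto.congr' h1 ?_
  rw [← integral_indicator hΩ.isOpen.measurableSet]
  -- For `ε < 1` the step function vanishes farther than `2 * N` from `Ω`, because a cell has
  -- diameter at most `2 * ε * N` by the crude bound on its points.
  refine tendsto_integral_filter_of_dominated_convergence
    ((Metric.cthickening (2 * N) Ω).indicator fun _ => C) ?_ ?_ ?_ ?_
  · filter_upwards [self_mem_nhdsWithin] with ε hε
    simp_rw [indicator_gridFloor_eq hΩ.isBounded hε]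
    exact (Finset.measurable_fun_sum _ fun a _ => measurable_const.indicator
      (measurable_sub_const a measurableSet_gridCell)).aestronglyMeasurable
  · have : ∀ᶠ ε in 𝓝[>] (0 : ℝ), ε < 1 := nhdsWithin_le_nhds (Iio_mem_nhds one_pos)
    filter_upwards [self_mem_nhdsWithin, this] with ε hε hε1
    refine ae_of_all _ fun x => ?_
    by_cases h : gridFloor ε x ∈ centres Ω ε
    · have h2 : x ∈ Metric.cthickening (2 * N) Ω := by
        refine Metric.mem_cthickening_of_dist_le x _ _ _ h.1 ((dist_gridFloor_le hε x).trans ?_)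
        have : (0 : ℝ) ≤ N := by positivity
        nlinarith
      rw [indicator_of_mem h, indicator_of_mem h2]
      exact hC _ (subset_closure h.1)
    · rw [indicator_of_notMem h, norm_zero]
      refine indicator_nonneg (fun _ _ => ?_) _
      obtain ⟨y, hy⟩ := hΩ.isConnected.nonempty
      exact (norm_nonneg _).trans (hC y (subset_closure hy))
  · refine (integrable_indicator_iff Metric.isClosed_cthickening.measurableSet).2
      (integrableOn_const ?_)
    exact hΩ.isBounded.cthickening.measure_lt_top.ne
  · have h0 : ∀ᵐ x : E N, x ∉ frontier Ω := by
      rw [ae_iff]; simpa using volume_frontier hN hΩ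
    filter_upwards [h0] with x hx
    have hfl : Tendsto (fun ε : ℝ => gridFloor ε x) (𝓝[>] 0) (𝓝 x) := by
      rw [tendsto_iff_dist_tendsto_zero]
      simpa [dist_comm] using tendsto_dist_gridFloor x
    by_cases h : x ∈ Ω
    · rw [indicator_of_mem h]
      refine Tendsto.congr' ?_ (hζ.continuousAt.tendsto.comp hfl)
      filter_upwards [eventually_gridFloor_mem_centres hΩ.isOpen hf h] with ε h3
      rw [indicator_of_mem h3]; rfl
    · rw [indicator_of_notMem h]
      have hcl : x ∉ closure Ω := fun h' => hx (hΩ.isOpen.frontier_eq ▸ ⟨h', h⟩)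
      refine tendsto_const_nhds.congr' ?_
      filter_upwards [hfl.eventually (isClosed_closure.isOpen_compl.mem_nhds hcl)] with ε h3
      rw [indicator_of_notMem fun h4 : _ ∈ centres Ω ε => h3 (subset_closure h4.1)]

end Centres

/-! ### Periodic annuli -/

section Annuli

variable {N : ℕ} {ε : ℝ}

/-- The annulus `B_ε(a) \ B_{ε/2}(a)`. -/
def annulus (a : E N) (ε : ℝ) : Set (E N) := Metric.ball a ε \ Metric.ball a (ε / 2)

/-- The union of the annuli around all points of `2 ε ℤ^N`. -/
def gridAnnuli (N : ℕ) (ε : ℝ) : Set (E N) := ⋃ a : grid N ε, annulus (a : E N) ε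

theorem measurableSet_annulus (a : E N) (ε : ℝ) : MeasurableSet (annulus a ε) :=
  measurableSet_ball.diff measurableSet_ball

theorem measurableSet_gridAnnuli : MeasurableSet (gridAnnuli N ε) :=
  MeasurableSet.iUnion fun _ => measurableSet_annulus _ _

theorem tsum_indicator_annulus (hε : 0 < ε) (x : E N) :
    ∑' a : grid N ε, (annulus (a : E N) ε).indicator (1 : E N → ℝ≥0∞) x =
      (gridAnnuli N ε).indicator 1 x := by
  by_cases hx : x ∈ gridAnnuli N ε
  · rw [indicator_of_mem hx]
    obtain ⟨a, ha⟩ := mem_iUnion.1 hx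
    rw [tsum_eq_single a, indicator_of_mem ha]
    intro b hba
    refine indicator_of_notMem (fun hb => ?_) _
    have h1 := le_dist_of_mem_grid hε b.2 a.2 fun h => hba (Subtype.ext h)
    have h2 := dist_triangle_left (b : E N) a x
    have h3 := Metric.mem_ball.1 ha.1
    have h4 := Metric.mem_ball.1 hb.1
    linarith
  · rw [indicator_of_notMem hx]
    refine ENNReal.tsum_eq_zero.2 fun a => indicator_of_notMem (fun ha => hx ?_) _
    exact mem_iUnion.2 ⟨a, ha⟩

theorem annulus_indicator_sub (a x : E N) (ε : ℝ) :
    (annulus a ε).indicator (1 : E N → ℝ≥0∞) x = (annulus 0 ε).indicator 1 (x - a) := by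
  have h : x ∈ annulus a ε ↔ x - a ∈ annulus 0 ε := by
    simp only [annulus, Set.mem_sdiff, Metric.mem_ball, dist_eq_norm, sub_zero]
  by_cases hx : x ∈ annulus a ε
  · rw [indicator_of_mem hx, indicator_of_mem (h.1 hx)]; rfl
  · rw [indicator_of_notMem hx, indicator_of_notMem fun h' => hx (h.2 h')]

/-- By periodicity the integral over one cell unfolds to the integral over the whole space of the
indicator of a single annulus. The result does not depend on `x`. -/
theorem lintegral_gridCell_indicator (hε : 0 < ε) (x : E N) :
    ∫⁻ y in gridCell N ε, (gridAnnuli N ε).indicator (1 : E N → ℝ≥0∞) (x - y) =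
      volume (annulus (0 : E N) ε) := by
  have hm : Measurable ((annulus (0 : E N) ε).indicator (1 : E N → ℝ≥0∞)) :=
    measurable_one.indicator (measurableSet_annulus _ _)
  calc _ = ∫⁻ y in gridCell N ε, ∑' a : grid N ε,
        (annulus (0 : E N) ε).indicator (1 : E N → ℝ≥0∞) (x - (a + y)) := by
        refine lintegral_congr fun y => ?_
        rw [← tsum_indicator_annulus hε]
        refine tsum_congr fun a => ?_
        rw [annulus_indicator_sub]
        congr 1
        abel
    _ = ∫⁻ y, (annulus (0 : E N) ε).indicator (1 : E N → ℝ≥0∞) (x - y) :=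
        (lintegral_eq_lintegral_gridCell
          (G := fun z => (annulus (0 : E N) ε).indicator (1 : E N → ℝ≥0∞) (x - z))
          (hm.comp (measurable_const_sub x))).symm
    _ = volume (annulus (0 : E N) ε) := by
        rw [lintegral_sub_left_eq_self, lintegral_indicator_one (measurableSet_annulus _ _)]

theorem lintegral_enorm_translate_sub_le {P : E N → ℝ} (hP : ContDiff ℝ ∞ P) (y : E N) :
    ∫⁻ x, ‖P (x + y) - P x‖ₑ ≤ ENNReal.ofReal ‖y‖ * ∫⁻ x, ‖gradient P x‖ₑ := by
  rcases eq_or_ne y 0 with rfl | hy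
  · simp
  have hy' : ‖y‖ ≠ 0 := norm_ne_zero_iff.2 hy
  have h1 : ‖(‖y‖⁻¹ • y)‖ = 1 := by rw [norm_smul, norm_inv, norm_norm, inv_mul_cancel₀ hy']
  have h2 : ‖y‖ • (‖y‖⁻¹ • y) = y := by rw [smul_smul, mul_inv_cancel₀ hy', one_smul]
  calc ∫⁻ x, ‖P (x + y) - P x‖ₑ
      ≤ ∫⁻ x, ∫⁻ σ in Icc 0 ‖y‖, ‖gradient P (x + σ • (‖y‖⁻¹ • y))‖ₑ := by
        refine lintegral_mono fun x => ?_
        have := enorm_sub_le_lintegral_gradient hP x _ h1 (norm_nonneg y)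
        rwa [h2, zero_smul, add_zero] at this
    _ = _ := by
        rw [lintegral_shift_le (G := fun x => ‖gradient P x‖ₑ)
          (continuous_gradient hP).enorm.measurable]
        simp

/-- After a change of variables the translation acts on the periodic set instead of `Q`. Averaging
over the cell then leaves a constant factor. -/
theorem lintegral_gridCell_translate (hε : 0 < ε) {Q : E N → ℝ≥0∞} (hQ : Measurable Q) :
    ∫⁻ y in gridCell N ε, ∫⁻ x in gridAnnuli N ε, Q (x + y) =
      volume (annulus (0 : E N) ε) * ∫⁻ x, Q x := by
  have hm : Measurable ((gridAnnuli N ε).indicator (1 : E N → ℝ≥0∞)) :=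
    measurable_one.indicator measurableSet_gridAnnuli
  have h1 : ∀ y, ∫⁻ x in gridAnnuli N ε, Q (x + y) =
      ∫⁻ x, (gridAnnuli N ε).indicator (1 : E N → ℝ≥0∞) (x - y) * Q x := by
    intro y
    rw [← lintegral_indicator measurableSet_gridAnnuli,
      ← lintegral_add_right_eq_self
        (fun x => (gridAnnuli N ε).indicator (1 : E N → ℝ≥0∞) (x - y) * Q x) y]
    refine lintegral_congr fun x => ?_
    by_cases hx : x ∈ gridAnnuli N ε <;> simp [hx]
  simp_rw [h1]
  rw [lintegral_lintegral_swap]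
  · refine (lintegral_congr fun x => ?_).trans (lintegral_const_mul _ hQ)
    rw [lintegral_mul_const (f := fun y => (gridAnnuli N ε).indicator (1 : E N → ℝ≥0∞) (x - y)) _
      (hm.comp (measurable_const_sub x)), lintegral_gridCell_indicator hε x]
  · exact ((hm.comp (measurable_snd.sub measurable_fst)).mul
      (hQ.comp measurable_snd)).aemeasurable

theorem lintegral_gridCell_sub_le (hε : 0 < ε) {P : E N → ℝ} (hP : ContDiff ℝ ∞ P) :
    ∫⁻ y in gridCell N ε, ∫⁻ x in gridAnnuli N ε, ‖P (x + y) - P x‖ₑ ≤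
      volume (gridCell N ε) * (ENNReal.ofReal (2 * ε * N) * ∫⁻ x, ‖gradient P x‖ₑ) := by
  calc _ ≤ ∫⁻ _ in gridCell N ε, ENNReal.ofReal (2 * ε * N) * ∫⁻ x, ‖gradient P x‖ₑ := by
        refine setLIntegral_mono_ae aemeasurable_const (ae_of_all _ fun y hy => ?_)
        refine (setLIntegral_le_lintegral _ _).trans
          ((lintegral_enorm_translate_sub_le hP y).trans ?_)
        exact mul_le_mul_left (ENNReal.ofReal_le_ofReal (norm_le_of_mem_gridCell hε hy)) _
    _ = _ := by rw [setLIntegral_const, mul_comm]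

/-- Together with the reverse inequality below, this says that the annuli carry their share of the
integral of `‖P‖`. For each `y` in the cell `P` is exchanged for `P (· + y)` at the cost of the
translation estimate, and the average over `y` is exact. -/
theorem lintegral_gridAnnuli_le (hε : 0 < ε) {P : E N → ℝ} (hP : ContDiff ℝ ∞ P) :
    volume (gridCell N ε) * ∫⁻ x in gridAnnuli N ε, ‖P x‖ₑ ≤
      volume (annulus (0 : E N) ε) * (∫⁻ x, ‖P x‖ₑ) +
      volume (gridCell N ε) * (ENNReal.ofReal (2 * ε * N) * ∫⁻ x, ‖gradient P x‖ₑ) := by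
  have hPm := hP.continuous.measurable
  refine le_trans ?_ (add_le_add (lintegral_gridCell_translate hε hPm.enorm).le
    (lintegral_gridCell_sub_le hε hP))
  rw [← lintegral_add_left]
  · rw [mul_comm, ← setLIntegral_const]
    refine lintegral_mono fun y => ?_
    rw [← lintegral_add_left (by fun_prop)]
    refine lintegral_mono fun x => ?_
    rw [enorm_sub_rev]
    simpa using enorm_add_le (P (x + y)) (P x - P (x + y))
  · exact Measurable.lintegral_prod_right' (f := fun q : E N × E N => ‖P (q.2 + q.1)‖ₑ)
      (by fun_prop)

theorem lintegral_le_gridAnnuli (hε : 0 < ε) {P : E N → ℝ} (hP : ContDiff ℝ ∞ P) :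
    volume (annulus (0 : E N) ε) * (∫⁻ x, ‖P x‖ₑ) ≤
      volume (gridCell N ε) * (∫⁻ x in gridAnnuli N ε, ‖P x‖ₑ) +
      volume (gridCell N ε) * (ENNReal.ofReal (2 * ε * N) * ∫⁻ x, ‖gradient P x‖ₑ) := by
  have hPm := hP.continuous.measurable
  rw [← lintegral_gridCell_translate hε hPm.enorm]
  refine le_trans ?_ (add_le_add le_rfl (lintegral_gridCell_sub_le hε hP))
  rw [mul_comm (volume (gridCell N ε)), ← setLIntegral_const, ← lintegral_add_left measurable_const]
  refine lintegral_mono fun y => ?_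
  rw [← lintegral_add_left (by fun_prop)]
  refine lintegral_mono fun x => ?_
  simpa using enorm_add_le (P x) (P (x + y) - P x)

end Annuli

/-! ### Spheres and shells -/

section Spheres

variable {N : ℕ} {ρ ε : ℝ}

instance : IsFiniteMeasure (sphereMeasure N) :=
  inferInstanceAs (IsFiniteMeasure (volume : Measure (E N)).toSphere)

theorem lintegral_polar (hN : 1 ≤ N) {G : E N → ℝ≥0∞} (hG : Measurable G) :
    ∫⁻ x, G x = ∫⁻ m, ∫⁻ s in Ioi (0 : ℝ), ENNReal.ofReal (s ^ (N - 1)) *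
      G (s • (m : E N)) ∂volume ∂(sphereMeasure N) := by
  have : Nonempty (Fin N) := ⟨⟨0, by omega⟩⟩
  have h0 := (volume : Measure (E N)).measurePreserving_homeomorphUnitSphereProd
  rw [finrank_euclideanSpace_fin] at h0
  have h1 : ∫⁻ x, G x = ∫⁻ x : ({0}ᶜ : Set (E N)), G x ∂(volume.comap Subtype.val) := by
    rw [lintegral_subtype_comap (measurableSet_singleton _).compl, restrict_compl_singleton]
  have h2 : ∀ x : ({0}ᶜ : Set (E N)), G x =
      (fun q : Metric.sphere (0 : E N) 1 × Ioi (0 : ℝ) => G ((q.2 : ℝ) • (q.1 : E N)))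
        (homeomorphUnitSphereProd (E N) x) := by
    intro x
    have hx : ‖(x : E N)‖ ≠ 0 := norm_ne_zero_iff.2 x.2
    simp [smul_smul, hx]
  have hGm : Measurable
      (fun q : Metric.sphere (0 : E N) 1 × Ioi (0 : ℝ) => G ((q.2 : ℝ) • (q.1 : E N))) :=
    hG.comp (by fun_prop)
  rw [h1]
  simp_rw [h2]
  rw [h0.lintegral_comp hGm, lintegral_prod _ hGm.aemeasurable]
  refine lintegral_congr fun m => ?_
  rw [Measure.volumeIoiPow]
  refine (lintegral_withDensity_eq_lintegral_mul _ (by fun_prop)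
    (hGm.comp measurable_prodMk_left)).trans ?_
  exact lintegral_subtype_comap measurableSet_Ioi
    (fun s : ℝ => ENNReal.ofReal (s ^ (N - 1)) * G (s • (m : E N)))

/-- The density that matches a sphere of radius `ρ` with an annulus. -/
noncomputable def annulusDensity (N : ℕ) (ρ ε : ℝ) : ℝ :=
  ρ ^ (N - 1) / ∫ s in (ε / 2)..ε, s ^ (N - 1)

/-- The radial part of the uniform measure on an annulus, with mass `ρ^(N-1)`. -/
noncomputable def radialMeasure (N : ℕ) (ρ ε : ℝ) : Measure ℝ :=
  ENNReal.ofReal (annulusDensity N ρ ε) •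
    (volume.restrict (Ico (ε / 2) ε)).withDensity fun s => ENNReal.ofReal (s ^ (N - 1))

/-- The integrand is bounded below by its value at the left endpoint. Only the order `ε ^ N`
matters, since it makes `annulusDensity` bounded at the critical scale. -/
theorem half_pow_le_integral (hN : 1 ≤ N) (hε : 0 < ε) :
    (ε / 2) ^ N ≤ ∫ s in (ε / 2)..ε, s ^ (N - 1) := by
  have h1 : ∫ _ in (ε / 2)..ε, (ε / 2) ^ (N - 1) ≤ ∫ s in (ε / 2)..ε, s ^ (N - 1) := by
    refine intervalIntegral.integral_mono_on (by linarith) (by simp) ?_ fun s hs => ?_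
    · exact (continuous_pow _).intervalIntegrable _ _
    · exact pow_le_pow_left₀ (by positivity) hs.1 _
  refine le_trans (le_of_eq ?_) h1
  rw [intervalIntegral.integral_const, smul_eq_mul]
  obtain ⟨k, rfl⟩ := Nat.exists_eq_add_of_le' hN
  rw [Nat.add_sub_cancel, pow_succ]
  ring

theorem annulusDensity_nonneg (hN : 1 ≤ N) (hε : 0 < ε) (hρ : 0 ≤ ρ) :
    0 ≤ annulusDensity N ρ ε :=
  div_nonneg (by positivity) ((by positivity : (0 : ℝ) ≤ (ε / 2) ^ N).trans
    (half_pow_le_integral hN hε))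

theorem annulusDensity_le (hN : 1 ≤ N) (hε : 0 < ε) (hρ : 0 ≤ ρ) :
    annulusDensity N ρ ε ≤ ρ ^ (N - 1) / (ε / 2) ^ N :=
  div_le_div_of_nonneg_left (by positivity) (by positivity) (half_pow_le_integral hN hε)

theorem radialMeasure_univ (hN : 1 ≤ N) (hε : 0 < ε) (hρ : 0 ≤ ρ) :
    radialMeasure N ρ ε univ = ENNReal.ofReal (ρ ^ (N - 1)) := by
  have h0 : 0 < ∫ s in (ε / 2)..ε, s ^ (N - 1) :=
    (by positivity : (0 : ℝ) < (ε / 2) ^ N).trans_le (half_pow_le_integral hN hε)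
  rw [radialMeasure, Measure.smul_apply, withDensity_apply _ MeasurableSet.univ,
    Measure.restrict_univ, smul_eq_mul, ← ofReal_integral_eq_lintegral_ofReal,
    ← ENNReal.ofReal_mul (annulusDensity_nonneg hN hε hρ), integral_Ico_eq_integral_Ioc,
    ← intervalIntegral.integral_of_le (by linarith), annulusDensity, div_mul_cancel₀ _ h0.ne']
  · exact (continuous_pow _).integrableOn_Icc.mono_set Ico_subset_Icc_self
  · filter_upwards [ae_restrict_mem measurableSet_Ico] with s hs
    exact pow_nonneg (by linarith [hs.1]) _

theorem isFiniteMeasure_radialMeasure (hN : 1 ≤ N) (hε : 0 < ε) (hρ : 0 ≤ ρ) :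
    IsFiniteMeasure (radialMeasure N ρ ε) :=
  ⟨by rw [radialMeasure_univ hN hε hρ]; exact ENNReal.ofReal_lt_top⟩

/-- The radial factor is only carried along here, with total mass `ρ ^ (N - 1)`. It is present so
that the sphere and the weighted annulus are images of the same product measure, as in
`smul_restrict_annulus_eq_map`. -/
theorem sphereSurface_eq_map (hN : 1 ≤ N) (hε : 0 < ε) (hρ : 0 ≤ ρ) (a : E N) :
    sphereSurface a ρ = ((sphereMeasure N).prod (radialMeasure N ρ ε)).map
      fun q => a + ρ • (q.1 : E N) := by
  have := isFiniteMeasure_radialMeasure hN hε hρ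
  have h : (fun q : Metric.sphere (0 : E N) 1 × ℝ => a + ρ • (q.1 : E N)) =
    (fun m : Metric.sphere (0 : E N) 1 => a + ρ • (m : E N)) ∘ Prod.fst := rfl
  rw [h, ← Measure.map_map (by fun_prop) measurable_fst, Measure.map_fst_prod, Measure.map_smul,
    radialMeasure_univ hN hε hρ, sphereSurface]

theorem lintegral_radialMeasure {G : ℝ → ℝ≥0∞} (hG : Measurable G) :
    ∫⁻ s, G s ∂(radialMeasure N ρ ε) = ENNReal.ofReal (annulusDensity N ρ ε) *
      ∫⁻ s in Ico (ε / 2) ε, ENNReal.ofReal (s ^ (N - 1)) * G s := by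
  rw [radialMeasure, lintegral_smul_measure, smul_eq_mul,
    lintegral_withDensity_eq_lintegral_mul _ (by fun_prop) hG]
  rfl

theorem norm_sphere (m : Metric.sphere (0 : E N) 1) : ‖(m : E N)‖ = 1 := by
  simp

theorem add_smul_mem_annulus {a : E N} {s : ℝ} (hs : 0 < s) (m : Metric.sphere (0 : E N) 1) :
    a + s • (m : E N) ∈ annulus a ε ↔ s ∈ Ico (ε / 2) ε := by
  simp [annulus, dist_eq_norm, norm_smul, abs_of_pos hs, and_comm]

theorem lintegral_polar_at (hN : 1 ≤ N) {G : E N → ℝ≥0∞} (hG : Measurable G) (a : E N) :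
    ∫⁻ x, G x = ∫⁻ m, ∫⁻ s in Ioi (0 : ℝ), ENNReal.ofReal (s ^ (N - 1)) *
      G (a + s • (m : E N)) ∂volume ∂(sphereMeasure N) := by
  rw [← lintegral_add_left_eq_self G a]
  exact lintegral_polar hN (hG.comp (measurable_const_add a))

theorem smul_restrict_annulus_eq_map (hN : 1 ≤ N) (hε : 0 < ε) (hρ : 0 ≤ ρ) (a : E N) :
    ENNReal.ofReal (annulusDensity N ρ ε) • volume.restrict (annulus a ε) =
      ((sphereMeasure N).prod (radialMeasure N ρ ε)).map fun q => a + q.2 • (q.1 : E N) := by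
  have := isFiniteMeasure_radialMeasure hN hε hρ
  refine Measure.ext_of_lintegral _ fun G hG => ?_
  rw [lintegral_smul_measure, smul_eq_mul, lintegral_map hG (by fun_prop), lintegral_prod
    (fun q : Metric.sphere (0 : E N) 1 × ℝ => G (a + q.2 • (q.1 : E N)))
    (hG.comp (by fun_prop)).aemeasurable, ← lintegral_indicator (measurableSet_annulus a ε),
    lintegral_polar_at hN (hG.indicator (measurableSet_annulus a ε)) a, ← lintegral_const_mul]
  · refine lintegral_congr fun m => ?_
    rw [lintegral_radialMeasure (G := fun s => G (a + s • (m : E N))) (hG.comp (by fun_prop))]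
    congr 1
    have hI : Ico (ε / 2) ε ⊆ Ioi 0 := fun s hs => lt_of_lt_of_le (by positivity) hs.1
    rw [← inter_eq_self_of_subset_left hI, ← Measure.restrict_restrict measurableSet_Ico,
      ← lintegral_indicator measurableSet_Ico]
    refine setLIntegral_congr_fun measurableSet_Ioi fun s hs => ?_
    by_cases h : s ∈ Ico (ε / 2) ε
    · simp only [indicator_of_mem h]
      rw [indicator_of_mem ((add_smul_mem_annulus hs m).2 h)]
    · simp only [indicator_of_notMem h]
      rw [indicator_of_notMem (fun h' => h ((add_smul_mem_annulus hs m).1 h')), mul_zero]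
  · refine Measurable.lintegral_prod_right'
      (f := fun q : Metric.sphere (0 : E N) 1 × ℝ => ENNReal.ofReal (q.2 ^ (N - 1)) *
        (annulus a ε).indicator G (a + q.2 • (q.1 : E N))) ?_
    exact (by fun_prop : Measurable fun q : Metric.sphere (0 : E N) 1 × ℝ =>
      ENNReal.ofReal (q.2 ^ (N - 1))).mul
      ((hG.indicator (measurableSet_annulus a ε)).comp (by fun_prop))

/-- The measure on the shell `B_ε(a) \ B_ρ(a)` with density `(ρ / |x - a|)^(N-1)`. -/
noncomputable def shellMeasure (a : E N) (ρ ε : ℝ) : Measure (E N) :=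
  ENNReal.ofReal (ρ ^ (N - 1)) • ((sphereMeasure N).prod (volume.restrict (Ioo ρ ε))).map
    fun q => a + q.2 • (q.1 : E N)

theorem lintegral_shellMeasure {G : E N → ℝ≥0∞} (hG : Measurable G) (a : E N) :
    ∫⁻ x, G x ∂(shellMeasure a ρ ε) = ENNReal.ofReal (ρ ^ (N - 1)) *
      ∫⁻ m, ∫⁻ s in Ioo ρ ε, G (a + s • (m : E N)) ∂volume ∂(sphereMeasure N) := by
  rw [shellMeasure, lintegral_smul_measure, smul_eq_mul, lintegral_map hG (by fun_prop),
    lintegral_prod (fun q : Metric.sphere (0 : E N) 1 × ℝ => G (a + q.2 • (q.1 : E N)))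
      (hG.comp (by fun_prop)).aemeasurable]

theorem shellMeasure_univ (a : E N) : shellMeasure a ρ ε univ =
    ENNReal.ofReal (ρ ^ (N - 1)) * (sphereMeasure N univ * ENNReal.ofReal (ε - ρ)) := by
  rw [← lintegral_one, lintegral_shellMeasure measurable_const]
  simp [mul_comm]

/-- In polar coordinates the volume carries the weight `s ^ (N - 1)`, which is at least `ρ ^ (N -
1)` for `s > ρ`. -/
theorem shellMeasure_le (hN : 1 ≤ N) (hρ : 0 < ρ) (a : E N) :
    shellMeasure a ρ ε ≤ volume.restrict (Metric.ball a ε \ Metric.closedBall a ρ) := by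
  have hS : MeasurableSet (Metric.ball a ε \ Metric.closedBall a ρ) :=
    measurableSet_ball.diff measurableSet_closedBall
  refine Measure.le_iff.2 fun B hB => ?_
  rw [Measure.restrict_apply hB, ← lintegral_indicator_one hB,
    ← lintegral_indicator_one (hB.inter hS), lintegral_shellMeasure (measurable_one.indicator hB),
    lintegral_polar_at hN (measurable_one.indicator (hB.inter hS)) a, ← lintegral_const_mul']
  · refine lintegral_mono fun m => ?_
    rw [← lintegral_const_mul' _ _ ENNReal.ofReal_ne_top]
    have hI : Ioo ρ ε ⊆ Ioi 0 := fun s hs => hρ.trans hs.1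
    refine le_trans ?_ (lintegral_mono_set hI)
    refine setLIntegral_mono_ae ?_ (ae_of_all _ fun s hs => ?_)
    · exact ((by fun_prop : Measurable fun s : ℝ => ENNReal.ofReal (s ^ (N - 1))).mul
        ((measurable_one.indicator (hB.inter hS)).comp (by fun_prop))).aemeasurable
    · have h0 : 0 < s := hρ.trans hs.1
      have h1 : a + s • (m : E N) ∈ Metric.ball a ε \ Metric.closedBall a ρ := by
        simp [dist_eq_norm, norm_smul, abs_of_pos h0, hs.1, hs.2]
      by_cases h : a + s • (m : E N) ∈ B
      · rw [indicator_of_mem h, indicator_of_mem (show _ ∈ B ∩ _ from ⟨h, h1⟩)]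
        simp only [Pi.one_apply, mul_one]
        exact ENNReal.ofReal_le_ofReal (pow_le_pow_left₀ hρ.le hs.1.le _)
      · rw [indicator_of_notMem h, mul_zero]
        exact zero_le
  · exact ENNReal.ofReal_ne_top

/-- On the common product space a point of the sphere and its partner in the annulus lie on the same
ray. The difference of the values is at most the integral of the gradient over the radial segment
between them, which lies in the shell because `ρ < ε / 2`. -/
theorem enorm_sub_le_shellMeasure (hN : 1 ≤ N) (hρ : 0 < ρ) (hρε : ρ < ε / 2) (a : E N)
    {p : E N → ℝ} (hp : ContDiff ℝ ∞ p) :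
    ‖∫ x, p x ∂(sphereSurface a ρ) - annulusDensity N ρ ε * ∫ x in annulus a ε, p x‖ₑ ≤
      ∫⁻ x, ‖gradient p x‖ₑ ∂(shellMeasure a ρ ε) := by
  have hε : 0 < ε := by linarith
  have := isFiniteMeasure_radialMeasure hN hε hρ.le
  set π := (sphereMeasure N).prod (radialMeasure N ρ ε)
  have hc := annulusDensity_nonneg hN hε hρ.le
  have hK : IsCompact (Metric.closedBall a ε) := isCompact_closedBall a ε
  obtain ⟨C, hC⟩ := hK.exists_bound_of_continuousOn hp.continuous.continuousOn
  have hrad : ∀ᵐ s ∂(radialMeasure N ρ ε), s ∈ Ico (ε / 2) ε := by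
    refine Measure.ae_smul_measure ?_ _
    exact (withDensity_absolutelyContinuous _ _).ae_le (ae_restrict_mem measurableSet_Ico)
  have hae : ∀ᵐ q ∂π, q.2 ∈ Ico (ε / 2) ε := Measure.quasiMeasurePreserving_snd.ae hrad
  have e1 : ∫ x, p x ∂(sphereSurface a ρ) = ∫ q, p (a + ρ • (q.1 : E N)) ∂π := by
    rw [sphereSurface_eq_map hN hε hρ.le, integral_map (by fun_prop)
      hp.continuous.aestronglyMeasurable]
  have e2 : annulusDensity N ρ ε * ∫ x in annulus a ε, p x = ∫ q, p (a + q.2 • (q.1 : E N)) ∂π := by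
    have := integral_smul_measure (μ := volume.restrict (annulus a ε)) p
      (ENNReal.ofReal (annulusDensity N ρ ε))
    rw [ENNReal.toReal_ofReal hc, smul_eq_mul, smul_restrict_annulus_eq_map hN hε hρ.le] at this
    rw [← this, integral_map (by fun_prop) hp.continuous.aestronglyMeasurable]
  have i1 : Integrable (fun q : Metric.sphere (0 : E N) 1 × ℝ => p (a + ρ • (q.1 : E N))) π := by
    refine Integrable.of_bound (hp.continuous.comp (by fun_prop)).aestronglyMeasurable C
      (ae_of_all _ fun q => hC _ ?_)
    simp [norm_smul, abs_of_pos hρ]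
    linarith
  have i2 : Integrable (fun q : Metric.sphere (0 : E N) 1 × ℝ => p (a + q.2 • (q.1 : E N))) π := by
    refine Integrable.of_bound (hp.continuous.comp (by fun_prop)).aestronglyMeasurable C ?_
    filter_upwards [hae] with q hq
    refine hC _ ?_
    have : 0 < q.2 := lt_of_lt_of_le (by positivity) hq.1
    simp [norm_smul, abs_of_pos this, hq.2.le]
  have hgm : Measurable fun x => ‖gradient p x‖ₑ := (continuous_gradient hp).enorm.measurable
  rw [e1, e2, ← integral_sub i1 i2, lintegral_shellMeasure hgm]
  refine (enorm_integral_le_lintegral_enorm _).trans ?_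
  calc ∫⁻ q, ‖p (a + ρ • (q.1 : E N)) - p (a + q.2 • (q.1 : E N))‖ₑ ∂π
      ≤ ∫⁻ q, ∫⁻ s in Ioo ρ ε, ‖gradient p (a + s • (q.1 : E N))‖ₑ ∂volume ∂π := by
        refine lintegral_mono_ae ?_
        filter_upwards [hae] with q hq
        rw [enorm_sub_rev]
        refine (enorm_sub_le_lintegral_gradient hp a _ (norm_sphere q.1)
          (hρε.le.trans hq.1)).trans ?_
        rw [restrict_Ioo_eq_restrict_Icc]
        exact lintegral_mono_set (Icc_subset_Icc_right hq.2.le)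
    _ = _ := by
        -- The bound no longer depends on the radius in the annulus, so the radial measure
        -- contributes just its mass, which is the prefactor of `shellMeasure`.
        have hm : Measurable fun m : Metric.sphere (0 : E N) 1 =>
            ∫⁻ s in Ioo ρ ε, ‖gradient p (a + s • (m : E N))‖ₑ :=
          Measurable.lintegral_prod_right'
            (f := fun q : Metric.sphere (0 : E N) 1 × ℝ => ‖gradient p (a + q.2 • (q.1 : E N))‖ₑ)
            (hgm.comp (by fun_prop))
        rw [lintegral_prod (fun q : Metric.sphere (0 : E N) 1 × ℝ =>
          ∫⁻ s in Ioo ρ ε, ‖gradient p (a + s • (q.1 : E N))‖ₑ)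
          (hm.comp measurable_fst).aemeasurable]
        simp only [lintegral_const, radialMeasure_univ hN hε hρ.le]
        rw [lintegral_mul_const _ hm, mul_comm]

theorem sphereSurface_univ (a : E N) : sphereSurface a ρ univ =
    ENNReal.ofReal (ρ ^ (N - 1)) * sphereMeasure N univ := by
  rw [sphereSurface, Measure.smul_apply, Measure.map_apply (by fun_prop) MeasurableSet.univ]
  rfl

theorem annulusDensity_mul_volume (hN : 1 ≤ N) (hε : 0 < ε) (hρ : 0 ≤ ρ) (a : E N) :
    annulusDensity N ρ ε * volume.real (annulus a ε) = ρ ^ (N - 1) * sphereArea N := by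
  have := isFiniteMeasure_radialMeasure hN hε hρ
  have h := congrArg (fun μ : Measure (E N) => (μ univ).toReal)
    (smul_restrict_annulus_eq_map hN hε hρ a)
  rw [Measure.map_apply (by fun_prop) MeasurableSet.univ, preimage_univ, Measure.prod_apply
    MeasurableSet.univ] at h
  simp only [Measure.smul_apply, Measure.restrict_apply_univ, smul_eq_mul, ENNReal.toReal_mul,
    ENNReal.toReal_ofReal (annulusDensity_nonneg hN hε hρ), preimage_univ, lintegral_const,
    radialMeasure_univ hN hε hρ, ENNReal.toReal_ofReal (pow_nonneg hρ _)] at h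
  exact h

end Spheres

/-! ### The surface of the inclusions -/

section Inclusions

variable {N : ℕ} {Ω : Set (E N)} {ρ ε : ℝ}

/-- The union of the annuli around the centres. -/
def centreAnnuli (Ω : Set (E N)) (ε : ℝ) : Set (E N) := ⋃ a : centres Ω ε, annulus (a : E N) ε

/-- The sum of the shell measures around the centres. -/
noncomputable def shellsMeasure (Ω : Set (E N)) (ρ ε : ℝ) : Measure (E N) :=
  Measure.sum fun a : centres Ω ε => shellMeasure (a : E N) ρ ε

theorem measurableSet_centreAnnuli (hΩ : Bornology.IsBounded Ω) (hε : 0 < ε) :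
    MeasurableSet (centreAnnuli Ω ε) := by
  have := (centres_finite hΩ hε).to_subtype
  exact MeasurableSet.iUnion fun _ => measurableSet_annulus _ _

theorem disjoint_ball_of_mem_centres (hε : 0 < ε) {a b : E N} (ha : a ∈ centres Ω ε)
    (hb : b ∈ centres Ω ε) (hab : a ≠ b) : Disjoint (Metric.ball a ε) (Metric.ball b ε) := by
  refine Metric.ball_disjoint_ball ?_
  linarith [le_dist_of_mem_centres hε ha hb hab]

theorem shell_subset_perforated (hε : 0 < ε) (hρ : ρ < ε) {a : E N} (ha : a ∈ centres Ω ε) :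
    Metric.ball a ε \ Metric.closedBall a ρ ⊆ perforated Ω ρ ε := by
  rintro x ⟨h1, h2⟩
  refine ⟨ball_subset_of_mem_centres ha h1, fun h => ?_⟩
  obtain ⟨b, hb, hxb⟩ := mem_iUnion₂.1 h
  have hab : a ≠ b := fun h => h2 (h ▸ hxb)
  exact disjoint_left.1 (disjoint_ball_of_mem_centres hε ha hb hab) h1
    (Metric.closedBall_subset_ball hρ hxb)

theorem centreAnnuli_subset_perforated (hε : 0 < ε) (hρ : ρ < ε / 2) :
    centreAnnuli Ω ε ⊆ perforated Ω ρ ε := by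
  refine iUnion_subset fun a => Subset.trans ?_
    (shell_subset_perforated hε (by linarith) a.2)
  exact sdiff_subset_sdiff_right (Metric.closedBall_subset_ball hρ)

theorem innerSurface_univ (hΩ : Bornology.IsBounded Ω) (hε : 0 < ε) :
    innerSurface Ω ρ ε univ =
      (centres Ω ε).ncard * (ENNReal.ofReal (ρ ^ (N - 1)) * sphereMeasure N univ) := by
  have := (centres_finite hΩ hε).fintype
  rw [innerSurface, Measure.sum_apply _ MeasurableSet.univ, tsum_fintype]
  simp_rw [sphereSurface_univ]
  rw [Finset.sum_const, Finset.card_univ, nsmul_eq_mul, ← Nat.card_eq_fintype_card,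
    Nat.card_coe_set_eq]

theorem innerSurface_real_univ (hΩ : Bornology.IsBounded Ω) (hε : 0 < ε) (hρ : 0 ≤ ρ) :
    (innerSurface Ω ρ ε).real univ = (centres Ω ε).ncard * ρ ^ (N - 1) * sphereArea N := by
  rw [measureReal_def, innerSurface_univ hΩ hε, sphereArea, measureReal_def]
  simp [ENNReal.toReal_ofReal (pow_nonneg hρ _), mul_assoc]

theorem isFiniteMeasure_innerSurface (hΩ : Bornology.IsBounded Ω) (hε : 0 < ε) :
    IsFiniteMeasure (innerSurface Ω ρ ε) :=
  ⟨by rw [innerSurface_univ hΩ hε]; finiteness⟩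

/-- Each shell measure has mass `ε - ρ` times the area of its sphere. The factor `ε` is the gain in
the `L²` comparison of spheres with annuli. -/
theorem shellsMeasure_univ_le (hΩ : Bornology.IsBounded Ω) (hε : 0 < ε) (hρ : 0 ≤ ρ) :
    shellsMeasure Ω ρ ε univ ≤ ENNReal.ofReal ε * innerSurface Ω ρ ε univ := by
  have := (centres_finite hΩ hε).fintype
  rw [shellsMeasure, innerSurface, Measure.sum_apply _ MeasurableSet.univ,
    Measure.sum_apply _ MeasurableSet.univ, tsum_fintype, tsum_fintype, Finset.mul_sum]
  refine Finset.sum_le_sum fun a _ => ?_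
  rw [shellMeasure_univ, sphereSurface_univ, ← mul_assoc, mul_comm]
  exact mul_le_mul_left (ENNReal.ofReal_le_ofReal (by linarith)) _

theorem shellsMeasure_le (hN : 1 ≤ N) (hΩ : Bornology.IsBounded Ω) (hε : 0 < ε) (hρ : 0 < ρ)
    (hρε : ρ < ε) : shellsMeasure Ω ρ ε ≤ volume.restrict (perforated Ω ρ ε) := by
  have := (centres_finite hΩ hε).to_subtype
  have h1 : shellsMeasure Ω ρ ε ≤ Measure.sum fun a : centres Ω ε =>
      volume.restrict (Metric.ball (a : E N) ε \ Metric.closedBall (a : E N) ρ) := by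
    refine Measure.le_iff.2 fun B hB => ?_
    rw [shellsMeasure, Measure.sum_apply _ hB, Measure.sum_apply _ hB]
    exact ENNReal.tsum_le_tsum fun a => shellMeasure_le hN hρ (a : E N) B
  refine h1.trans ?_
  rw [← Measure.restrict_iUnion]
  · exact Measure.restrict_mono (iUnion_subset fun a => shell_subset_perforated hε hρε a.2) le_rfl
  · intro a b hab
    exact (disjoint_ball_of_mem_centres hε a.2 b.2 fun h => hab (Subtype.ext h)).mono
      sdiff_subset sdiff_subset
  · exact fun a => measurableSet_ball.diff measurableSet_closedBall

theorem restrict_centreAnnuli (hΩ : Bornology.IsBounded Ω) (hε : 0 < ε) :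
    volume.restrict (centreAnnuli Ω ε) =
      Measure.sum fun a : centres Ω ε => volume.restrict (annulus (a : E N) ε) := by
  have := (centres_finite hΩ hε).to_subtype
  refine Measure.restrict_iUnion ?_ fun a => measurableSet_annulus _ _
  intro a b hab
  exact (disjoint_ball_of_mem_centres hε a.2 b.2 fun h => hab (Subtype.ext h)).mono
    sdiff_subset sdiff_subset

theorem centreAnnuli_subset : centreAnnuli Ω ε ⊆ Ω :=
  iUnion_subset fun a => sdiff_subset.trans (ball_subset_of_mem_centres a.2)

theorem ae_innerSurface_iff (hΩ : Bornology.IsBounded Ω) (hε : 0 < ε) (hρ : 0 < ρ)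
    {P : E N → Prop} : (∀ᵐ x ∂(innerSurface Ω ρ ε), P x) ↔
      ∀ a ∈ centres Ω ε, ∀ᵐ m : Metric.sphere (0 : E N) 1 ∂(sphereMeasure N),
        P (a + ρ • (m : E N)) := by
  have := (centres_finite hΩ hε).to_subtype
  rw [innerSurface, Measure.ae_sum_iff]
  have h0 : ENNReal.ofReal (ρ ^ (N - 1)) ≠ 0 := by
    rw [Ne, ENNReal.ofReal_eq_zero, not_le]; positivity
  have he : ∀ a : E N, MeasurableEmbedding
      fun m : Metric.sphere (0 : E N) 1 => a + ρ • (m : E N) := fun a =>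
    (measurableEmbedding_addLeft a).comp ((measurableEmbedding_const_smul₀ hρ.ne').comp
      (MeasurableEmbedding.subtype_coe Metric.isClosed_sphere.measurableSet))
  simp_rw [sphereSurface, Measure.ae_ennreal_smul_measure_iff h0, (he _).ae_map_iff]
  simp

theorem innerSurface_compl_inclusions (hΩ : Bornology.IsBounded Ω) (hε : 0 < ε) (hρ : 0 < ρ) :
    innerSurface Ω ρ ε (inclusions Ω ρ ε)ᶜ = 0 := by
  have h : ∀ᵐ x ∂(innerSurface Ω ρ ε), x ∈ inclusions Ω ρ ε := by
    refine (ae_innerSurface_iff hΩ hε hρ).2 fun a ha => ae_of_all _ fun m => ?_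
    refine mem_iUnion₂.2 ⟨a, ha, ?_⟩
    simp [norm_smul, abs_of_pos hρ]
  exact h

theorem integrable_innerSurface (hΩ : Bornology.IsBounded Ω) (hε : 0 < ε) (hρ : 0 < ρ)
    {p : E N → ℝ} (hp : Continuous p) : Integrable p (innerSurface Ω ρ ε) := by
  have := isFiniteMeasure_innerSurface (ρ := ρ) hΩ hε
  rw [← memLp_one_iff_integrable]
  exact memLp_of_continuous (isCompact_inclusions hΩ hε ρ)
    (innerSurface_compl_inclusions hΩ hε hρ) hp 1

theorem enorm_sub_le_shellsMeasure (hN : 1 ≤ N) (hΩ : Bornology.IsBounded Ω) (hρ : 0 < ρ)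
    (hρε : ρ < ε / 2) {p : E N → ℝ} (hp : ContDiff ℝ ∞ p) :
    ‖∫ x, p x ∂(innerSurface Ω ρ ε) - annulusDensity N ρ ε * ∫ x in centreAnnuli Ω ε, p x‖ₑ ≤
      ∫⁻ x, ‖gradient p x‖ₑ ∂(shellsMeasure Ω ρ ε) := by
  have hε : 0 < ε := by linarith
  have := (centres_finite hΩ hε).fintype
  have h1 := integrable_innerSurface hΩ hε hρ hp.continuous
  have h2 : Integrable p (volume.restrict (centreAnnuli Ω ε)) := by
    rw [← memLp_one_iff_integrable]
    exact memLp_restrict_of_continuous (hΩ.subset centreAnnuli_subset) hp.continuous 1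
  rw [restrict_centreAnnuli hΩ hε] at h2 ⊢
  rw [shellsMeasure, lintegral_sum_measure, integral_sum_measure h2, innerSurface,
    integral_sum_measure h1, tsum_fintype, tsum_fintype, tsum_fintype, Finset.mul_sum,
    ← Finset.sum_sub_distrib]
  exact (enorm_sum_le _ _).trans
    (Finset.sum_le_sum fun a _ => enorm_sub_le_shellMeasure hN hρ hρε (a : E N) hp)

/-- Spheres against annuli, with the `L¹` norm of the gradient. -/
theorem enorm_sub_le_lintegral_perforated (hN : 1 ≤ N) (hΩ : Bornology.IsBounded Ω) (hρ : 0 < ρ)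
    (hρε : ρ < ε / 2) {p : E N → ℝ} (hp : ContDiff ℝ ∞ p) :
    ‖∫ x, p x ∂(innerSurface Ω ρ ε) - annulusDensity N ρ ε * ∫ x in centreAnnuli Ω ε, p x‖ₑ ≤
      ∫⁻ x in perforated Ω ρ ε, ‖gradient p x‖ₑ :=
  (enorm_sub_le_shellsMeasure hN hΩ hρ hρε hp).trans
    (lintegral_mono' (shellsMeasure_le hN hΩ (by linarith) hρ (by linarith)) le_rfl)

/-- Spheres against annuli, with the `L²` norm of the gradient. -/
theorem enorm_sub_sq_le_lintegral_perforated (hN : 1 ≤ N) (hΩ : Bornology.IsBounded Ω) (hρ : 0 < ρ)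
    (hρε : ρ < ε / 2) {p : E N → ℝ} (hp : ContDiff ℝ ∞ p) :
    ‖∫ x, p x ∂(innerSurface Ω ρ ε) - annulusDensity N ρ ε * ∫ x in centreAnnuli Ω ε, p x‖ₑ ^ 2 ≤
      ENNReal.ofReal ε * innerSurface Ω ρ ε univ *
        ∫⁻ x in perforated Ω ρ ε, ‖gradient p x‖ₑ ^ 2 := by
  refine (pow_le_pow_left' (enorm_sub_le_shellsMeasure hN hΩ hρ hρε hp) 2).trans ?_
  refine (sq_lintegral_le _ (continuous_gradient hp).enorm.measurable.aemeasurable).trans ?_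
  exact mul_le_mul' (shellsMeasure_univ_le hΩ (by linarith) hρ.le)
    (lintegral_mono' (shellsMeasure_le hN hΩ (by linarith) hρ (by linarith)) le_rfl)

theorem volume_inclusions_le (hΩ : Bornology.IsBounded Ω) (hε : 0 < ε) (hρ : 0 ≤ ρ) :
    volume (inclusions Ω ρ ε) ≤
      ENNReal.ofReal ((centres Ω ε).ncard * ρ ^ N) * volume (Metric.ball (0 : E N) 1) := by
  have := (centres_finite hΩ hε).fintype
  rw [inclusions, biUnion_eq_iUnion]
  refine (measure_iUnion_le _).trans (le_of_eq ?_)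
  simp_rw [Measure.addHaar_closedBall _ _ hρ, finrank_euclideanSpace_fin]
  rw [tsum_fintype, Finset.sum_const, Finset.card_univ, nsmul_eq_mul,
    ← Nat.card_eq_fintype_card, Nat.card_coe_set_eq, ENNReal.ofReal_mul (by positivity),
    ENNReal.ofReal_natCast, mul_assoc]

end Inclusions

/-! ### The trace operator -/

section Trace

variable {N : ℕ} {U : Set (E N)} {ν : Measure (E N)}

/-- Pairs of a smooth function and its boundary values. -/
def smoothPairs (U : Set (E N)) (ν : Measure (E N)) : Submodule ℝ (H1 U × Lp ℝ 2 ν) where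
  carrier := {q | ∃ φ : E N → ℝ, ContDiff ℝ ∞ φ ∧ toFn q.1 =ᵐ[volume.restrict U] φ ∧
    weakGrad q.1 =ᵐ[volume.restrict U] gradient φ ∧ q.2 =ᵐ[ν] φ}
  zero_mem' := by
    refine ⟨fun _ => 0, contDiff_const, Lp.coeFn_zero _ _ _, ?_, Lp.coeFn_zero _ _ _⟩
    refine (Lp.coeFn_zero _ _ _).trans (ae_of_all _ fun x => ?_)
    rw [gradient_const']; rfl
  add_mem' := by
    rintro p q ⟨φ, h1, h2, h3, h4⟩ ⟨ψ, k1, k2, k3, k4⟩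
    refine ⟨fun x => φ x + ψ x, h1.add k1, ?_, ?_, ?_⟩
    · exact (Lp.coeFn_add (toFn p.1) (toFn q.1)).trans (h2.add k2)
    · refine (Lp.coeFn_add (weakGrad p.1) (weakGrad q.1)).trans ((h3.add k3).trans ?_)
      exact ae_of_all _ fun x => (gradient_add' h1 k1 x).symm
    · exact (Lp.coeFn_add p.2 q.2).trans (h4.add k4)
  smul_mem' := by
    rintro c p ⟨φ, h1, h2, h3, h4⟩
    refine ⟨fun x => c * φ x, contDiff_const.mul h1, ?_, ?_, ?_⟩
    · exact (Lp.coeFn_smul c (toFn p.1)).trans (h2.const_smul c)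
    · refine (Lp.coeFn_smul c (weakGrad p.1)).trans ((h3.const_smul c).trans ?_)
      exact ae_of_all _ fun x => (gradient_const_mul' c h1 x).symm
    · exact (Lp.coeFn_smul c p.2).trans (h4.const_smul c)

theorem hasTrace_iff_seq (hν : ∀ φ : E N → ℝ, ContDiff ℝ ∞ φ → MemLp φ 2 ν)
    {v : H1 U} {t : Lp ℝ 2 ν} :
    HasTrace ν v t ↔ ∃ q : ℕ → H1 U × Lp ℝ 2 ν, (∀ n, q n ∈ smoothPairs U ν) ∧
      Tendsto (fun n => ‖(q n).1 - v‖) atTop (𝓝 0) ∧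
      Tendsto (fun n => ‖(q n).2 - t‖) atTop (𝓝 0) := by
  constructor
  · rintro ⟨φ, V, h1, h2, h3, h4, h5⟩
    refine ⟨fun n => (V n, (hν _ (h1 n)).toLp _), fun n => ⟨φ n, h1 n, h2 n, h3 n,
      (hν _ (h1 n)).coeFn_toLp⟩, tendsto_iff_norm_sub_tendsto_zero.1 h4, ?_⟩
    rw [← tendsto_iff_norm_sub_tendsto_zero, Lp.tendsto_Lp_iff_tendsto_eLpNorm']
    refine h5.congr fun n => eLpNorm_congr_ae ?_
    exact ((hν _ (h1 n)).coeFn_toLp.symm.sub (ae_eq_refl _))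
  · rintro ⟨q, hq, hl1, hl2⟩
    choose φ h1 h2 h3 h4 using hq
    refine ⟨φ, fun n => (q n).1, h1, h2, h3, tendsto_iff_norm_sub_tendsto_zero.2 hl1, ?_⟩
    rw [← tendsto_iff_norm_sub_tendsto_zero, Lp.tendsto_Lp_iff_tendsto_eLpNorm'] at hl2
    exact hl2.congr fun n => eLpNorm_congr_ae ((h4 n).sub (ae_eq_refl _))

/-- Traces are limits of elements of the submodule `smoothPairs`, so they inherit linearity.
Differences are needed for uniqueness and for polarization. -/
theorem HasTrace.sub (hν : ∀ φ : E N → ℝ, ContDiff ℝ ∞ φ → MemLp φ 2 ν) {v w : H1 U}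
    {t s : Lp ℝ 2 ν} (h : HasTrace ν v t) (h' : HasTrace ν w s) : HasTrace ν (v - w) (t - s) := by
  rw [hasTrace_iff_seq hν] at *
  obtain ⟨q, h1, h2, h3⟩ := h
  obtain ⟨p, k1, k2, k3⟩ := h'
  refine ⟨fun n => q n - p n, fun n => sub_mem (h1 n) (k1 n), ?_, ?_⟩
  · refine squeeze_zero (fun _ => norm_nonneg _) (fun n => ?_) (by simpa using h2.add k2)
    rw [Prod.fst_sub, sub_sub_sub_comm]
    exact norm_sub_le _ _
  · refine squeeze_zero (fun _ => norm_nonneg _) (fun n => ?_) (by simpa using h3.add k3)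
    rw [Prod.snd_sub, sub_sub_sub_comm]
    exact norm_sub_le _ _

theorem HasTrace.add (hν : ∀ φ : E N → ℝ, ContDiff ℝ ∞ φ → MemLp φ 2 ν) {v w : H1 U}
    {t s : Lp ℝ 2 ν} (h : HasTrace ν v t) (h' : HasTrace ν w s) : HasTrace ν (v + w) (t + s) := by
  rw [hasTrace_iff_seq hν] at *
  obtain ⟨q, h1, h2, h3⟩ := h
  obtain ⟨p, k1, k2, k3⟩ := h'
  refine ⟨fun n => q n + p n, fun n => add_mem (h1 n) (k1 n), ?_, ?_⟩
  · refine squeeze_zero (fun _ => norm_nonneg _) (fun n => ?_) (by simpa using h2.add k2)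
    rw [Prod.fst_add, add_sub_add_comm]
    exact norm_add_le _ _
  · refine squeeze_zero (fun _ => norm_nonneg _) (fun n => ?_) (by simpa using h3.add k3)
    rw [Prod.snd_add, add_sub_add_comm]
    exact norm_add_le _ _

theorem hasTrace_ofSmooth (hU : Bornology.IsBounded U) {φ : E N → ℝ} (hφ : ContDiff ℝ ∞ φ)
    (hm : MemLp φ 2 ν) : HasTrace ν (ofSmooth hU hφ) (hm.toLp φ) := by
  refine ⟨fun _ => φ, fun _ => ofSmooth hU hφ, fun _ => hφ, fun _ => toFn_ofSmooth _ _,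
    fun _ => weakGrad_ofSmooth _ _, tendsto_const_nhds, ?_⟩
  have : eLpNorm (fun x => φ x - hm.toLp φ x) 2 ν = 0 := by
    rw [← eLpNorm_zero (p := 2) (μ := ν) (ε := ℝ)]
    refine eLpNorm_congr_ae ?_
    filter_upwards [hm.coeFn_toLp] with x hx
    simp [hx]
  simp_rw [this]
  exact tendsto_const_nhds

theorem enorm_sq_eq_lintegral {X F : Type*} [MeasurableSpace X] [NormedAddCommGroup F]
    {μ : Measure X} (f : Lp F 2 μ) : ‖f‖ₑ ^ 2 = ∫⁻ x, ‖f x‖ₑ ^ 2 ∂μ := by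
  rw [Lp.enorm_def, eLpNorm_two_sq]

theorem enorm_sq_eq_energy {v : H1 U} {φ : E N → ℝ} (h1 : toFn v =ᵐ[volume.restrict U] φ)
    (h2 : weakGrad v =ᵐ[volume.restrict U] gradient φ) : ‖v‖ₑ ^ 2 = energy U φ := by
  have : ‖v‖ₑ ^ 2 = ‖toFn v‖ₑ ^ 2 + ‖weakGrad v‖ₑ ^ 2 := by
    simp only [← ofReal_norm]
    rw [← ENNReal.ofReal_pow (norm_nonneg _), ← ENNReal.ofReal_pow (norm_nonneg _),
      ← ENNReal.ofReal_pow (norm_nonneg _), H1.norm_sq, ENNReal.ofReal_add (by positivity)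
      (by positivity)]
  rw [this, enorm_sq_eq_lintegral, enorm_sq_eq_lintegral, energy]
  congr 1
  · exact lintegral_congr_ae (by filter_upwards [h1] with x hx; rw [hx])
  · exact lintegral_congr_ae (by filter_upwards [h2] with x hx; rw [hx])

theorem memLp_outerSurface {Ω : Set (E N)} (hΩ : IsSmoothBoundedDomain Ω) {F : Type*}
    [NormedAddCommGroup F] {φ : E N → F} (hφ : Continuous φ) : MemLp φ 2 (outerSurface Ω) := by
  have := isFiniteMeasure_outerSurface hΩ
  refine memLp_of_continuous (isCompact_frontier hΩ) ?_ hφ 2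
  rw [outerSurface, Measure.restrict_apply isClosed_frontier.measurableSet.compl]
  simp

theorem norm_le_of_mem_smoothPairs {C : ℝ≥0∞} (hC : C ≠ ⊤)
    (h : ∀ ψ : E N → ℝ, ContDiff ℝ ∞ ψ → ∫⁻ a, ‖ψ a‖ₑ ^ 2 ∂ν ≤ C * energy U ψ)
    {q : H1 U × Lp ℝ 2 ν} (hq : q ∈ smoothPairs U ν) : ‖q.2‖ ≤ √C.toReal * ‖q.1‖ := by
  obtain ⟨φ, h1, h2, h3, h4⟩ := hq
  obtain ⟨v, t⟩ := q
  have h5 := h φ h1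
  rw [← enorm_sq_eq_energy h2 h3] at h5
  have h6 : ‖t‖ₑ ^ 2 ≤ C * ‖v‖ₑ ^ 2 := by
    rw [enorm_sq_eq_lintegral]
    refine le_trans (le_of_eq (lintegral_congr_ae ?_)) h5
    filter_upwards [h4] with x hx
    rw [← hx]
  have h7 := ENNReal.toReal_mono (ENNReal.mul_ne_top hC (ENNReal.pow_ne_top enorm_ne_top)) h6
  rw [ENNReal.toReal_mul, ENNReal.toReal_pow, ENNReal.toReal_pow, toReal_enorm, toReal_enorm] at h7
  refine abs_le_of_sq_le_sq' ?_ (by positivity) |>.2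
  rw [mul_pow, Real.sq_sqrt ENNReal.toReal_nonneg]
  exact h7

/-- The closure of a bounded linear relation is, on a closed subspace, a bounded operator. -/
theorem exists_clm_of_bounded_relation {H F : Type*} [NormedAddCommGroup H] [InnerProductSpace ℝ H]
    [CompleteSpace H] [NormedAddCommGroup F] [NormedSpace ℝ F] [CompleteSpace F]
    (p : Submodule ℝ (H × F)) {C : ℝ} (hp : ∀ q ∈ p, ‖q.2‖ ≤ C * ‖q.1‖) :
    ∃ (V : Submodule ℝ H) (Tr : H →L[ℝ] F), IsClosed (V : Set H) ∧
      ∀ v t, (∃ q : ℕ → H × F, (∀ n, q n ∈ p) ∧ Tendsto (fun n => ‖(q n).1 - v‖) atTop (𝓝 0) ∧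
        Tendsto (fun n => ‖(q n).2 - t‖) atTop (𝓝 0)) ↔ v ∈ V ∧ t = Tr v := by
  set g := p.topologicalClosure
  have hgc : IsClosed (g : Set (H × F)) := Submodule.isClosed_topologicalClosure _
  have hle : ∀ q ∈ g, ‖q.2‖ ≤ C * ‖q.1‖ := fun q hq =>
    closure_minimal (t := {q : H × F | ‖q.2‖ ≤ C * ‖q.1‖}) hp
      (isClosed_le (by fun_prop) (by fun_prop)) hq
  have hgp : ∀ v t, (∃ q : ℕ → H × F, (∀ n, q n ∈ p) ∧
      Tendsto (fun n => ‖(q n).1 - v‖) atTop (𝓝 0) ∧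
      Tendsto (fun n => ‖(q n).2 - t‖) atTop (𝓝 0)) ↔ (v, t) ∈ g := fun v t => by
    rw [← SetLike.mem_coe, Submodule.topologicalClosure_coe, mem_closure_iff_seq_limit]
    simp only [← tendsto_iff_norm_sub_tendsto_zero, Prod.tendsto_iff, SetLike.mem_coe]
  have hg0 : ∀ q ∈ g, q.1 = 0 → q.2 = 0 := fun q hq h0 => by
    have := hle q hq
    rw [h0, norm_zero, mul_zero] at this
    exact norm_le_zero_iff.1 this
  set τ := g.toLinearPMap
  have hgr : ∀ q, q ∈ g ↔ q ∈ τ.graph := fun q => by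
    rw [Submodule.toLinearPMap_graph_eq g hg0]
  -- On the closed graph the first component controls both components. The projection to `H` is
  -- therefore antilipschitz on a complete space and has closed range. The constant `max 1 C` comes
  -- from the maximum norm on the product.
  have hVc : IsClosed (τ.domain : Set H) := by
    have : CompleteSpace g := hgc.completeSpace_coe
    have hal : AntilipschitzWith (Real.toNNReal (max 1 C)) fun q : g => (q : H × F).1 := by
      refine AntilipschitzWith.of_le_mul_dist fun p q => ?_
      have h1 := hle _ (sub_mem p.2 q.2)
      rw [Subtype.dist_eq, dist_eq_norm, dist_eq_norm, Prod.norm_def,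
        Real.coe_toNNReal _ (le_max_of_le_left zero_le_one)]
      have h0 := norm_nonneg ((p : H × F).1 - (q : H × F).1)
      refine max_le ?_ (h1.trans ?_)
      · rw [Prod.fst_sub]
        exact le_mul_of_one_le_left h0 (le_max_left _ _)
      · exact mul_le_mul_of_nonneg_right (le_max_right _ _) h0
    have hr := hal.isClosed_range (uniformContinuous_fst.comp uniformContinuous_subtype_val)
    convert hr using 1
    ext x
    simp [τ, Submodule.toLinearPMap_domain]
  have : CompleteSpace τ.domain := hVc.completeSpace_coe
  let τ' : τ.domain →L[ℝ] F := τ.toFun.mkContinuous C fun x =>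
    hle _ ((hgr _).2 (τ.mem_graph x))
  -- Composition with the orthogonal projection makes the operator total. It then acts on weakly
  -- convergent families, while membership in the domain is recorded separately.
  refine ⟨τ.domain, τ'.comp τ.domain.orthogonalProjectionOnto, hVc, fun v t => ?_⟩
  rw [hgp, hgr, LinearPMap.mem_graph_iff]
  constructor
  · rintro ⟨y, hy, hyt⟩
    simp only at hy hyt
    subst hy hyt
    refine ⟨y.2, ?_⟩
    simp only [ContinuousLinearMap.comp_apply, Submodule.orthogonalProjectionOnto_mem_subspace_eq_self]
    rfl
  · rintro ⟨hv, rfl⟩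
    refine ⟨⟨v, hv⟩, rfl, ?_⟩
    have : τ.domain.orthogonalProjectionOnto v = ⟨v, hv⟩ :=
      Submodule.orthogonalProjectionOnto_mem_subspace_eq_self (K := τ.domain) ⟨v, hv⟩
    rw [ContinuousLinearMap.comp_apply, this]
    rfl

set_option maxHeartbeats 1000000 in
/-- The functions with a trace form a closed subspace, and the trace is the restriction of a
bounded operator. -/
theorem exists_traceOperator {Ω : Set (E N)} (hΩ : IsSmoothBoundedDomain Ω) :
    ∃ (V : Submodule ℝ (H1 Ω)) (Tr : H1 Ω →L[ℝ] Lp ℝ 2 (outerSurface Ω)),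
      IsClosed (V : Set (H1 Ω)) ∧
      ∀ v t, HasTrace (outerSurface Ω) v t ↔ v ∈ V ∧ t = Tr v := by
  obtain ⟨C, hC, hle⟩ := exists_trace_le hΩ
  have hν : ∀ φ : E N → ℝ, ContDiff ℝ ∞ φ → MemLp φ 2 (outerSurface Ω) := fun φ hφ =>
    memLp_outerSurface hΩ hφ.continuous
  generalize outerSurface Ω = ν at *
  obtain ⟨V, Tr, h1, h2⟩ := exists_clm_of_bounded_relation (smoothPairs Ω ν)
    fun q hq => norm_le_of_mem_smoothPairs hC hle hq
  exact ⟨V, Tr, h1, fun v t => (hasTrace_iff_seq hν).trans (h2 v t)⟩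

/-- A closed subspace is the annihilator of its orthogonal complement, and each of these linear
conditions passes to a weak limit. -/
theorem WeaklyTendsto.mem_of_isClosed {ι H : Type*} [NormedAddCommGroup H] [InnerProductSpace ℝ H]
    [CompleteSpace H] {V : Submodule ℝ H} (hV : IsClosed (V : Set H)) {w : ι → H} {l : Filter ι}
    [l.NeBot] {u : H} (h : WeaklyTendsto w l u) (hw : ∀ᶠ i in l, w i ∈ V) : u ∈ V := by
  have : CompleteSpace V := hV.completeSpace_coe
  rw [← Submodule.orthogonal_orthogonal V, Submodule.mem_orthogonal]
  intro x hx
  refine tendsto_nhds_unique (h (innerSL ℝ x)) (tendsto_const_nhds.congr' ?_)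
  filter_upwards [hw] with i hi
  rw [innerSL_apply_apply, Submodule.inner_left_of_mem_orthogonal hi hx]

end Trace

/-! ### Asymptotics at the critical scale -/

section Asymptotics

variable {N : ℕ} {Ω : Set (E N)} {r : ℝ → ℝ} {S : ℝ}

theorem sphereArea_pos (hN : 1 ≤ N) : 0 < sphereArea N := by
  rw [sphereArea, sphereMeasure, Measure.toSphere_real_apply_univ, finrank_euclideanSpace_fin]
  have h1 : 0 < volume.real (Metric.ball (0 : E N) 1) :=
    ENNReal.toReal_pos (Metric.measure_ball_pos _ _ one_pos).ne' measure_ball_lt_top.ne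
  have h2 : (0 : ℝ) < N := by exact_mod_cast hN
  positivity

theorem volume_real_pos (hΩ : IsSmoothBoundedDomain Ω) : 0 < volume.real Ω :=
  ENNReal.toReal_pos (hΩ.isOpen.measure_pos volume hΩ.isConnected.nonempty).ne'
    hΩ.isBounded.measure_lt_top.ne

theorem volume_real_gridCell_pos (ε : ℝ) : 0 < volume.real (gridCell N ε) :=
  ENNReal.toReal_pos (volume_gridCell_ne_zero ε) (volume_gridCell_ne_top ε)

theorem tendsto_gridCell_mul_ncard (hN : 1 ≤ N) (hΩ : IsSmoothBoundedDomain Ω) :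
    Tendsto (fun ε => volume.real (gridCell N ε) * ((centres Ω ε).ncard : ℝ)) (𝓝[>] 0)
      (𝓝 (volume.real Ω)) := by
  have h := tendsto_sum_centres hN hΩ (ζ := fun _ => (1 : ℝ)) continuous_const
  simp only [integral_const, smul_eq_mul, mul_one, measureReal_restrict_apply_univ] at h
  refine h.congr' ?_
  filter_upwards [self_mem_nhdsWithin] with ε hε
  rw [finsum_mem_eq_finite_toFinset_sum _ (centres_finite hΩ.isBounded hε), Finset.sum_const,
    ← ncard_eq_toFinset_card _ (centres_finite hΩ.isBounded hε), nsmul_eq_mul, mul_one]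

/-- The surface area of a sphere of radius `ρ` divided by the volume of a cell. -/
noncomputable def cellDensity (N : ℕ) (ρ ε : ℝ) : ℝ :=
  ρ ^ (N - 1) * sphereArea N / volume.real (gridCell N ε)

theorem cellDensity_nonneg {ρ ε : ℝ} (hρ : 0 ≤ ρ) : 0 ≤ cellDensity N ρ ε :=
  div_nonneg (mul_nonneg (pow_nonneg hρ _) measureReal_nonneg) measureReal_nonneg

theorem annulusDensity_mul_volume_annulus (hN : 1 ≤ N) {ρ ε : ℝ} (hε : 0 < ε) (hρ : 0 ≤ ρ) :
    annulusDensity N ρ ε * volume.real (annulus (0 : E N) ε) =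
      cellDensity N ρ ε * volume.real (gridCell N ε) := by
  rw [annulusDensity_mul_volume hN hε hρ, cellDensity,
    div_mul_cancel₀ _ (volume_real_gridCell_pos ε).ne']

/-- The number of centres cancels between the limit `S` of `ncard * r ^ (N - 1)` and the limit `|Ω|`
of the cell volume times `ncard`. -/
theorem tendsto_pow_div_gridCell (hN : 1 ≤ N) (hΩ : IsSmoothBoundedDomain Ω)
    (hrS : Tendsto (fun ε => ((centres Ω ε).ncard : ℝ) * r ε ^ (N - 1)) (𝓝[>] 0) (𝓝 S)) :
    Tendsto (fun ε => r ε ^ (N - 1) / volume.real (gridCell N ε)) (𝓝[>] 0)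
      (𝓝 (S / volume.real Ω)) := by
  have h1 := tendsto_gridCell_mul_ncard hN hΩ
  have hp := volume_real_pos hΩ
  refine (hrS.div h1 hp.ne').congr' ?_
  filter_upwards [h1.eventually_const_lt hp] with ε hε
  have hV := volume_real_gridCell_pos (N := N) ε
  have hn : ((centres Ω ε).ncard : ℝ) ≠ 0 := fun h => by simp [h] at hε
  rw [Pi.div_apply]
  field_simp

theorem tendsto_cellDensity (hN : 1 ≤ N) (hΩ : IsSmoothBoundedDomain Ω)
    (hrS : Tendsto (fun ε => ((centres Ω ε).ncard : ℝ) * r ε ^ (N - 1)) (𝓝[>] 0) (𝓝 S)) :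
    Tendsto (fun ε => cellDensity N (r ε) ε) (𝓝[>] 0)
      (𝓝 (sphereArea N * S / volume.real Ω)) := by
  have h := (tendsto_pow_div_gridCell hN hΩ hrS).const_mul (sphereArea N)
  rw [← mul_div_assoc] at h
  refine h.congr fun ε => ?_
  rw [cellDensity]; ring

theorem exists_pow_le (hN : 1 ≤ N) (hΩ : IsSmoothBoundedDomain Ω)
    (hrS : Tendsto (fun ε => ((centres Ω ε).ncard : ℝ) * r ε ^ (N - 1)) (𝓝[>] 0) (𝓝 S)) :
    ∃ C : ℝ, ∀ᶠ ε in 𝓝[>] (0 : ℝ), r ε ^ (N - 1) ≤ C * ε ^ N := by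
  have h := tendsto_pow_div_gridCell hN hΩ hrS
  refine ⟨(|S / volume.real Ω| + 1) * ((2 * N) ^ N * volume.real (Metric.ball (0 : E N) 1)), ?_⟩
  filter_upwards [h.eventually_lt_const (lt_of_le_of_lt (le_abs_self _) (lt_add_one _)),
    self_mem_nhdsWithin] with ε h1 h2
  rw [div_lt_iff₀ (volume_real_gridCell_pos ε)] at h1
  refine h1.le.trans ?_
  rw [mul_assoc]
  exact mul_le_mul_of_nonneg_left (volume_gridCell_le h2) (by positivity)

/-- As `r ε ^ (N - 1)` is at most of order `ε ^ N`, a radius of at least `ε / 2` would force `(ε /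
2) ^ (N - 1) ≤ C * ε ^ N`, which fails for small `ε`. -/
theorem eventually_lt_half (hN : 1 ≤ N) (hΩ : IsSmoothBoundedDomain Ω)
    (hrS : Tendsto (fun ε => ((centres Ω ε).ncard : ℝ) * r ε ^ (N - 1)) (𝓝[>] 0) (𝓝 S)) :
    ∀ᶠ ε in 𝓝[>] (0 : ℝ), r ε < ε / 2 := by
  obtain ⟨C, hC⟩ := exists_pow_le hN hΩ hrS
  have h0 : Tendsto (fun ε : ℝ => C * 2 ^ (N - 1) * ε) (𝓝[>] 0) (𝓝 0) := by
    have : Continuous fun ε : ℝ => C * 2 ^ (N - 1) * ε := by fun_prop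
    simpa using (this.tendsto 0).mono_left nhdsWithin_le_nhds
  filter_upwards [hC, self_mem_nhdsWithin, h0.eventually_lt_const one_pos] with ε h1 h2 h3
  have h2 : 0 < ε := h2
  by_contra! h4
  have h5 := (pow_le_pow_left₀ (by positivity) h4 (N - 1)).trans h1
  obtain ⟨k, rfl⟩ := Nat.exists_eq_add_of_le' hN
  simp only [Nat.add_sub_cancel] at h3 h5
  rw [div_pow, div_le_iff₀ (by positivity), pow_succ] at h5
  have h6 : 0 < ε ^ k := by positivity
  nlinarith

theorem exists_annulusDensity_le (hN : 1 ≤ N) (hΩ : IsSmoothBoundedDomain Ω)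
    (hr : ∀ ε > 0, 0 < r ε ∧ r ε < ε)
    (hrS : Tendsto (fun ε => ((centres Ω ε).ncard : ℝ) * r ε ^ (N - 1)) (𝓝[>] 0) (𝓝 S)) :
    ∃ C : ℝ, 0 ≤ C ∧ ∀ᶠ ε in 𝓝[>] (0 : ℝ), annulusDensity N (r ε) ε ≤ C := by
  obtain ⟨C, hC⟩ := exists_pow_le hN hΩ hrS
  refine ⟨|C| * 2 ^ N, by positivity, ?_⟩
  filter_upwards [hC, self_mem_nhdsWithin] with ε h1 h2
  have h2 : 0 < ε := h2
  refine (annulusDensity_le hN h2 (hr ε h2).1.le).trans ?_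
  rw [div_le_iff₀ (by positivity), div_pow, mul_assoc, mul_div_cancel₀ _ (by positivity)]
  exact h1.trans (mul_le_mul_of_nonneg_right (le_abs_self _) (by positivity))

theorem tendsto_volume_inclusions (hN : 1 ≤ N) (hΩ : IsSmoothBoundedDomain Ω)
    (hr : ∀ ε > 0, 0 < r ε ∧ r ε < ε)
    (hrS : Tendsto (fun ε => ((centres Ω ε).ncard : ℝ) * r ε ^ (N - 1)) (𝓝[>] 0) (𝓝 S)) :
    Tendsto (fun ε => volume (inclusions Ω (r ε) ε)) (𝓝[>] 0) (𝓝 0) := by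
  have h1 : Tendsto (fun ε : ℝ => ENNReal.ofReal (((centres Ω ε).ncard : ℝ) * r ε ^ (N - 1) * ε) *
      volume (Metric.ball (0 : E N) 1)) (𝓝[>] 0) (𝓝 0) := by
    have h2 := hrS.mul ((tendsto_id (x := 𝓝 (0 : ℝ))).mono_left nhdsWithin_le_nhds)
    rw [mul_zero] at h2
    have := ENNReal.Tendsto.mul_const (ENNReal.tendsto_ofReal h2)
      (b := volume (Metric.ball (0 : E N) 1)) (Or.inr measure_ball_lt_top.ne)
    simpa using this
  refine tendsto_of_tendsto_of_tendsto_of_le_of_le' tendsto_const_nhds h1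
    (Eventually.of_forall fun _ => zero_le) ?_
  filter_upwards [self_mem_nhdsWithin] with ε hε
  have h3 := hr ε hε
  refine (volume_inclusions_le hΩ.isBounded hε h3.1.le).trans ?_
  refine mul_le_mul_left (ENNReal.ofReal_le_ofReal ?_) _
  obtain ⟨k, rfl⟩ := Nat.exists_eq_add_of_le' hN
  rw [Nat.add_sub_cancel, pow_succ, ← mul_assoc]
  exact mul_le_mul_of_nonneg_left h3.2.le (mul_nonneg (Nat.cast_nonneg _) (pow_nonneg h3.1.le _))

theorem tendsto_innerSurface_real_univ (hΩ : IsSmoothBoundedDomain Ω)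
    (hr : ∀ ε > 0, 0 < r ε ∧ r ε < ε)
    (hrS : Tendsto (fun ε => ((centres Ω ε).ncard : ℝ) * r ε ^ (N - 1)) (𝓝[>] 0) (𝓝 S)) :
    Tendsto (fun ε => (innerSurface Ω (r ε) ε).real univ) (𝓝[>] 0) (𝓝 (S * sphereArea N)) := by
  refine (hrS.mul_const (sphereArea N)).congr' ?_
  filter_upwards [self_mem_nhdsWithin] with ε hε
  rw [innerSurface_real_univ hΩ.isBounded hε (hr ε hε).1.le]

end Asymptotics

/-! ### Squared norms as real integrals. -/

theorem lintegral_enorm_sq_eq {X F : Type*} [MeasurableSpace X] [NormedAddCommGroup F]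
    {μ : Measure X} {f : X → F} (hf : MemLp f 2 μ) :
    ∫⁻ x, ‖f x‖ₑ ^ 2 ∂μ = ENNReal.ofReal (∫ x, ‖f x‖ ^ 2 ∂μ) := by
  rw [ofReal_integral_eq_lintegral_ofReal (MemLp.integrable_norm_pow (p := 2) (by exact_mod_cast hf) two_ne_zero)
    (ae_of_all _ fun x => by positivity)]
  refine lintegral_congr fun x => ?_
  rw [ENNReal.ofReal_pow (norm_nonneg _), ofReal_norm]

theorem energy_eq_ofReal {N : ℕ} {U : Set (E N)} (hU : Bornology.IsBounded U) {ψ : E N → ℝ}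
    (hψ : ContDiff ℝ ∞ ψ) : energy U ψ =
      ENNReal.ofReal ((∫ x in U, ψ x ^ 2) + ∫ x in U, ‖gradient ψ x‖ ^ 2) := by
  rw [energy, lintegral_enorm_sq_eq (memLp_restrict_of_continuous hU hψ.continuous 2),
    lintegral_enorm_sq_eq (memLp_restrict_of_continuous hU (continuous_gradient hψ) 2),
    ← ENNReal.ofReal_add (integral_nonneg fun _ => by positivity)
      (integral_nonneg fun _ => by positivity)]
  simp

/-! ### Averages over the annuli -/

section Average

variable {N : ℕ} {Ω : Set (E N)} {r : ℝ → ℝ} {S : ℝ}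

theorem centreAnnuli_subset_gridAnnuli {ε : ℝ} (hε : 0 < ε) :
    centreAnnuli Ω ε ⊆ gridAnnuli N ε :=
  iUnion_subset fun a => subset_iUnion (fun b : grid N ε => annulus (b : E N) ε)
    ⟨a, ((mem_centres_iff hε).1 a.2).2.1⟩

/-- A lattice annulus that meets `K` has its centre within `ε` of `K`. When `2 * ε` is below the
width of a neighbourhood of `K` in `Ω`, that centre is at distance at least `ε` from the boundary
and is one of the centres. -/
theorem eventually_gridAnnuli_inter_subset (hN : 1 ≤ N) (hΩ : IsSmoothBoundedDomain Ω)
    {K : Set (E N)} (hK : IsCompact K) (hKΩ : K ⊆ Ω) :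
    ∀ᶠ ε in 𝓝[>] (0 : ℝ), gridAnnuli N ε ∩ K ⊆ centreAnnuli Ω ε := by
  obtain ⟨δ, hδ, h⟩ := hK.exists_cthickening_subset_open hΩ.isOpen hKΩ
  have h1 : ∀ᶠ ε in 𝓝[>] (0 : ℝ), ε < δ / 2 := nhdsWithin_le_nhds (Iio_mem_nhds (by positivity))
  filter_upwards [h1, self_mem_nhdsWithin] with ε h2 hε
  rintro x ⟨hx, hxK⟩
  obtain ⟨a, ha⟩ := mem_iUnion.1 hx
  have h3 : dist x a < ε := ha.1
  have h4 : ∀ y, dist x y ≤ δ → y ∈ Ω := fun y hy =>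
    h (Metric.mem_cthickening_of_dist_le y x _ _ hxK (by rwa [dist_comm]))
  refine mem_iUnion.2 ⟨⟨a, (mem_centres_iff hε).2 ⟨h4 a (by linarith [mem_Ioi.1 hε]), a.2, ?_⟩⟩, ha⟩
  rw [Metric.le_infDist (frontier_nonempty_of_isBounded hN hΩ)]
  intro y hy
  by_contra! h5
  refine (hΩ.isOpen.frontier_eq ▸ hy).2 (h4 y ?_)
  linarith [dist_triangle x a y]

theorem abs_gridAnnuli_sub_le (hN : 1 ≤ N) {ρ ε : ℝ} (hε : 0 < ε) (hρ : 0 ≤ ρ) {P : E N → ℝ}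
    (hP : ContDiff ℝ ∞ P) (hc : HasCompactSupport P) (h0 : ∀ x, 0 ≤ P x) :
    |annulusDensity N ρ ε * (∫ x in gridAnnuli N ε, P x) - cellDensity N ρ ε * ∫ x, P x| ≤
      annulusDensity N ρ ε * (2 * ε * N) * ∫ x, ‖gradient P x‖ := by
  have hi : Integrable P := hP.continuous.integrable_of_hasCompactSupport hc
  have hcg : HasCompactSupport (gradient P) :=
    (hc.fderiv ℝ).comp_left (g := (InnerProductSpace.toDual ℝ (E N)).symm) (map_zero _)
  have hg : Integrable (gradient P) :=
    (continuous_gradient hP).integrable_of_hasCompactSupport hcg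
  have e1 : (∫⁻ x, ‖P x‖ₑ).toReal = ∫ x, P x := by
    rw [← integral_norm_eq_lintegral_enorm hi.1]
    exact integral_congr_ae (ae_of_all _ fun x => Real.norm_of_nonneg (h0 x))
  have e2 : (∫⁻ x in gridAnnuli N ε, ‖P x‖ₑ).toReal = ∫ x in gridAnnuli N ε, P x := by
    rw [← integral_norm_eq_lintegral_enorm hi.1.restrict]
    exact integral_congr_ae (ae_of_all _ fun x => Real.norm_of_nonneg (h0 x))
  have e3 : (∫⁻ x, ‖gradient P x‖ₑ).toReal = ∫ x, ‖gradient P x‖ :=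
    (integral_norm_eq_lintegral_enorm hg.1).symm
  have n1 : ∫⁻ x, ‖P x‖ₑ ≠ ⊤ := hi.2.ne
  have n2 : ∫⁻ x in gridAnnuli N ε, ‖P x‖ₑ ≠ ⊤ := hi.restrict.2.ne
  have n3 : ∫⁻ x, ‖gradient P x‖ₑ ≠ ⊤ := hg.2.ne
  have nV := volume_gridCell_ne_top (N := N) ε
  have nA : volume (annulus (0 : E N) ε) ≠ ⊤ :=
    (Metric.isBounded_ball.subset sdiff_subset).measure_lt_top.ne
  have f1 := ENNReal.toReal_mono (by finiteness) (lintegral_gridAnnuli_le hε hP)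
  have f2 := ENNReal.toReal_mono (by finiteness) (lintegral_le_gridAnnuli hε hP)
  rw [ENNReal.toReal_add (by finiteness) (by finiteness)] at f1 f2
  simp only [ENNReal.toReal_mul, e1, e2, e3, ← measureReal_def,
    ENNReal.toReal_ofReal (show 0 ≤ 2 * ε * N by positivity)] at f1 f2
  have hA := annulusDensity_mul_volume_annulus hN hε hρ
  have hc0 := annulusDensity_nonneg hN hε hρ
  have hV := volume_real_gridCell_pos (N := N) ε
  set c := annulusDensity N ρ ε
  set k := cellDensity N ρ ε
  set V := volume.real (gridCell N ε)
  set A := volume.real (annulus (0 : E N) ε)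
  set I := ∫ x in gridAnnuli N ε, P x
  set J := ∫ x, P x
  set G := ∫ x, ‖gradient P x‖
  have g1 := mul_le_mul_of_nonneg_left f1 hc0
  have g2 := mul_le_mul_of_nonneg_left f2 hc0
  -- Both inequalities are proved after multiplication by the cell volume `V`. The identity `hA` of
  -- masses turns `c * A` into `k * V`.
  rw [abs_le]
  constructor
  · refine le_of_mul_le_mul_left ?_ hV
    linear_combination g2 - J * hA
  · refine le_of_mul_le_mul_left ?_ hV
    linear_combination g1 + J * hA

/-- The gradient is `2 χ ψ ∇ψ + ψ² ∇χ`. Since `0 ≤ χ ≤ 1`, Young's inequality bounds the first term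
by `ψ² + |∇ψ|²`, so the `L¹` norm of the gradient is controlled by the square of the `H¹` norm. -/
theorem integral_norm_gradient_cutoff_le (hU : Bornology.IsBounded Ω)
    {χ ψ : E N → ℝ} (hχ : ContDiff ℝ ∞ χ) (hs : tsupport χ ⊆ Ω) (h01 : ∀ x, χ x ∈ Icc 0 1)
    {B : ℝ} (hB : ∀ x, ‖gradient χ x‖ ≤ B) (hψ : ContDiff ℝ ∞ ψ) :
    ∫ x, ‖gradient (fun y => χ y * ψ y ^ 2) x‖ ≤
      (B + 1) * ((∫ x in Ω, ψ x ^ 2) + ∫ x in Ω, ‖gradient ψ x‖ ^ 2) := by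
  have hψ2 : ContDiff ℝ ∞ fun y => ψ y ^ 2 := hψ.pow 2
  have e0 : ∀ x, gradient (fun y => χ y * ψ y ^ 2) x =
      (2 * χ x * ψ x) • gradient ψ x + (ψ x ^ 2) • gradient χ x := by
    intro x
    have h1 := gradient_mul' hχ hψ2 x
    have h2 : gradient (fun y => ψ y ^ 2) x = (2 * ψ x) • gradient ψ x := by
      simp_rw [pow_two]
      rw [gradient_mul' hψ hψ x, ← add_smul, two_mul]
    rw [h1, h2, smul_smul]
    ring_nf
  have hz : ∀ x, x ∉ Ω → ‖gradient (fun y => χ y * ψ y ^ 2) x‖ = 0 := by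
    intro x hx
    have h1 : χ x = 0 := image_eq_zero_of_notMem_tsupport fun h => hx (hs h)
    have h2 : gradient χ x = 0 := by
      rw [gradient, image_eq_zero_of_notMem_tsupport (f := fderiv ℝ χ)
        fun h => hx (hs (tsupport_fderiv_subset ℝ h)), map_zero]
    rw [e0, h1, h2]
    simp
  rw [← setIntegral_eq_integral_of_forall_compl_eq_zero hz]
  have i1 : Integrable (fun x => ψ x ^ 2) (volume.restrict Ω) :=
    (memLp_one_iff_integrable).1 (memLp_restrict_of_continuous hU (hψ.continuous.pow 2) 1)
  have i2 : Integrable (fun x => ‖gradient ψ x‖ ^ 2) (volume.restrict Ω) :=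
    (memLp_one_iff_integrable).1
      (memLp_restrict_of_continuous hU ((continuous_gradient hψ).norm.pow 2) 1)
  have i3 : Integrable (fun x => ‖gradient (fun y => χ y * ψ y ^ 2) x‖) (volume.restrict Ω) :=
    (memLp_one_iff_integrable).1
      (memLp_restrict_of_continuous hU (continuous_gradient (hχ.mul hψ2)).norm 1)
  rw [← integral_add i1 i2, ← integral_const_mul]
  refine integral_mono i3 ((i1.add i2).const_mul _) fun x => ?_
  have hB0 : 0 ≤ B := (norm_nonneg _).trans (hB x)
  simp only [e0]
  refine (norm_add_le _ _).trans ?_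
  rw [norm_smul, norm_smul, norm_mul, norm_mul, norm_pow, Real.norm_ofNat,
    Real.norm_of_nonneg (h01 x).1, Real.norm_eq_abs, sq_abs]
  have h1 : χ x * |ψ x| * ‖gradient ψ x‖ ≤ |ψ x| * ‖gradient ψ x‖ := by
    rw [mul_assoc]
    exact mul_le_of_le_one_left (by positivity) (h01 x).2
  have h2 := mul_le_mul_of_nonneg_left (hB x) (sq_nonneg (ψ x))
  have h3 := two_mul_le_add_sq |ψ x| ‖gradient ψ x‖
  rw [sq_abs] at h3
  have h4 : 0 ≤ B * ‖gradient ψ x‖ ^ 2 := by positivity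
  linarith

/-- The squares of smooth functions have asymptotically the same average over the annuli as over
the domain, uniformly on bounded sets of `H¹`. -/
theorem eventually_abs_annuli_sub_le_smooth (hN : 1 ≤ N) (hΩ : IsSmoothBoundedDomain Ω)
    (hr : ∀ ε > 0, 0 < r ε ∧ r ε < ε)
    (hrS : Tendsto (fun ε => ((centres Ω ε).ncard : ℝ) * r ε ^ (N - 1)) (𝓝[>] 0) (𝓝 S))
    {η : ℝ} (hη : 0 < η) :
    ∀ᶠ ε in 𝓝[>] (0 : ℝ), ∀ ψ : E N → ℝ, ContDiff ℝ ∞ ψ →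
      |annulusDensity N (r ε) ε * (∫ x in centreAnnuli Ω ε, ψ x ^ 2) -
        cellDensity N (r ε) ε * ∫ x in Ω, ψ x ^ 2| ≤
      η * ((∫ x in Ω, ψ x ^ 2) + ∫ x in Ω, ‖gradient ψ x‖ ^ 2) := by
  obtain ⟨C, hC0, hC⟩ := exists_annulusDensity_le hN hΩ hr hrS
  obtain ⟨k, hk0, hk⟩ : ∃ k : ℝ, 0 ≤ k ∧ ∀ᶠ ε in 𝓝[>] (0 : ℝ), cellDensity N (r ε) ε ≤ k :=
    ⟨|sphereArea N * S / volume.real Ω| + 1, by positivity,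
      ((tendsto_cellDensity hN hΩ hrS).eventually_lt_const
        (lt_of_le_of_lt (le_abs_self _) (lt_add_one _))).mono fun _ h => h.le⟩
  -- Half of `η` is kept for the translation error. The cut-off error occurs once with the annulus
  -- weight, at most `C`, and once with the cell weight, at most `k`, so `(C + k) * η' ≤ η / 2` is
  -- what is required.
  set η' := η / (2 * (C + k + 1)) with hη'
  have hη'0 : 0 < η' := by positivity
  obtain ⟨K, hK, hKΩ, hlayer⟩ := exists_compact_layer_le hΩ (ENNReal.ofReal_pos.2 hη'0)
  obtain ⟨χ, hχ, hχc, hχs, hχ1, h01⟩ := exists_cutoff hK hΩ.isOpen hKΩ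
  have hgc : HasCompactSupport (gradient χ) :=
    (hχc.fderiv ℝ).comp_left (g := (InnerProductSpace.toDual ℝ (E N)).symm) (map_zero _)
  obtain ⟨B, hB⟩ := hgc.exists_bound_of_continuous (continuous_gradient hχ)
  have hB0 : 0 ≤ B := (norm_nonneg _).trans (hB 0)
  have hsmall : ∀ᶠ ε in 𝓝[>] (0 : ℝ), C * (2 * ε * N) * (B + 1) < η / 2 := by
    have : Continuous fun ε : ℝ => C * (2 * ε * N) * (B + 1) := by fun_prop
    have := (this.tendsto 0).mono_left (nhdsWithin_le_nhds (s := Ioi 0))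
    simp only [mul_zero, zero_mul] at this
    exact this.eventually_lt_const (by positivity)
  filter_upwards [hC, hk, hsmall, eventually_gridAnnuli_inter_subset hN hΩ hχc hχs,
    self_mem_nhdsWithin] with ε h1 h2 h3 h4 hε ψ hψ
  have hε : 0 < ε := hε
  have hρ := (hr ε hε).1.le
  set P : E N → ℝ := fun y => χ y * ψ y ^ 2 with hP
  have hPs : ContDiff ℝ ∞ P := hχ.mul (hψ.pow 2)
  have hPc : HasCompactSupport P := hχc.mul_right
  have hP0 : ∀ x, 0 ≤ P x := fun x => mul_nonneg (h01 x).1 (sq_nonneg _)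
  have hPz : ∀ x, x ∉ tsupport χ → P x = 0 := fun x hx => by
    simp only [hP, image_eq_zero_of_notMem_tsupport hx, zero_mul]
  have hA := measurableSet_centreAnnuli hΩ.isBounded hε
  have m1 := abs_gridAnnuli_sub_le hN hε hρ hPs hPc hP0
  have m2 := integral_norm_gradient_cutoff_le hΩ.isBounded hχ hχs h01 hB hψ
  -- On the support of `χ` the annuli of the full lattice and those of the centres are the same.
  have e1 : ∫ x in gridAnnuli N ε, P x = ∫ x in centreAnnuli Ω ε, P x := by
    rw [← integral_indicator measurableSet_gridAnnuli, ← integral_indicator hA]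
    congr 1
    ext x
    by_cases hx : x ∈ tsupport χ
    · have : x ∈ gridAnnuli N ε ↔ x ∈ centreAnnuli Ω ε :=
        ⟨fun h => h4 ⟨h, hx⟩, fun h => centreAnnuli_subset_gridAnnuli hε h⟩
      by_cases hxA : x ∈ centreAnnuli Ω ε
      · rw [indicator_of_mem hxA, indicator_of_mem (this.2 hxA)]
      · rw [indicator_of_notMem hxA, indicator_of_notMem fun h => hxA (this.1 h)]
    · rw [indicator_apply_eq_zero.2 fun _ => hPz x hx, indicator_apply_eq_zero.2 fun _ => hPz x hx]
  have e2 : ∫ x, P x = ∫ x in Ω, P x :=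
    (setIntegral_eq_integral_of_forall_compl_eq_zero fun x hx => hPz x fun h => hx (hχs h)).symm
  have i1 : IntegrableOn (fun x => ψ x ^ 2) Ω :=
    (memLp_one_iff_integrable).1
      (memLp_restrict_of_continuous hΩ.isBounded (hψ.continuous.pow 2) 1)
  have i2 : IntegrableOn P Ω :=
    (memLp_one_iff_integrable).1 (memLp_restrict_of_continuous hΩ.isBounded hPs.continuous 1)
  set En := (∫ x in Ω, ψ x ^ 2) + ∫ x in Ω, ‖gradient ψ x‖ ^ 2 with hEn
  have hEn0 : 0 ≤ En := add_nonneg (integral_nonneg fun x => sq_nonneg _)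
    (integral_nonneg fun x => sq_nonneg _)
  have hlay : ∫ x in Ω \ K, ψ x ^ 2 ≤ η' * En := by
    have h5 := hlayer ψ hψ
    rw [energy_eq_ofReal hΩ.isBounded hψ, ← ENNReal.ofReal_mul hη'0.le, lintegral_enorm_sq_eq
      (memLp_restrict_of_continuous (hΩ.isBounded.subset sdiff_subset) hψ.continuous 2),
      ENNReal.ofReal_le_ofReal_iff (mul_nonneg hη'0.le hEn0)] at h5
    simpa using h5
  -- Replacing `ψ²` by `χ ψ²` changes nothing on `K`, where `χ = 1`, and elsewhere costs at most the
  -- integral of `ψ²` over the boundary layer.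
  have hdiff : ∀ T : Set (E N), T ⊆ Ω → MeasurableSet T →
      0 ≤ (∫ x in T, ψ x ^ 2) - ∫ x in T, P x ∧
        (∫ x in T, ψ x ^ 2) - ∫ x in T, P x ≤ η' * En := by
    intro T hT hTm
    rw [← integral_sub (i1.mono_set hT) (i2.mono_set hT)]
    have hd0 : ∀ x, 0 ≤ ψ x ^ 2 - P x := fun x => by
      have := mul_le_of_le_one_left (sq_nonneg (ψ x)) (h01 x).2
      simp only [hP]; linarith
    refine ⟨integral_nonneg hd0, le_trans ?_ hlay⟩
    refine (setIntegral_mono_set (i1.sub i2) (ae_of_all _ hd0) hT.eventuallyLE).trans ?_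
    rw [← integral_indicator hΩ.isOpen.measurableSet,
      ← integral_indicator (hΩ.isOpen.measurableSet.diff hK.measurableSet)]
    refine integral_mono ((integrable_indicator_iff hΩ.isOpen.measurableSet).2 (i1.sub i2))
      ((integrable_indicator_iff (hΩ.isOpen.measurableSet.diff hK.measurableSet)).2
        (i1.mono_set sdiff_subset)) fun x => ?_
    by_cases hxΩ : x ∈ Ω
    · by_cases hxK : x ∈ K
      · have : χ x = 1 := (Filter.Eventually.self_of_nhdsSet hχ1) x hxK
        rw [indicator_of_mem hxΩ, indicator_of_notMem fun h : x ∈ Ω \ K => h.2 hxK]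
        simp [hP, this]
      · rw [indicator_of_mem hxΩ, indicator_of_mem (show x ∈ Ω \ K from ⟨hxΩ, hxK⟩)]
        exact sub_le_self _ (hP0 x)
    · rw [indicator_of_notMem hxΩ, indicator_of_notMem fun h : x ∈ Ω \ K => hxΩ h.1]
  obtain ⟨a1, a2⟩ := hdiff _ centreAnnuli_subset hA
  obtain ⟨b1, b2⟩ := hdiff Ω subset_rfl hΩ.isOpen.measurableSet
  rw [e1, e2] at m1
  have hc0 := annulusDensity_nonneg hN hε hρ
  have hk0' := cellDensity_nonneg (N := N) (ε := ε) hρ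
  set c := annulusDensity N (r ε) ε
  set κ := cellDensity N (r ε) ε
  have hNε : 0 ≤ 2 * ε * N := by positivity
  have m3 : c * (2 * ε * N) * (∫ x, ‖gradient P x‖) ≤ η / 2 * En := by
    calc _ ≤ C * (2 * ε * N) * ((B + 1) * En) := by gcongr
      _ = C * (2 * ε * N) * (B + 1) * En := by ring
      _ ≤ _ := mul_le_mul_of_nonneg_right h3.le hEn0
  have m4 : c * (η' * En) + κ * (η' * En) ≤ η / 2 * En := by
    have : (C + k) * η' ≤ η / 2 := by
      rw [hη', mul_div_assoc', div_le_div_iff₀ (by positivity) (by positivity)]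
      nlinarith
    calc c * (η' * En) + κ * (η' * En) ≤ C * (η' * En) + k * (η' * En) := by gcongr
      _ = (C + k) * η' * En := by ring
      _ ≤ _ := mul_le_mul_of_nonneg_right this hEn0
  have a3 := mul_le_mul_of_nonneg_left a2 hc0
  have b3 := mul_le_mul_of_nonneg_left b2 hk0'
  have a4 := mul_nonneg hc0 a1
  have b4 := mul_nonneg hk0' b1
  have hh := mul_nonneg hη'0.le hEn0
  have hh1 := mul_nonneg hc0 hh
  have hh2 := mul_nonneg hk0' hh
  rw [abs_le] at m1 ⊢
  constructor <;> nlinarith [m1.1, m1.2]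

end Average

/-! ### Averages for functions with a trace, and polarization. -/

section Average

variable {N : ℕ} {Ω : Set (E N)} {r : ℝ → ℝ} {S : ℝ}

theorem tendsto_setIntegral_mul {U A : Set (E N)} (hA : A ⊆ U) {ι : Type*} {l : Filter ι}
    {V : ι → H1 U} {v : H1 U} (hV : Tendsto V l (𝓝 v)) {φ ψ : ι → E N → ℝ} {w : E N → ℝ}
    (hφ : ∀ n, toFn (V n) =ᵐ[volume.restrict U] φ n)
    (hψm : ∀ n, MemLp (ψ n) 2 (volume.restrict A)) (hwm : MemLp w 2 (volume.restrict A))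
    (hψ : Tendsto (fun n => eLpNorm (ψ n - w) 2 (volume.restrict A)) l (𝓝 0)) :
    Tendsto (fun n => ∫ x in A, φ n x * ψ n x) l (𝓝 (∫ x in A, toFn v x * w x)) := by
  have hle : volume.restrict A ≤ volume.restrict U := Measure.restrict_mono hA le_rfl
  have hφA : ∀ n, toFn (V n) =ᵐ[volume.restrict A] φ n := fun n =>
    (hφ n).filter_mono (ae_mono hle)
  have h1 := (H1.tendsto_iff.1 hV).1
  rw [Lp.tendsto_Lp_iff_tendsto_eLpNorm'] at h1
  refine tendsto_integral_mul
    (fun n => ((Lp.memLp (toFn (V n))).mono_measure hle).ae_eq (hφA n)) hψm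
    ((Lp.memLp (toFn v)).mono_measure hle) hwm ?_ hψ
  refine tendsto_of_tendsto_of_tendsto_of_le_of_le tendsto_const_nhds h1 (fun _ => zero_le)
    fun n => ?_
  refine (eLpNorm_congr_ae ((hφA n).symm.sub (ae_eq_refl _))).le.trans ?_
  exact eLpNorm_mono_measure _ hle

theorem tendsto_setIntegral_sq {U A : Set (E N)} (hA : A ⊆ U) {ι : Type*} {l : Filter ι}
    {V : ι → H1 U} {v : H1 U} (hV : Tendsto V l (𝓝 v)) {φ : ι → E N → ℝ}
    (hφ : ∀ n, toFn (V n) =ᵐ[volume.restrict U] φ n) :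
    Tendsto (fun n => ∫ x in A, φ n x ^ 2) l (𝓝 (∫ x in A, toFn v x ^ 2)) := by
  have hle : volume.restrict A ≤ volume.restrict U := Measure.restrict_mono hA le_rfl
  have hφA : ∀ n, toFn (V n) =ᵐ[volume.restrict A] φ n := fun n =>
    (hφ n).filter_mono (ae_mono hle)
  have h1 := (H1.tendsto_iff.1 hV).1
  rw [Lp.tendsto_Lp_iff_tendsto_eLpNorm'] at h1
  simp only [pow_two]
  refine tendsto_setIntegral_mul hA hV hφ
    (fun n => ((Lp.memLp (toFn (V n))).mono_measure hle).ae_eq (hφA n))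
    ((Lp.memLp (toFn v)).mono_measure hle) ?_
  refine tendsto_of_tendsto_of_tendsto_of_le_of_le tendsto_const_nhds h1 (fun _ => zero_le)
    fun n => ?_
  refine (eLpNorm_congr_ae ((hφA n).symm.sub (ae_eq_refl _))).le.trans ?_
  exact eLpNorm_mono_measure _ hle

theorem norm_sq_eq_of_smooth {U : Set (E N)} {V : H1 U} {φ : E N → ℝ}
    (h1 : toFn V =ᵐ[volume.restrict U] φ) (h2 : weakGrad V =ᵐ[volume.restrict U] gradient φ) :
    ‖V‖ ^ 2 = (∫ x in U, φ x ^ 2) + ∫ x in U, ‖gradient φ x‖ ^ 2 := by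
  rw [H1.norm_sq, ← integral_sq_eq_norm_sq, ← integral_sq_eq_norm_sq]
  congr 1
  · exact integral_congr_ae (by filter_upwards [h1] with x hx; rw [hx, Real.norm_eq_abs, sq_abs])
  · exact integral_congr_ae (by filter_upwards [h2] with x hx; rw [hx])

/-- The admissible range of `ε` is the same for all smooth functions, so for fixed `ε` the
approximants provided by the trace may be taken to their limit. -/
theorem eventually_abs_annuli_sub_le (hN : 1 ≤ N) (hΩ : IsSmoothBoundedDomain Ω)
    (hr : ∀ ε > 0, 0 < r ε ∧ r ε < ε)
    (hrS : Tendsto (fun ε => ((centres Ω ε).ncard : ℝ) * r ε ^ (N - 1)) (𝓝[>] 0) (𝓝 S))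
    {η : ℝ} (hη : 0 < η) :
    ∀ᶠ ε in 𝓝[>] (0 : ℝ), ∀ (v : H1 Ω) (t : Lp ℝ 2 (outerSurface Ω)),
      HasTrace (outerSurface Ω) v t →
      |annulusDensity N (r ε) ε * (∫ x in centreAnnuli Ω ε, toFn v x ^ 2) -
        cellDensity N (r ε) ε * ∫ x in Ω, toFn v x ^ 2| ≤ η * ‖v‖ ^ 2 := by
  filter_upwards [eventually_abs_annuli_sub_le_smooth hN hΩ hr hrS hη] with ε h v t ht
  obtain ⟨φ, V, h1, h2, h3, h4, -⟩ := ht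
  have h5 : ∀ n, |annulusDensity N (r ε) ε * (∫ x in centreAnnuli Ω ε, φ n x ^ 2) -
        cellDensity N (r ε) ε * ∫ x in Ω, φ n x ^ 2| ≤ η * ‖V n‖ ^ 2 := fun n => by
    rw [norm_sq_eq_of_smooth (h2 n) (h3 n)]
    exact h (φ n) (h1 n)
  refine le_of_tendsto_of_tendsto' ?_ ((h4.norm.pow 2).const_mul η) h5
  exact (((tendsto_setIntegral_sq centreAnnuli_subset h4 h2).const_mul _).sub
    ((tendsto_setIntegral_sq subset_rfl h4 h2).const_mul _)).abs

theorem integrableOn_toFn_mul {U A : Set (E N)} (hA : A ⊆ U) (u v : H1 U) :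
    Integrable (fun x => toFn u x * toFn v x) (volume.restrict A) := by
  have hle : volume.restrict A ≤ volume.restrict U := Measure.restrict_mono hA le_rfl
  exact ((Lp.memLp (toFn u)).mono_measure hle).integrable_mul
    ((Lp.memLp (toFn v)).mono_measure hle)

theorem four_mul_setIntegral_mul {U A : Set (E N)} (hA : A ⊆ U) (u v : H1 U) :
    4 * ∫ x in A, toFn u x * toFn v x =
      (∫ x in A, toFn (u + v) x ^ 2) - ∫ x in A, toFn (u - v) x ^ 2 := by
  have hle : volume.restrict A ≤ volume.restrict U := Measure.restrict_mono hA le_rfl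
  have i : ∀ w : H1 U, Integrable (fun x => toFn w x ^ 2) (volume.restrict A) := fun w => by
    simp only [pow_two]
    exact integrableOn_toFn_mul hA w w
  rw [← integral_const_mul, ← integral_sub (i _) (i _)]
  refine integral_congr_ae ?_
  filter_upwards [(Lp.coeFn_add (toFn u) (toFn v)).filter_mono (ae_mono hle),
    (Lp.coeFn_sub (toFn u) (toFn v)).filter_mono (ae_mono hle)] with x h1 h2
  rw [toFn_add, toFn_sub, h1, h2, Pi.add_apply, Pi.sub_apply]
  ring

/-- Here `p` and `q` stand for the norms of the sum and the difference. Each squared norm is at most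
`2 * (a ^ 2 + b ^ 2)`, and the factor `4` from polarization absorbs both. -/
theorem abs_polarization_le {c κ I₁ I₂ I₃ I₄ I₅ I₆ η a b p q : ℝ} (hη : 0 ≤ η) (hp0 : 0 ≤ p)
    (hq0 : 0 ≤ q) (h1 : |c * I₃ - κ * I₅| ≤ η * p ^ 2) (h2 : |c * I₄ - κ * I₆| ≤ η * q ^ 2)
    (h3 : 4 * I₁ = I₃ - I₄) (h4 : 4 * I₂ = I₅ - I₆) (hp : p ≤ a + b) (hq : q ≤ a + b) :
    |c * I₁ - κ * I₂| ≤ η * (a ^ 2 + b ^ 2) := by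
  have h5 : p ^ 2 ≤ 2 * (a ^ 2 + b ^ 2) := by nlinarith [sq_nonneg (a - b)]
  have h6 : q ^ 2 ≤ 2 * (a ^ 2 + b ^ 2) := by nlinarith [sq_nonneg (a - b)]
  have h5' := mul_le_mul_of_nonneg_left h5 hη
  have h6' := mul_le_mul_of_nonneg_left h6 hη
  have e1 : c * I₃ - c * I₄ = 4 * (c * I₁) := by rw [← mul_sub, ← h3]; ring
  have e2 : κ * I₅ - κ * I₆ = 4 * (κ * I₂) := by rw [← mul_sub, ← h4]; ring
  rw [abs_le] at *
  constructor <;> linarith [h1.1, h1.2, h2.1, h2.2]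

theorem eventually_abs_annuli_mul_sub_le (hN : 1 ≤ N) (hΩ : IsSmoothBoundedDomain Ω)
    (hr : ∀ ε > 0, 0 < r ε ∧ r ε < ε)
    (hrS : Tendsto (fun ε => ((centres Ω ε).ncard : ℝ) * r ε ^ (N - 1)) (𝓝[>] 0) (𝓝 S))
    {η : ℝ} (hη : 0 < η) :
    ∀ᶠ ε in 𝓝[>] (0 : ℝ), ∀ (u v : H1 Ω) (t s : Lp ℝ 2 (outerSurface Ω)),
      HasTrace (outerSurface Ω) u t → HasTrace (outerSurface Ω) v s →
      |annulusDensity N (r ε) ε * (∫ x in centreAnnuli Ω ε, toFn u x * toFn v x) -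
        cellDensity N (r ε) ε * ∫ x in Ω, toFn u x * toFn v x| ≤ η * (‖u‖ ^ 2 + ‖v‖ ^ 2) := by
  have hν : ∀ φ : E N → ℝ, ContDiff ℝ ∞ φ → MemLp φ 2 (outerSurface Ω) := fun φ hφ =>
    memLp_outerSurface hΩ hφ.continuous
  filter_upwards [eventually_abs_annuli_sub_le hN hΩ hr hrS hη] with ε h u v t s hu hv
  exact abs_polarization_le hη.le (norm_nonneg (u + v)) (norm_nonneg (u - v))
    (h _ _ (hu.add hν hv)) (h _ _ (hu.sub hν hv))
    (four_mul_setIntegral_mul centreAnnuli_subset u v) (four_mul_setIntegral_mul subset_rfl u v)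
    (norm_add_le u v) (norm_sub_le u v)

end Average

/-! ### Traces on the inclusions -/

section InnerTrace

variable {N : ℕ} {Ω : Set (E N)} {ρ ε : ℝ}

theorem innerSurface_le : innerSurface Ω ρ ε ≤ perforatedSurface Ω ρ ε :=
  Measure.le_add_left le_rfl

theorem outerSurface_le : outerSurface Ω ≤ perforatedSurface Ω ρ ε :=
  Measure.le_add_right le_rfl

theorem memLp_innerSurface (hΩ : Bornology.IsBounded Ω) (hε : 0 < ε) (hρ : 0 < ρ) {F : Type*}
    [NormedAddCommGroup F] {φ : E N → F} (hφ : Continuous φ) :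
    MemLp φ 2 (innerSurface Ω ρ ε) := by
  have := isFiniteMeasure_innerSurface (ρ := ρ) hΩ hε
  exact memLp_of_continuous (isCompact_inclusions hΩ hε ρ)
    (innerSurface_compl_inclusions hΩ hε hρ) hφ 2

theorem memLp_perforatedSurface (hΩ : IsSmoothBoundedDomain Ω) (hε : 0 < ε) (hρ : 0 < ρ)
    {φ : E N → ℝ} (hφ : Continuous φ) : MemLp φ 2 (perforatedSurface Ω ρ ε) := by
  rw [memLp_two_iff_integrable_sq_norm hφ.aestronglyMeasurable, perforatedSurface]
  refine Integrable.add_measure ?_ ?_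
  · exact (memLp_two_iff_integrable_sq_norm hφ.aestronglyMeasurable).1 (memLp_outerSurface hΩ hφ)
  · exact (memLp_two_iff_integrable_sq_norm hφ.aestronglyMeasurable).1
      (memLp_innerSurface hΩ.isBounded hε hρ hφ)

theorem isBounded_perforated (hΩ : Bornology.IsBounded Ω) :
    Bornology.IsBounded (perforated Ω ρ ε) := hΩ.subset sdiff_subset

theorem isOpen_perforated (hΩ : IsSmoothBoundedDomain Ω) (hε : 0 < ε) :
    IsOpen (perforated Ω ρ ε) :=
  hΩ.isOpen.sdiff (isCompact_inclusions hΩ.isBounded hε ρ).isClosed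

theorem tendsto_integral_innerSurface_mul {t : Lp ℝ 2 (perforatedSurface Ω ρ ε)}
    {φ : ℕ → E N → ℝ} (hφm : ∀ n, MemLp (φ n) 2 (innerSurface Ω ρ ε))
    (hφ : Tendsto (fun n => eLpNorm (fun x => φ n x - t x) 2 (perforatedSurface Ω ρ ε)) atTop (𝓝 0))
    {ψ : ℕ → E N → ℝ} {w : E N → ℝ} (hψm : ∀ n, MemLp (ψ n) 2 (innerSurface Ω ρ ε))
    (hwm : MemLp w 2 (innerSurface Ω ρ ε))
    (hψ : Tendsto (fun n => eLpNorm (ψ n - w) 2 (innerSurface Ω ρ ε)) atTop (𝓝 0)) :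
    Tendsto (fun n => ∫ x, φ n x * ψ n x ∂(innerSurface Ω ρ ε)) atTop
      (𝓝 (∫ x, t x * w x ∂(innerSurface Ω ρ ε))) := by
  refine tendsto_integral_mul hφm hψm ((Lp.memLp t).mono_measure innerSurface_le) hwm ?_ hψ
  exact tendsto_of_tendsto_of_tendsto_of_le_of_le tendsto_const_nhds hφ (fun _ => zero_le)
    fun n => eLpNorm_mono_measure _ innerSurface_le

theorem norm_gradient_mul_sq_le {ζ ψ : E N → ℝ} (hζ : ContDiff ℝ ∞ ζ) (hψ : ContDiff ℝ ∞ ψ)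
    {M : ℝ} {x : E N} (h1 : |ζ x| ≤ M) (h2 : ‖gradient ζ x‖ ≤ M) :
    ‖gradient (fun y => ψ y * ζ y) x‖ ^ 2 ≤ 2 * M ^ 2 * (ψ x ^ 2 + ‖gradient ψ x‖ ^ 2) := by
  have hM : 0 ≤ M := (norm_nonneg _).trans h2
  have h3 : ‖gradient (fun y => ψ y * ζ y) x‖ ≤ M * (|ψ x| + ‖gradient ψ x‖) := by
    rw [gradient_mul' hψ hζ]
    refine (norm_add_le _ _).trans ?_
    rw [norm_smul, norm_smul, Real.norm_eq_abs, Real.norm_eq_abs]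
    have := mul_le_mul_of_nonneg_left h2 (abs_nonneg (ψ x))
    have := mul_le_mul_of_nonneg_right h1 (norm_nonneg (gradient ψ x))
    linarith
  refine (pow_le_pow_left₀ (norm_nonneg _) h3 2).trans ?_
  rw [mul_pow, ← sq_abs (ψ x)]
  nlinarith [sq_nonneg (|ψ x| - ‖gradient ψ x‖), sq_nonneg M,
    mul_nonneg (sq_nonneg M) (sq_nonneg (|ψ x| - ‖gradient ψ x‖))]

/-- Spheres against annuli for the product of a trace with a smooth function. -/
theorem HasTrace.abs_innerSurface_mul_sub_le (hN : 1 ≤ N) (hΩ : IsSmoothBoundedDomain Ω)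
    (hρ : 0 < ρ) (hρε : ρ < ε / 2) {v : H1 (perforated Ω ρ ε)}
    {t : Lp ℝ 2 (perforatedSurface Ω ρ ε)} (h : HasTrace (perforatedSurface Ω ρ ε) v t)
    {ζ : E N → ℝ} (hζ : ContDiff ℝ ∞ ζ) {M : ℝ} (h1 : ∀ x ∈ Ω, |ζ x| ≤ M)
    (h2 : ∀ x ∈ Ω, ‖gradient ζ x‖ ≤ M) :
    |∫ x, t x * ζ x ∂(innerSurface Ω ρ ε) -
        annulusDensity N ρ ε * ∫ x in centreAnnuli Ω ε, toFn v x * ζ x| ^ 2 ≤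
      ε * (innerSurface Ω ρ ε).real univ * (2 * M ^ 2 * ‖v‖ ^ 2) := by
  have hε : 0 < ε := by linarith
  have := isFiniteMeasure_innerSurface (ρ := ρ) hΩ.isBounded hε
  have hb := isBounded_perforated (ρ := ρ) (ε := ε) hΩ.isBounded
  have hA := centreAnnuli_subset_perforated (Ω := Ω) hε hρε
  obtain ⟨φ, V, k1, k2, k3, k4, k5⟩ := h
  have hn : ∀ n, |∫ x, φ n x * ζ x ∂(innerSurface Ω ρ ε) -
        annulusDensity N ρ ε * ∫ x in centreAnnuli Ω ε, φ n x * ζ x| ^ 2 ≤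
      ε * (innerSurface Ω ρ ε).real univ * (2 * M ^ 2 * ‖V n‖ ^ 2) := by
    intro n
    have hs : ContDiff ℝ ∞ fun x => φ n x * ζ x := (k1 n).mul hζ
    -- With a fixed smooth factor the gradient of the product is in `L²`, so the version of the
    -- comparison with the small factor `ε` applies.
    have h3 := enorm_sub_sq_le_lintegral_perforated hN hΩ.isBounded hρ hρε hs
    rw [lintegral_enorm_sq_eq (memLp_restrict_of_continuous hb (continuous_gradient hs) 2)] at h3
    have h4 := ENNReal.toReal_mono (by finiteness) h3
    rw [ENNReal.toReal_mul, ENNReal.toReal_mul, ENNReal.toReal_pow, toReal_enorm,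
      ENNReal.toReal_ofReal hε.le, ENNReal.toReal_ofReal (integral_nonneg fun _ => by positivity),
      Real.norm_eq_abs] at h4
    refine h4.trans (mul_le_mul_of_nonneg_left ?_ (mul_nonneg hε.le ENNReal.toReal_nonneg))
    have j1 : Integrable (fun x => φ n x ^ 2) (volume.restrict (perforated Ω ρ ε)) :=
      (memLp_one_iff_integrable).1 (memLp_restrict_of_continuous hb ((k1 n).continuous.pow 2) 1)
    have j2 : Integrable (fun x => ‖gradient (φ n) x‖ ^ 2) (volume.restrict (perforated Ω ρ ε)) :=
      (memLp_one_iff_integrable).1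
        (memLp_restrict_of_continuous hb ((continuous_gradient (k1 n)).norm.pow 2) 1)
    have j3 : Integrable (fun x => ‖gradient (fun y => φ n y * ζ y) x‖ ^ 2)
        (volume.restrict (perforated Ω ρ ε)) :=
      (memLp_one_iff_integrable).1
        (memLp_restrict_of_continuous hb ((continuous_gradient hs).norm.pow 2) 1)
    rw [norm_sq_eq_of_smooth (k2 n) (k3 n), ← integral_add j1 j2, ← integral_const_mul]
    refine integral_mono_ae j3 ((j1.add j2).const_mul _) ?_
    filter_upwards [ae_restrict_mem (isOpen_perforated hΩ hε).measurableSet] with x hx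
    exact norm_gradient_mul_sq_le hζ (k1 n) (h1 x hx.1) (h2 x hx.1)
  have hζi := memLp_innerSurface hΩ.isBounded hε hρ hζ.continuous
  have hζA := memLp_restrict_of_continuous
    (hΩ.isBounded.subset (centreAnnuli_subset (ε := ε))) hζ.continuous 2
  refine le_of_tendsto_of_tendsto' ?_ (((k4.norm.pow 2).const_mul (2 * M ^ 2)).const_mul _) hn
  refine (((tendsto_integral_innerSurface_mul (fun n => memLp_innerSurface hΩ.isBounded hε hρ
    (k1 n).continuous) k5 (fun _ => hζi) hζi (by simp)).sub
    ((tendsto_setIntegral_mul hA k4 k2 (fun _ => hζA) hζA (by simp)).const_mul _)).abs).pow 2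

/-- Spheres against annuli for the square of a trace. -/
theorem HasTrace.abs_innerSurface_sq_sub_le (hN : 1 ≤ N) (hΩ : IsSmoothBoundedDomain Ω)
    (hρ : 0 < ρ) (hρε : ρ < ε / 2) {v : H1 (perforated Ω ρ ε)}
    {t : Lp ℝ 2 (perforatedSurface Ω ρ ε)} (h : HasTrace (perforatedSurface Ω ρ ε) v t) :
    |∫ x, t x ^ 2 ∂(innerSurface Ω ρ ε) -
        annulusDensity N ρ ε * ∫ x in centreAnnuli Ω ε, toFn v x ^ 2| ≤
      2 * (‖toFn v‖ * ‖weakGrad v‖) := by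
  have hε : 0 < ε := by linarith
  have hb := isBounded_perforated (ρ := ρ) (ε := ε) hΩ.isBounded
  have hA := centreAnnuli_subset_perforated (Ω := Ω) hε hρε
  obtain ⟨φ, V, k1, k2, k3, k4, k5⟩ := h
  have hn : ∀ n, |∫ x, φ n x ^ 2 ∂(innerSurface Ω ρ ε) -
        annulusDensity N ρ ε * ∫ x in centreAnnuli Ω ε, φ n x ^ 2| ≤
      2 * (‖toFn (V n)‖ * ‖weakGrad (V n)‖) := by
    intro n
    have hs : ContDiff ℝ ∞ fun x => φ n x ^ 2 := (k1 n).pow 2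
    -- The gradient `2 φ ∇φ` of a square is controlled only in `L¹`. The resulting error is bounded
    -- but not small, which is enough for the a priori bound.
    have h3 := enorm_sub_le_lintegral_perforated hN hΩ.isBounded hρ hρε hs
    have h4 : ∫⁻ x in perforated Ω ρ ε, ‖gradient (fun y => φ n y ^ 2) x‖ₑ =
        2 * ∫⁻ x in perforated Ω ρ ε, ‖toFn (V n) x‖ₑ * ‖weakGrad (V n) x‖ₑ := by
      rw [← lintegral_const_mul' _ _ (by norm_num)]
      refine lintegral_congr_ae ?_
      filter_upwards [k2 n, k3 n] with x hx hx'
      have : gradient (fun y => φ n y ^ 2) x = (2 * φ n x) • gradient (φ n) x := by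
        simp_rw [pow_two]
        rw [gradient_mul' (k1 n) (k1 n) x, ← add_smul, two_mul]
      rw [hx, hx', this, enorm_smul, enorm_mul, mul_assoc]
      congr 1
      simp [← ofReal_norm]
    have h5 := ENNReal.lintegral_mul_le_Lp_mul_Lq (volume.restrict (perforated Ω ρ ε))
      Real.HolderConjugate.two_two (f := fun x => ‖toFn (V n) x‖ₑ)
      (g := fun x => ‖weakGrad (V n) x‖ₑ) (Lp.aestronglyMeasurable _).enorm
      (Lp.aestronglyMeasurable _).enorm
    have h6 : ∀ {F : Type} [NormedAddCommGroup F] (f : Lp F 2 (volume.restrict (perforated Ω ρ ε))),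
        (∫⁻ x in perforated Ω ρ ε, ‖f x‖ₑ ^ (2 : ℝ)) ^ (1 / 2 : ℝ) = ‖f‖ₑ := by
      intro F _ f
      have := enorm_sq_eq_lintegral f
      simp only [← ENNReal.rpow_natCast, Nat.cast_ofNat] at this
      rw [← this, ← ENNReal.rpow_mul]
      norm_num
    simp only [Pi.mul_apply] at h5
    rw [h6, h6] at h5
    rw [h4] at h3
    have h7 := ENNReal.toReal_mono (by finiteness) (h3.trans (mul_le_mul_right h5 2))
    simpa using h7
  refine le_of_tendsto_of_tendsto' ?_ ((((H1.tendsto_iff.1 k4).1.norm.mul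
    (H1.tendsto_iff.1 k4).2.norm)).const_mul 2) hn
  have hφi := fun n => memLp_innerSurface (ρ := ρ) hΩ.isBounded hε hρ (k1 n).continuous
  have ht : MemLp t 2 (innerSurface Ω ρ ε) := (Lp.memLp t).mono_measure innerSurface_le
  have key : Tendsto (fun n => ∫ x, φ n x ^ 2 ∂(innerSurface Ω ρ ε)) atTop
      (𝓝 (∫ x, t x ^ 2 ∂(innerSurface Ω ρ ε))) := by
    simp only [pow_two]
    refine tendsto_integral_innerSurface_mul hφi k5 hφi ht ?_
    exact tendsto_of_tendsto_of_tendsto_of_le_of_le tendsto_const_nhds k5 (fun _ => zero_le)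
      fun n => eLpNorm_mono_measure _ innerSurface_le
  exact (key.sub ((tendsto_setIntegral_sq hA k4 k2).const_mul _)).abs

end InnerTrace

/-! ### Data that are the same on every inclusion -/

section Data

variable {N : ℕ} {Ω : Set (E N)} {r : ℝ → ℝ} {S : ℝ}

theorem sphereSurface_le_innerSurface {ρ ε : ℝ} {a : E N} (ha : a ∈ centres Ω ε) :
    sphereSurface a ρ ≤ innerSurface Ω ρ ε :=
  Measure.le_sum (fun x : centres Ω ε => sphereSurface (x : E N) ρ) ⟨a, ha⟩

theorem ae_sphereSurface_mem {ρ : ℝ} (hρ : 0 ≤ ρ) (a : E N) :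
    ∀ᵐ x ∂(sphereSurface a ρ), x ∈ Metric.closedBall a ρ := by
  refine Measure.ae_smul_measure ?_ _
  refine (ae_map_iff (by fun_prop) Metric.isClosed_closedBall.measurableSet).2 ?_
  exact ae_of_all _ fun m => by simp [norm_smul, abs_of_nonneg hρ]

/-- Freezing `ζ` at the centre of each inclusion costs its oscillation over a small ball times the
`L¹` norm of the data. -/
theorem abs_innerSurface_sub_sum_le (hΩ : Bornology.IsBounded Ω) {ρ ε : ℝ} (hε : 0 < ε)
    (hρ : 0 < ρ) {ζ G : E N → ℝ} (hζ : Continuous ζ) (hG : Integrable G (innerSurface Ω ρ ε))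
    {δ : ℝ} (hδ : ∀ a ∈ centres Ω ε, ∀ x ∈ Metric.closedBall a ρ, |ζ x - ζ a| ≤ δ) :
    |∫ x, ζ x * G x ∂(innerSurface Ω ρ ε) -
      ∑ᶠ a ∈ centres Ω ε, ζ a * ∫ x, G x ∂(sphereSurface a ρ)| ≤
      δ * ∫ x, |G x| ∂(innerSurface Ω ρ ε) := by
  have hfin := centres_finite hΩ hε
  have := hfin.fintype
  obtain ⟨B, hB⟩ := (isCompact_inclusions hΩ hε ρ).exists_bound_of_continuousOn hζ.continuousOn
  have hζG : Integrable (fun x => ζ x * G x) (innerSurface Ω ρ ε) := by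
    refine hG.bdd_mul (c := B) hζ.aestronglyMeasurable ?_
    have h0 : ∀ᵐ x ∂(innerSurface Ω ρ ε), x ∈ inclusions Ω ρ ε :=
      innerSurface_compl_inclusions hΩ hε hρ
    filter_upwards [h0] with x hx using hB x hx
  have hGa : ∀ a : centres Ω ε, Integrable G (sphereSurface (a : E N) ρ) := fun a =>
    hG.mono_measure (sphereSurface_le_innerSurface a.2)
  have hζGa : ∀ a : centres Ω ε, Integrable (fun x => ζ x * G x) (sphereSurface (a : E N) ρ) :=
    fun a => hζG.mono_measure (sphereSurface_le_innerSurface a.2)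
  rw [innerSurface] at hG hζG ⊢
  rw [integral_sum_measure hζG, integral_sum_measure hG.abs, tsum_fintype, tsum_fintype,
    ← finsum_set_coe_eq_finsum_mem, finsum_eq_sum_of_fintype, ← Finset.sum_sub_distrib,
    Finset.mul_sum]
  refine (Finset.abs_sum_le_sum_abs _ _).trans (Finset.sum_le_sum fun a _ => ?_)
  rw [← integral_const_mul, ← integral_sub (hζGa a) ((hGa a).const_mul _), ← integral_const_mul]
  refine abs_integral_le_integral_abs.trans (integral_mono_ae ?_ ((hGa a).abs.const_mul _) ?_)
  · exact ((hζGa a).sub ((hGa a).const_mul _)).abs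
  · filter_upwards [ae_sphereSurface_mem hρ.le (a : E N)] with x hx
    rw [← sub_mul, abs_mul]
    exact mul_le_mul_of_nonneg_right (hδ a a.2 x hx) (abs_nonneg _)

theorem integral_sphereSurface {ρ : ℝ} (hρ : 0 < ρ) (a : E N) (G : E N → ℝ) :
    ∫ x, G x ∂(sphereSurface a ρ) =
      ρ ^ (N - 1) * ∫ m : Metric.sphere (0 : E N) 1, G (a + ρ • (m : E N)) ∂(sphereMeasure N) := by
  have he : MeasurableEmbedding fun m : Metric.sphere (0 : E N) 1 => a + ρ • (m : E N) :=
    (measurableEmbedding_addLeft a).comp ((measurableEmbedding_const_smul₀ hρ.ne').comp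
      (MeasurableEmbedding.subtype_coe Metric.isClosed_sphere.measurableSet))
  rw [sphereSurface, integral_smul_measure, he.integral_map,
    ENNReal.toReal_ofReal (pow_nonneg hρ.le _), smul_eq_mul]

theorem exists_integral_abs_le (hΩ : IsSmoothBoundedDomain Ω)
    (hr : ∀ ε > 0, 0 < r ε ∧ r ε < ε)
    (hrS : Tendsto (fun ε => ((centres Ω ε).ncard : ℝ) * r ε ^ (N - 1)) (𝓝[>] 0) (𝓝 S))
    {α : ℝ} (hα : 0 < α) {gε : ℝ → E N → ℝ}
    (hgε : ∀ ε > 0, MemLp (gε ε) 2 (perforatedSurface Ω (r ε) ε))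
    (hg_bdd : ∃ C : ℝ≥0, ∀ᶠ ε in 𝓝[>] (0 : ℝ),
      ENNReal.ofReal α * eLpNorm (gε ε) 2 (innerSurface Ω (r ε) ε) ≤ C) :
    ∃ K : ℝ, 0 ≤ K ∧ (∀ᶠ ε in 𝓝[>] (0 : ℝ), ∫ x, |gε ε x| ∂(innerSurface Ω (r ε) ε) ≤ K) ∧
      ∀ᶠ ε in 𝓝[>] (0 : ℝ), ∫ x, gε ε x ^ 2 ∂(innerSurface Ω (r ε) ε) ≤ K := by
  obtain ⟨C, hC⟩ := hg_bdd
  have hm := tendsto_innerSurface_real_univ hΩ hr hrS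
  set m := |S * sphereArea N| + 1
  have hsq : ∀ᶠ ε in 𝓝[>] (0 : ℝ), ∫ x, gε ε x ^ 2 ∂(innerSurface Ω (r ε) ε) ≤ (C / α) ^ 2 := by
    filter_upwards [hC, self_mem_nhdsWithin] with ε h1 hε
    have hg : MemLp (gε ε) 2 (innerSurface Ω (r ε) ε) := (hgε ε hε).mono_measure innerSurface_le
    have h2 := ENNReal.toReal_mono ENNReal.coe_ne_top h1
    rw [ENNReal.toReal_mul, ENNReal.toReal_ofReal hα.le, ENNReal.coe_toReal] at h2
    have h3 := eLpNorm_two_sq (innerSurface Ω (r ε) ε) (gε ε)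
    rw [lintegral_enorm_sq_eq hg] at h3
    have h4 := congrArg ENNReal.toReal h3
    rw [ENNReal.toReal_pow, ENNReal.toReal_ofReal (integral_nonneg fun _ => by positivity)] at h4
    simp only [Real.norm_eq_abs, sq_abs] at h4
    rw [← h4]
    refine pow_le_pow_left₀ ENNReal.toReal_nonneg ?_ 2
    rw [le_div_iff₀ hα, mul_comm]
    exact h2
  have hK : 0 ≤ m + (C / α) ^ 2 := by positivity
  refine ⟨m + (C / α) ^ 2, hK, ?_, hsq.mono fun ε h => h.trans (le_add_of_nonneg_left (by positivity))⟩
  filter_upwards [hsq, self_mem_nhdsWithin,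
    hm.eventually_lt_const (lt_of_le_of_lt (le_abs_self _) (lt_add_one _))] with ε h1 hε h2
  have hg : MemLp (gε ε) 2 (innerSurface Ω (r ε) ε) := (hgε ε hε).mono_measure innerSurface_le
  have := isFiniteMeasure_innerSurface (ρ := r ε) hΩ.isBounded hε
  have i1 : Integrable (fun x => gε ε x ^ 2) (innerSurface Ω (r ε) ε) := hg.integrable_sq
  have i2 : Integrable (gε ε) (innerSurface Ω (r ε) ε) := hg.integrable (by norm_num)
  -- The bound `|g| ≤ 1 + g²` suffices for the `L¹` norm, because the total area of the spheres
  -- converges.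
  calc ∫ x, |gε ε x| ∂(innerSurface Ω (r ε) ε)
      ≤ ∫ x, (1 + gε ε x ^ 2) ∂(innerSurface Ω (r ε) ε) := by
        refine integral_mono i2.abs ((integrable_const 1).add i1) fun x => ?_
        simp only
        rw [← sq_abs (gε ε x)]
        nlinarith [sq_nonneg (|gε ε x| - 1), abs_nonneg (gε ε x)]
    _ ≤ _ := by
        rw [integral_add (integrable_const 1) i1, integral_const, smul_eq_mul, mul_one]
        exact add_le_add h2.le h1

/-- The limit of the integrals of data that are the same on every inclusion. -/
theorem tendsto_integral_innerSurface_data (hN : 1 ≤ N) (hΩ : IsSmoothBoundedDomain Ω)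
    (hr : ∀ ε > 0, 0 < r ε ∧ r ε < ε)
    (hrS : Tendsto (fun ε => ((centres Ω ε).ncard : ℝ) * r ε ^ (N - 1)) (𝓝[>] 0) (𝓝 S))
    {α : ℝ} (hα : 0 < α) {gε : ℝ → E N → ℝ}
    (hgε : ∀ ε > 0, MemLp (gε ε) 2 (perforatedSurface Ω (r ε) ε))
    (hg_bdd : ∃ C : ℝ≥0, ∀ᶠ ε in 𝓝[>] (0 : ℝ),
      ENNReal.ofReal α * eLpNorm (gε ε) 2 (innerSurface Ω (r ε) ε) ≤ C)
    {h : ℝ → Metric.sphere (0 : E N) 1 → ℝ}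
    (hgh : ∀ ε > 0, ∀ x ∈ centres Ω ε, ∀ᵐ m : Metric.sphere (0 : E N) 1 ∂(sphereMeasure N),
      gε ε (x + r ε • (m : E N)) = h ε m)
    {hbar : ℝ}
    (hhbar : Tendsto (fun ε => (1 / sphereArea N) * ∫ m, h ε m ∂(sphereMeasure N))
      (𝓝[>] 0) (𝓝 hbar)) {ζ : E N → ℝ} (hζ : Continuous ζ) :
    Tendsto (fun ε => ∫ x, ζ x * gε ε x ∂(innerSurface Ω (r ε) ε)) (𝓝[>] 0)
      (𝓝 (S * sphereArea N / volume.real Ω * hbar * ∫ x in Ω, ζ x)) := by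
  obtain ⟨K, hK0, hK, -⟩ := exists_integral_abs_le hΩ hr hrS hα hgε hg_bdd
  have hω := sphereArea_pos hN
  have hmain : Tendsto (fun ε => ∑ᶠ a ∈ centres Ω ε, ζ a * ∫ x, gε ε x ∂(sphereSurface a (r ε)))
      (𝓝[>] 0) (𝓝 (S * sphereArea N / volume.real Ω * hbar * ∫ x in Ω, ζ x)) := by
    -- The sum factors as the cell volume times the sum of `ζ`, times `r ^ (N - 1)` over the cell
    -- volume, times the integral of `h ε`. Each of the three factors has a limit.
    have h1 := ((tendsto_sum_centres hN hΩ hζ).mul (tendsto_pow_div_gridCell hN hΩ hrS)).mul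
      (hhbar.const_mul (sphereArea N))
    have e : S * sphereArea N / volume.real Ω * hbar * ∫ x in Ω, ζ x =
      (∫ x in Ω, ζ x) * (S / volume.real Ω) * (sphereArea N * hbar) := by ring
    rw [e]
    refine h1.congr' ?_
    filter_upwards [self_mem_nhdsWithin] with ε hε
    have hfin := centres_finite hΩ.isBounded hε
    have e2 : ∀ a ∈ centres Ω ε, ζ a * ∫ x, gε ε x ∂(sphereSurface a (r ε)) =
        ζ a * (r ε ^ (N - 1) * ∫ m, h ε m ∂(sphereMeasure N)) := by
      intro a ha
      rw [integral_sphereSurface (hr ε hε).1, integral_congr_ae (hgh ε hε a ha)]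
    rw [finsum_mem_congr rfl e2, finsum_mem_eq_finite_toFinset_sum _ hfin,
      finsum_mem_eq_finite_toFinset_sum _ hfin, ← Finset.sum_mul]
    have hV := volume_real_gridCell_pos (N := N) ε
    field_simp
  have hdiff : Tendsto (fun ε => ∫ x, ζ x * gε ε x ∂(innerSurface Ω (r ε) ε) -
      ∑ᶠ a ∈ centres Ω ε, ζ a * ∫ x, gε ε x ∂(sphereSurface a (r ε))) (𝓝[>] 0) (𝓝 0) := by
    rw [Metric.tendsto_nhds]
    intro η hη
    have hKc : IsCompact (Metric.cthickening 1 Ω) :=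
      Metric.isCompact_of_isClosed_isBounded Metric.isClosed_cthickening hΩ.isBounded.cthickening
    have huc := hKc.uniformContinuousOn_of_continuous hζ.continuousOn
    rw [Metric.uniformContinuousOn_iff] at huc
    obtain ⟨δ, hδ, hd⟩ := huc (η / (2 * (K + 1))) (by positivity)
    have h1 : ∀ᶠ ε in 𝓝[>] (0 : ℝ), ε < min δ 1 :=
      nhdsWithin_le_nhds (Iio_mem_nhds (by positivity))
    filter_upwards [hK, h1, self_mem_nhdsWithin] with ε h2 h3 hε
    have hg : MemLp (gε ε) 2 (innerSurface Ω (r ε) ε) := (hgε ε hε).mono_measure innerSurface_le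
    have := isFiniteMeasure_innerSurface (ρ := r ε) hΩ.isBounded hε
    have h4 := abs_innerSurface_sub_sum_le hΩ.isBounded hε (hr ε hε).1 hζ
      (hg.integrable (by norm_num)) (δ := η / (2 * (K + 1))) (fun a ha x hx => by
        have h5 : dist x a < min δ 1 := (Metric.mem_closedBall.1 hx).trans_lt
          ((hr ε hε).2.trans h3)
        refine (hd x ?_ a ?_ (h5.trans_le (min_le_left _ _))).le
        · exact Metric.mem_cthickening_of_dist_le x a _ _ ha.1 (h5.le.trans (min_le_right _ _))
        · exact Metric.self_subset_cthickening _ ha.1)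
    rw [Real.dist_eq, sub_zero]
    refine h4.trans_lt ?_
    calc _ ≤ η / (2 * (K + 1)) * K := mul_le_mul_of_nonneg_left h2 (by positivity)
      _ < η := by
        rw [div_mul_eq_mul_div, div_lt_iff₀ (by positivity)]
        nlinarith
  have := hdiff.add hmain
  simpa using this

theorem infDist_centres_eq {a x : E N} {ρ ε : ℝ} (hε : 0 < ε) (ha : a ∈ centres Ω ε)
    (hd : dist x a = ρ) (hρε : ρ < ε) : Metric.infDist x (centres Ω ε) = ρ := by
  refine le_antisymm ((Metric.infDist_le_dist_of_mem ha).trans_eq hd) ?_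
  rw [Metric.le_infDist ⟨a, ha⟩]
  intro b hb
  rcases eq_or_ne a b with hab | hab
  · rw [← hab, hd]
  · have h1 := le_dist_of_mem_centres hε ha hb hab
    have h2 := dist_triangle_left a b x
    linarith

theorem auxiliary_eq_of_dist_eq {a x : E N} {α ρ ε : ℝ} (hε : 0 < ε) (ha : a ∈ centres Ω ε)
    (hd : dist x a = ρ) (hρε : ρ < ε) :
    auxiliary Ω α ρ ε x = cellProfile N α ρ ε ρ := by
  have h1 : ∃ c ∈ centres Ω ε, dist x c < ε := ⟨a, ha, by rw [hd]; exact hρε⟩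
  have h2 : auxiliary Ω α ρ ε x = cellProfile N α ρ ε (Metric.infDist x (centres Ω ε)) :=
    if_pos h1
  rw [h2, infDist_centres_eq hε ha hd hρε]

/-- The profile is radial and all spheres have the same radius, so the auxiliary function is a
single constant on the boundaries of the inclusions and factors out of the integral. -/
theorem auxiliary_eq_on_inclusions (hΩ : Bornology.IsBounded Ω) {α ρ ε : ℝ} (hε : 0 < ε)
    (hρ : 0 < ρ) (hρε : ρ < ε) :
    ∀ᵐ x ∂(innerSurface Ω ρ ε), auxiliary Ω α ρ ε x = cellProfile N α ρ ε ρ := by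
  refine (ae_innerSurface_iff hΩ hε hρ).2 fun a ha => ae_of_all _ fun m => ?_
  refine auxiliary_eq_of_dist_eq hε ha ?_ hρε
  rw [dist_eq_norm, add_sub_cancel_left, norm_smul, norm_eq_of_mem_sphere, mul_one,
    Real.norm_of_nonneg hρ.le]

/-- At the inner sphere the correction in the numerator vanishes. The one in the denominator is
nonnegative and at most `α * ε`: for `N = 2` because `log x ≤ x` at `x = ε / r ε`, for `N ≥ 3`
because `r ε < ε`. -/
theorem tendsto_cellProfile (hN : 2 ≤ N) (hr : ∀ ε > 0, 0 < r ε ∧ r ε < ε) {α : ℝ} (hα : 0 ≤ α) :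
    Tendsto (fun ε => cellProfile N α (r ε) ε (r ε)) (𝓝[>] 0) (𝓝 1) := by
  have hid : Tendsto (fun ε : ℝ => ε) (𝓝[>] 0) (𝓝 0) := nhdsWithin_le_nhds
  rcases eq_or_ne N 2 with h2 | h2
  · have h1 : Tendsto (fun ε => α * r ε * Real.log (ε / r ε)) (𝓝[>] 0) (𝓝 0) := by
      have h0 := hid.const_mul α
      rw [mul_zero] at h0
      refine tendsto_of_tendsto_of_tendsto_of_le_of_le' tendsto_const_nhds h0 ?_ ?_
      · filter_upwards [self_mem_nhdsWithin] with ε hε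
        obtain ⟨h3, h4⟩ := hr ε hε
        exact mul_nonneg (by positivity) (Real.log_nonneg ((one_le_div h3).2 h4.le))
      · filter_upwards [self_mem_nhdsWithin] with ε hε
        obtain ⟨h3, h4⟩ := hr ε hε
        have hε : 0 < ε := hε
        rw [mul_assoc]
        refine mul_le_mul_of_nonneg_left ?_ hα
        calc r ε * Real.log (ε / r ε) ≤ r ε * (ε / r ε) :=
              mul_le_mul_of_nonneg_left (Real.log_le_self (by positivity)) h3.le
          _ = ε := by field_simp
    have h3 := (tendsto_const_nhds (x := (1 : ℝ))).div (h1.const_add 1) (by norm_num)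
    simp only [add_zero, div_one] at h3
    refine h3.congr' ?_
    filter_upwards [self_mem_nhdsWithin] with ε hε
    rw [cellProfile, if_pos h2, div_self (hr ε hε).1.ne', Real.log_one, mul_zero, add_zero]
    rfl
  · have hN2 : (0 : ℝ) < (N : ℝ) - 2 := by
      have : 3 ≤ N := by omega
      have : (3 : ℝ) ≤ N := by exact_mod_cast this
      linarith
    have h1 : Tendsto (fun ε => α * r ε * (1 - (r ε / ε) ^ (N - 2))) (𝓝[>] 0) (𝓝 0) := by
      have h0 := hid.const_mul α
      rw [mul_zero] at h0
      refine tendsto_of_tendsto_of_tendsto_of_le_of_le' tendsto_const_nhds h0 ?_ ?_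
      · filter_upwards [self_mem_nhdsWithin] with ε hε
        obtain ⟨h3, h4⟩ := hr ε hε
        have hε : 0 < ε := hε
        refine mul_nonneg (by positivity) (sub_nonneg.2 (pow_le_one₀ (by positivity) ?_))
        exact (div_le_one hε).2 h4.le
      · filter_upwards [self_mem_nhdsWithin] with ε hε
        obtain ⟨h3, h4⟩ := hr ε hε
        have hε : 0 < ε := hε
        have h5 : 1 - (r ε / ε) ^ (N - 2) ≤ 1 := sub_le_self _ (by positivity)
        calc _ ≤ α * r ε * 1 := mul_le_mul_of_nonneg_left h5 (by positivity)
          _ ≤ α * ε := by rw [mul_one]; exact mul_le_mul_of_nonneg_left h4.le hα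
    have h3 := (tendsto_const_nhds (x := (N : ℝ) - 2)).div (h1.const_add ((N : ℝ) - 2))
      (by rw [add_zero]; exact hN2.ne')
    rw [add_zero, div_self hN2.ne'] at h3
    refine h3.congr' ?_
    filter_upwards [self_mem_nhdsWithin] with ε hε
    rw [cellProfile, if_neg h2, div_self (hr ε hε).1.ne', one_pow, sub_self, mul_zero, add_zero]
    rfl

theorem tendsto_mul_integral_auxiliary (hN : 2 ≤ N) (hΩ : IsSmoothBoundedDomain Ω)
    (hr : ∀ ε > 0, 0 < r ε ∧ r ε < ε)
    (hrS : Tendsto (fun ε => ((centres Ω ε).ncard : ℝ) * r ε ^ (N - 1)) (𝓝[>] 0) (𝓝 S))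
    {α : ℝ} (hα : 0 ≤ α) {gε : ℝ → E N → ℝ}
    (hgε : ∀ ε > 0, MemLp (gε ε) 2 (perforatedSurface Ω (r ε) ε))
    (hg_bdd : ∃ C : ℝ≥0, ∀ᶠ ε in 𝓝[>] (0 : ℝ),
      ENNReal.ofReal α * eLpNorm (gε ε) 2 (innerSurface Ω (r ε) ε) ≤ C)
    {h : ℝ → Metric.sphere (0 : E N) 1 → ℝ}
    (hgh : ∀ ε > 0, ∀ x ∈ centres Ω ε, ∀ᵐ m : Metric.sphere (0 : E N) 1 ∂(sphereMeasure N),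
      gε ε (x + r ε • (m : E N)) = h ε m)
    {hbar : ℝ}
    (hhbar : Tendsto (fun ε => (1 / sphereArea N) * ∫ m, h ε m ∂(sphereMeasure N))
      (𝓝[>] 0) (𝓝 hbar)) {ζ : E N → ℝ} (hζ : Continuous ζ) :
    Tendsto (fun ε => α * ∫ x, ζ x * gε ε x * auxiliary Ω α (r ε) ε x
        ∂(innerSurface Ω (r ε) ε)) (𝓝[>] 0)
      (𝓝 (α * S * sphereArea N / volume.real Ω * hbar * ∫ x in Ω, ζ x)) := by
  -- For `α = 0` both sides vanish. This case is separate because the hypothesis bounds only `α`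
  -- times the norm of the data.
  rcases hα.eq_or_lt with rfl | hα'
  · simp
  have h1 := ((tendsto_integral_innerSurface_data (by omega) hΩ hr hrS hα' hgε hg_bdd hgh hhbar
    hζ).mul (tendsto_cellProfile hN hr hα)).const_mul α
  have e : α * S * sphereArea N / volume.real Ω * hbar * ∫ x in Ω, ζ x =
    α * (S * sphereArea N / volume.real Ω * hbar * (∫ x in Ω, ζ x) * 1) := by ring
  rw [e]
  refine h1.congr' ?_
  filter_upwards [self_mem_nhdsWithin] with ε hε
  obtain ⟨h3, h4⟩ := hr ε hε
  rw [← integral_mul_const]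
  congr 1
  refine integral_congr_ae ?_
  filter_upwards [auxiliary_eq_on_inclusions (α := α) hΩ.isBounded hε h3 h4] with x hx
  rw [hx]

end Data

/-! ### Weak limits in `H¹` -/

section WeakLimits

variable {N : ℕ}

/-- The function underlying an element of `H¹(U)`, as a continuous linear map. -/
noncomputable def toFnCLM (U : Set (E N)) : H1 U →L[ℝ] Lp ℝ 2 (volume.restrict U) :=
  LinearMap.mkContinuous ⟨⟨fun v => toFn v, toFn_add⟩, toFn_smul⟩ 1
    fun v => (norm_toFn_le v).trans_eq (one_mul _).symm

/-- The weak gradient as a continuous linear map. -/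
noncomputable def weakGradCLM (U : Set (E N)) : H1 U →L[ℝ] Lp (E N) 2 (volume.restrict U) :=
  LinearMap.mkContinuous ⟨⟨fun v => weakGrad v, weakGrad_add⟩, weakGrad_smul⟩ 1
    fun v => (norm_weakGrad_le v).trans_eq (one_mul _).symm

theorem toFnCLM_apply {U : Set (E N)} (v : H1 U) : toFnCLM U v = toFn v := rfl

theorem WeaklyTendsto.inner_clm {ι H F : Type*} [NormedAddCommGroup H] [NormedSpace ℝ H]
    [NormedAddCommGroup F] [InnerProductSpace ℝ F] {w : ι → H} {l : Filter ι} {u : H}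
    (h : WeaklyTendsto w l u) (A : H →L[ℝ] F) (y : F) :
    Tendsto (fun i => (inner ℝ (A (w i)) y : ℝ)) l (𝓝 (inner ℝ (A u) y)) := by
  have := h ((innerSL ℝ y).comp A)
  simpa [real_inner_comm] using this

theorem integrable_inner_of_memLp {X F : Type*} [MeasurableSpace X] [NormedAddCommGroup F]
    [InnerProductSpace ℝ F] {μ : Measure X} {f g : X → F} (hf : MemLp f 2 μ) (hg : MemLp g 2 μ) :
    Integrable (fun x => (inner ℝ (f x) (g x) : ℝ)) μ := by
  refine (L2.integrable_inner (𝕜 := ℝ) (hf.toLp f) (hg.toLp g)).congr ?_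
  filter_upwards [hf.coeFn_toLp, hg.coeFn_toLp] with x h1 h2
  rw [h1, h2]

theorem abs_setIntegral_inner_le {X F : Type*} [MeasurableSpace X] [NormedAddCommGroup F]
    [InnerProductSpace ℝ F] {μ : Measure X} (G : Lp F 2 μ) {ψ : X → F} (hψ : MemLp ψ 2 μ)
    {D : Set X} (hD : MeasurableSet D) :
    |∫ x in D, inner ℝ (G x) (ψ x) ∂μ| ^ 2 ≤ ‖G‖ ^ 2 * ∫ x in D, ‖ψ x‖ ^ 2 ∂μ := by
  have hi := hψ.indicator hD
  have h1 : ∫ x in D, inner ℝ (G x) (ψ x) ∂μ = inner ℝ G (hi.toLp _) := by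
    rw [L2.inner_def, ← integral_indicator hD]
    refine integral_congr_ae ?_
    filter_upwards [hi.coeFn_toLp] with x hx
    rw [hx]
    by_cases hxD : x ∈ D <;> simp [hxD]
  have h2 : ∫ x in D, ‖ψ x‖ ^ 2 ∂μ = ‖hi.toLp _‖ ^ 2 := by
    rw [← integral_sq_eq_norm_sq, ← integral_indicator hD]
    refine integral_congr_ae ?_
    filter_upwards [hi.coeFn_toLp] with x hx
    rw [hx]
    by_cases hxD : x ∈ D <;> simp [hxD]
  rw [h1, h2, ← mul_pow]
  exact pow_le_pow_left₀ (abs_nonneg _) (abs_real_inner_le_norm _ _) 2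

/-- The integral over the whole space converges weakly. The part over `D i` tends to zero by
Cauchy-Schwarz, since `G i` is bounded and the fixed function `ψ` has small norm on sets of small
measure. -/
theorem tendsto_setIntegral_inner_of_weak {X F ι : Type*} [MeasurableSpace X]
    [NormedAddCommGroup F] [InnerProductSpace ℝ F] {μ : Measure X} {l : Filter ι}
    {G : ι → Lp F 2 μ} {G₀ : Lp F 2 μ} {M : ℝ} (hM : ∀ᶠ i in l, ‖G i‖ ≤ M) {ψ : X → F}
    (hψ : MemLp ψ 2 μ)
    (hG : Tendsto (fun i => (inner ℝ (G i) (hψ.toLp ψ) : ℝ)) l (𝓝 (inner ℝ G₀ (hψ.toLp ψ))))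
    {D : ι → Set X} (hD : ∀ᶠ i in l, MeasurableSet (D i)) (hD0 : Tendsto (fun i => μ (D i)) l (𝓝 0)) :
    Tendsto (fun i => ∫ x in (D i)ᶜ, inner ℝ (G i x) (ψ x) ∂μ) l
      (𝓝 (∫ x, inner ℝ (G₀ x) (ψ x) ∂μ)) := by
  have e : ∀ K : Lp F 2 μ, inner ℝ K (hψ.toLp ψ) = ∫ x, inner ℝ (K x) (ψ x) ∂μ := fun K => by
    rw [L2.inner_def]
    refine integral_congr_ae ?_
    filter_upwards [hψ.coeFn_toLp] with x hx
    rw [hx]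
  have h0 : Tendsto (fun i => ∫ x in D i, ‖ψ x‖ ^ 2 ∂μ) l (𝓝 0) :=
    (hψ.integrable_norm_pow (by norm_num)).tendsto_setIntegral_nhds_zero hD0
  have h1 : Tendsto (fun i => ∫ x in D i, inner ℝ (G i x) (ψ x) ∂μ) l (𝓝 0) := by
    have h2 : Tendsto (fun i => √(M ^ 2 * ∫ x in D i, ‖ψ x‖ ^ 2 ∂μ)) l (𝓝 0) := by
      have := (h0.const_mul (M ^ 2)).sqrt
      simpa using this
    rw [tendsto_zero_iff_abs_tendsto_zero]
    refine squeeze_zero' (Eventually.of_forall fun _ => abs_nonneg _) ?_ h2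
    filter_upwards [hM, hD] with i hi hDi
    refine Real.le_sqrt_of_sq_le ((abs_setIntegral_inner_le (G i) hψ hDi).trans ?_)
    exact mul_le_mul_of_nonneg_right (pow_le_pow_left₀ (norm_nonneg _) hi 2)
      (integral_nonneg fun _ => by positivity)
  have h3 := hG.sub h1
  simp only [e, sub_zero] at h3
  refine h3.congr' ?_
  filter_upwards [hD] with i hDi
  have := integral_add_compl hDi (f := fun x => (inner ℝ (G i x) (ψ x) : ℝ)) (μ := μ)
    (integrable_inner_of_memLp (Lp.memLp (G i)) hψ)
  linarith

end WeakLimits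

/-! ### Functions on the perforated domain and their extensions -/

section Extensions

variable {N : ℕ} {Ω : Set (E N)} {ρ ε : ℝ}

theorem H1.norm_le_of_ae_eq {U' U : Set (E N)} (hU' : IsOpen U') (h : U' ⊆ U) {w : H1 U}
    {v : H1 U'} (hwv : toFn w =ᵐ[volume.restrict U'] toFn v) : ‖v‖ ≤ ‖w‖ := by
  have hle : volume.restrict U' ≤ volume.restrict U := Measure.restrict_mono h le_rfl
  have key : ∀ {F : Type} [NormedAddCommGroup F] [InnerProductSpace ℝ F]
      (a : Lp F 2 (volume.restrict U)) (b : Lp F 2 (volume.restrict U')),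
      a =ᵐ[volume.restrict U'] b → ‖b‖ ^ 2 ≤ ‖a‖ ^ 2 := by
    intro F _ _ a b hab
    rw [← integral_sq_eq_norm_sq, ← integral_sq_eq_norm_sq]
    calc ∫ x in U', ‖b x‖ ^ 2 = ∫ x in U', ‖a x‖ ^ 2 :=
          integral_congr_ae (by filter_upwards [hab] with x hx; rw [hx])
      _ ≤ _ := integral_mono_measure hle (ae_of_all _ fun _ => by positivity)
          ((Lp.memLp a).integrable_norm_pow (by norm_num))
  have h1 := key _ _ hwv
  have h2 := key _ _ (H1.ae_weakGrad_eq hU' h w v hwv)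
  refine le_of_sq_le_sq ?_ (norm_nonneg _)
  rw [H1.norm_sq, H1.norm_sq]
  exact add_le_add h1 h2

theorem exists_outer_trace (hΩ : IsSmoothBoundedDomain Ω) (hε : 0 < ε) (hρε : ρ < ε)
    {w : H1 Ω} {v : H1 (perforated Ω ρ ε)}
    (hwv : toFn w =ᵐ[volume.restrict (perforated Ω ρ ε)] toFn v)
    {t : Lp ℝ 2 (perforatedSurface Ω ρ ε)} (ht : HasTrace (perforatedSurface Ω ρ ε) v t) :
    ∃ t₀ : Lp ℝ 2 (outerSurface Ω), t₀ =ᵐ[outerSurface Ω] t ∧ HasTrace (outerSurface Ω) w t₀ := by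
  have hm : MemLp t 2 (outerSurface Ω) := (Lp.memLp t).mono_measure outerSurface_le
  refine ⟨hm.toLp t, hm.coeFn_toLp, ?_⟩
  refine HasTrace.of_sdiff hΩ.isOpen hΩ.isBounded (isCompact_inclusions hΩ.isBounded hε ρ)
    (inclusions_subset hρε) hwv outerSurface_le ?_ ht hm.coeFn_toLp
  rw [outerSurface, Measure.restrict_apply isClosed_frontier.measurableSet.compl]
  simp

/-- A test function with a trace is by definition a limit of smooth functions, in `H¹` and on the
boundary, and every term of the weak formulation is continuous in this sense. -/
theorem isRobinSolution_of_smooth {U : Set (E N)} (hU : Bornology.IsBounded U)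
    {ν : Measure (E N)} (hν : ∀ φ : E N → ℝ, ContDiff ℝ ∞ φ → MemLp φ 2 ν) {k α : ℝ}
    {F g : E N → ℝ} (hF : MemLp F 2 (volume.restrict U)) (hg : MemLp g 2 ν) {u : H1 U}
    {t : Lp ℝ 2 ν} (ht : HasTrace ν u t)
    (h : ∀ ζ : E N → ℝ, ContDiff ℝ ∞ ζ →
      (∫ x in U, inner ℝ (weakGrad u x) (gradient ζ x)) + k * (∫ x in U, toFn u x * ζ x)
        + α * (∫ x, (t x - g x) * ζ x ∂ν) = ∫ x in U, F x * ζ x) :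
    IsRobinSolution U ν k α F g u := by
  refine ⟨t, ht, fun v s hs => ?_⟩
  obtain ⟨φ, hφ, h1, h2, h3⟩ := (hasTrace_iff hU).1 hs
  have m1 : ∀ n, MemLp (φ n) 2 (volume.restrict U) := fun n =>
    memLp_restrict_of_continuous hU (hφ n).continuous 2
  have m2 : ∀ n, MemLp (gradient (φ n)) 2 (volume.restrict U) := fun n =>
    memLp_restrict_of_continuous hU (continuous_gradient (hφ n)) 2
  have z : ∀ {X F' : Type} [MeasurableSpace X] [NormedAddCommGroup F'] {μ : Measure X}
      (f : X → F'), Tendsto (fun _ : ℕ => eLpNorm (f - f) 2 μ) atTop (𝓝 0) := by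
    intro X F' _ _ μ f; simp
  have t1 := tendsto_integral_inner (fun _ => Lp.memLp (weakGrad u)) m2 (Lp.memLp (weakGrad u))
    (Lp.memLp (weakGrad v)) (z _) h2
  have t2 := tendsto_integral_mul (fun _ => Lp.memLp (toFn u)) m1 (Lp.memLp (toFn u))
    (Lp.memLp (toFn v)) (z _) h1
  have t3 := tendsto_integral_mul (fun _ => (Lp.memLp t).sub hg) (fun n => hν _ (hφ n))
    ((Lp.memLp t).sub hg) (Lp.memLp s) (z _) h3
  have t4 := tendsto_integral_mul (fun _ => hF) m1 hF (Lp.memLp (toFn v)) (z _) h1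
  have t5 := (t1.add (t2.const_mul k)).add (t3.const_mul α)
  exact tendsto_nhds_unique t5 (t4.congr fun n => (h (φ n) (hφ n)).symm)

end Extensions

/-! ### Passage to the limit in the weak formulation -/

section Limit

variable {N : ℕ} {Ω : Set (E N)} {r : ℝ → ℝ} {S : ℝ}

theorem perforated_eq_inter_compl {ρ ε : ℝ} :
    perforated Ω ρ ε = (inclusions Ω ρ ε)ᶜ ∩ Ω := by
  rw [perforated, sdiff_eq, inter_comm]

theorem restrict_perforated (hΩ : IsSmoothBoundedDomain Ω) {ρ ε : ℝ} (hε : 0 < ε) :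
    (volume.restrict Ω).restrict (inclusions Ω ρ ε)ᶜ = volume.restrict (perforated Ω ρ ε) := by
  rw [Measure.restrict_restrict (isCompact_inclusions hΩ.isBounded hε ρ).measurableSet.compl,
    perforated_eq_inter_compl]

theorem tendsto_restrict_inclusions (hN : 1 ≤ N) (hΩ : IsSmoothBoundedDomain Ω)
    (hr : ∀ ε > 0, 0 < r ε ∧ r ε < ε)
    (hrS : Tendsto (fun ε => ((centres Ω ε).ncard : ℝ) * r ε ^ (N - 1)) (𝓝[>] 0) (𝓝 S)) :
    Tendsto (fun ε => volume.restrict Ω (inclusions Ω (r ε) ε)) (𝓝[>] 0) (𝓝 0) :=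
  tendsto_of_tendsto_of_tendsto_of_le_of_le tendsto_const_nhds
    (tendsto_volume_inclusions hN hΩ hr hrS) (fun _ => zero_le)
    fun _ => Measure.restrict_apply_le _ _

theorem mul_sq_add_sq_lt {η a b M : ℝ} (hη : 0 < η) (ha : 0 ≤ a) (haM : a ≤ M) :
    η / (2 * (M ^ 2 + b ^ 2 + 1)) * (a ^ 2 + b ^ 2) < η := by
  have h3 : a ^ 2 ≤ M ^ 2 := pow_le_pow_left₀ ha haM 2
  calc _ ≤ η / (2 * (M ^ 2 + b ^ 2 + 1)) * (M ^ 2 + b ^ 2 + 1) :=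
        mul_le_mul_of_nonneg_left (by linarith) (by positivity)
    _ = η / 2 := by field_simp
    _ < η := by linarith

/-- The limit of the integrals of the traces over the boundaries of the inclusions. -/
theorem tendsto_integral_innerSurface_trace (hN : 1 ≤ N) (hΩ : IsSmoothBoundedDomain Ω)
    (hr : ∀ ε > 0, 0 < r ε ∧ r ε < ε)
    (hrS : Tendsto (fun ε => ((centres Ω ε).ncard : ℝ) * r ε ^ (N - 1)) (𝓝[>] 0) (𝓝 S))
    {l : Filter ℝ} (hl : l ≤ 𝓝[>] 0) {v : ∀ ε, H1 (perforated Ω (r ε) ε)} {w : ℝ → H1 Ω}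
    (hwv : ∀ ε > 0, toFn (w ε) =ᵐ[volume.restrict (perforated Ω (r ε) ε)] toFn (v ε))
    {t : ∀ ε, Lp ℝ 2 (perforatedSurface Ω (r ε) ε)}
    (ht : ∀ ε > 0, HasTrace (perforatedSurface Ω (r ε) ε) (v ε) (t ε))
    {M : ℝ} (hM : ∀ᶠ ε in l, ‖w ε‖ ≤ M) {u : H1 Ω} (hu : WeaklyTendsto w l u)
    {ζ : E N → ℝ} (hζ : ContDiff ℝ ∞ ζ) :
    Tendsto (fun ε => ∫ x, t ε x * ζ x ∂(innerSurface Ω (r ε) ε)) l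
      (𝓝 (sphereArea N * S / volume.real Ω * ∫ x in Ω, toFn u x * ζ x)) := by
  have hpos : ∀ᶠ ε in l, 0 < ε := hl self_mem_nhdsWithin
  have hζm : MemLp ζ 2 (volume.restrict Ω) :=
    memLp_restrict_of_continuous hΩ.isBounded hζ.continuous 2
  -- the limit of the volume integrals
  have hvol : Tendsto (fun ε => ∫ x in Ω, toFn (w ε) x * ζ x) l
      (𝓝 (∫ x in Ω, toFn u x * ζ x)) := by
    have := hu.inner_clm (toFnCLM Ω) (hζm.toLp ζ)
    have e : ∀ y : H1 Ω, inner ℝ (toFnCLM Ω y) (hζm.toLp ζ) = ∫ x in Ω, toFn y x * ζ x := by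
      intro y
      rw [toFnCLM_apply, ← integral_mul_eq_inner]
      refine integral_congr_ae ?_
      filter_upwards [hζm.coeFn_toLp] with x hx
      rw [hx]
    simpa only [e] using this
  -- a bound for the test function
  obtain ⟨B, hB⟩ := hΩ.isBounded.isCompact_closure.exists_bound_of_continuousOn
    hζ.continuous.continuousOn
  obtain ⟨B', hB'⟩ := hΩ.isBounded.isCompact_closure.exists_bound_of_continuousOn
    (continuous_gradient hζ).continuousOn
  have hζ1 : ∀ x ∈ Ω, |ζ x| ≤ max B B' := fun x hx =>
    (hB x (subset_closure hx)).trans (le_max_left _ _)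
  have hζ2 : ∀ x ∈ Ω, ‖gradient ζ x‖ ≤ max B B' := fun x hx =>
    (hB' x (subset_closure hx)).trans (le_max_right _ _)
  -- comparison of surface and annuli
  have hc : Tendsto (fun ε => ∫ x, t ε x * ζ x ∂(innerSurface Ω (r ε) ε) -
      annulusDensity N (r ε) ε * ∫ x in centreAnnuli Ω ε, toFn (w ε) x * ζ x) l (𝓝 0) := by
    have h0 : Tendsto (fun ε => √(ε * (innerSurface Ω (r ε) ε).real univ *
        (2 * max B B' ^ 2 * M ^ 2))) l (𝓝 0) := by
      have h1 : Tendsto (fun ε : ℝ => ε) l (𝓝 0) := hl.trans nhdsWithin_le_nhds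
      have h2 := (((h1.mul ((tendsto_innerSurface_real_univ hΩ hr hrS).mono_left hl))).mul_const
        (2 * max B B' ^ 2 * M ^ 2)).sqrt
      simpa using h2
    rw [tendsto_zero_iff_abs_tendsto_zero]
    refine squeeze_zero' (Eventually.of_forall fun _ => abs_nonneg _) ?_ h0
    filter_upwards [hpos, hM, hl (eventually_lt_half hN hΩ hrS)] with ε hε hMε hh
    have hA := centreAnnuli_subset_perforated (Ω := Ω) hε hh
    have e : ∫ x in centreAnnuli Ω ε, toFn (w ε) x * ζ x =
        ∫ x in centreAnnuli Ω ε, toFn (v ε) x * ζ x := by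
      refine integral_congr_ae ?_
      filter_upwards [(hwv ε hε).filter_mono (ae_mono (Measure.restrict_mono hA le_rfl))] with x hx
      rw [hx]
    have hv : ‖v ε‖ ≤ M :=
      (H1.norm_le_of_ae_eq (isOpen_perforated hΩ hε) sdiff_subset (hwv ε hε)).trans hMε
    have hv2 : ‖v ε‖ ^ 2 ≤ M ^ 2 := pow_le_pow_left₀ (norm_nonneg _) hv 2
    rw [Function.comp_apply, e]
    refine Real.le_sqrt_of_sq_le (((ht ε hε).abs_innerSurface_mul_sub_le hN hΩ (hr ε hε).1 hh hζ
      hζ1 hζ2).trans ?_)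
    have h3 : 0 ≤ (innerSurface Ω (r ε) ε).real univ := measureReal_nonneg
    gcongr
  -- comparison of annuli and the domain
  have hν : MemLp ζ 2 (outerSurface Ω) := memLp_outerSurface hΩ hζ.continuous
  set z := ofSmooth hΩ.isBounded hζ with hz
  have hzt := hasTrace_ofSmooth hΩ.isBounded hζ hν
  have hz1 : toFn z =ᵐ[volume.restrict Ω] ζ := toFn_ofSmooth _ _
  have hd : Tendsto (fun ε => annulusDensity N (r ε) ε *
      (∫ x in centreAnnuli Ω ε, toFn (w ε) x * ζ x) -
      cellDensity N (r ε) ε * ∫ x in Ω, toFn (w ε) x * ζ x) l (𝓝 0) := by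
    rw [Metric.tendsto_nhds]
    intro η hη
    -- The denominator makes the error, `η'` times the sum of the squared norms, smaller than `η`
    -- for all functions of norm at most `M`.
    have hη' : 0 < η / (2 * (M ^ 2 + ‖z‖ ^ 2 + 1)) := by positivity
    filter_upwards [hpos, hM, hl (eventually_abs_annuli_mul_sub_le hN hΩ hr hrS hη')]
      with ε hε hMε h1
    -- The comparison of annuli with the domain is available for functions on `Ω` with a trace. The
    -- extension inherits one from the solution.
    obtain ⟨t₀, -, ht₀⟩ := exists_outer_trace hΩ hε (hr ε hε).2 (hwv ε hε) (ht ε hε)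
    have h2 := h1 (w ε) z t₀ _ ht₀ hzt
    have e : ∀ A ⊆ Ω, ∫ x in A, toFn (w ε) x * toFn z x = ∫ x in A, toFn (w ε) x * ζ x := by
      intro A hA
      refine integral_congr_ae ?_
      filter_upwards [hz1.filter_mono (ae_mono (Measure.restrict_mono hA le_rfl))] with x hx
      rw [hx]
    rw [e _ centreAnnuli_subset, e _ subset_rfl] at h2
    rw [Real.dist_eq, sub_zero]
    refine h2.trans_lt ?_
    exact mul_sq_add_sq_lt hη (norm_nonneg _) hMε
  have hk := ((tendsto_cellDensity hN hΩ hrS).mono_left hl).mul hvol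
  have := (hc.add hd).add hk
  simp only [zero_add, add_zero] at this
  refine this.congr fun ε => ?_
  ring

theorem IsRobinSolution.smooth_identity (hΩ : IsSmoothBoundedDomain Ω) {ρ ε α : ℝ} (hε : 0 < ε)
    (hρ : 0 < ρ) {f g : E N → ℝ} (hg : MemLp g 2 (perforatedSurface Ω ρ ε)) {w : H1 Ω}
    {v : H1 (perforated Ω ρ ε)}
    (hwv : toFn w =ᵐ[volume.restrict (perforated Ω ρ ε)] toFn v)
    {t : Lp ℝ 2 (perforatedSurface Ω ρ ε)} {t₀ : Lp ℝ 2 (outerSurface Ω)}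
    (ht₀ : t₀ =ᵐ[outerSurface Ω] t)
    (h : ∀ (y : H1 (perforated Ω ρ ε)) (s : Lp ℝ 2 (perforatedSurface Ω ρ ε)),
      HasTrace (perforatedSurface Ω ρ ε) y s →
      (∫ x in perforated Ω ρ ε, inner ℝ (weakGrad v x) (weakGrad y x)) +
        0 * (∫ x in perforated Ω ρ ε, toFn v x * toFn y x)
        + α * (∫ x, (t x - g x) * s x ∂(perforatedSurface Ω ρ ε)) =
        ∫ x in perforated Ω ρ ε, f x * toFn y x)
    {ζ : E N → ℝ} (hζ : ContDiff ℝ ∞ ζ) :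
    (∫ x in perforated Ω ρ ε, inner ℝ (weakGrad w x) (gradient ζ x)) +
      α * ((∫ x, t₀ x * ζ x ∂(outerSurface Ω)) - ∫ x, g x * ζ x ∂(outerSurface Ω)) +
      α * ((∫ x, t x * ζ x ∂(innerSurface Ω ρ ε)) - ∫ x, g x * ζ x ∂(innerSurface Ω ρ ε)) =
      ∫ x in perforated Ω ρ ε, f x * ζ x := by
  have hb := isBounded_perforated (ρ := ρ) (ε := ε) hΩ.isBounded
  have hm := memLp_perforatedSurface hΩ hε hρ hζ.continuous
  have h1 := h _ _ (hasTrace_ofSmooth hb hζ hm)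
  have e1 : ∫ x in perforated Ω ρ ε, inner ℝ (weakGrad v x) (weakGrad (ofSmooth hb hζ) x) =
      ∫ x in perforated Ω ρ ε, inner ℝ (weakGrad w x) (gradient ζ x) := by
    refine integral_congr_ae ?_
    filter_upwards [weakGrad_ofSmooth hb hζ, H1.ae_weakGrad_eq (isOpen_perforated hΩ hε)
      sdiff_subset w v hwv] with x h2 h3
    rw [h2, h3]
  have e2 : ∫ x in perforated Ω ρ ε, f x * toFn (ofSmooth hb hζ) x =
      ∫ x in perforated Ω ρ ε, f x * ζ x := by
    refine integral_congr_ae ?_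
    filter_upwards [toFn_ofSmooth hb hζ] with x h2
    rw [h2]
  have i1 : Integrable (fun x => t x * ζ x) (perforatedSurface Ω ρ ε) :=
    (Lp.memLp t).integrable_mul hm
  have i2 : Integrable (fun x => g x * ζ x) (perforatedSurface Ω ρ ε) := hg.integrable_mul hm
  have e3 : ∫ x, (t x - g x) * hm.toLp ζ x ∂(perforatedSurface Ω ρ ε) =
      ((∫ x, t₀ x * ζ x ∂(outerSurface Ω)) - ∫ x, g x * ζ x ∂(outerSurface Ω)) +
      ((∫ x, t x * ζ x ∂(innerSurface Ω ρ ε)) - ∫ x, g x * ζ x ∂(innerSurface Ω ρ ε)) := by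
    have e4 : ∫ x, (t x - g x) * hm.toLp ζ x ∂(perforatedSurface Ω ρ ε) =
        (∫ x, t x * ζ x ∂(perforatedSurface Ω ρ ε)) -
          ∫ x, g x * ζ x ∂(perforatedSurface Ω ρ ε) := by
      rw [← integral_sub i1 i2]
      refine integral_congr_ae ?_
      filter_upwards [hm.coeFn_toLp] with x h2
      rw [h2, sub_mul]
    have e5 : ∫ x, t₀ x * ζ x ∂(outerSurface Ω) = ∫ x, t x * ζ x ∂(outerSurface Ω) :=
      integral_congr_ae (by filter_upwards [ht₀] with x h2; rw [h2])
    have e6 : ∀ F : E N → ℝ, Integrable F (perforatedSurface Ω ρ ε) →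
        ∫ x, F x ∂(perforatedSurface Ω ρ ε) =
          (∫ x, F x ∂(outerSurface Ω)) + ∫ x, F x ∂(innerSurface Ω ρ ε) := fun F hF =>
      integral_add_measure (hF.mono_measure outerSurface_le) (hF.mono_measure innerSurface_le)
    rw [e4, e5, e6 _ i1, e6 _ i2]
    ring
  rw [e1, e2, e3] at h1
  rw [← h1]
  ring

theorem tendsto_integral_mul_of_pos {X : Type*} [MeasurableSpace X] {μ : Measure X}
    {G : ℝ → X → ℝ} {g ζ : X → ℝ} (hG : ∀ ε > 0, MemLp (G ε) 2 μ) (hg : MemLp g 2 μ)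
    (hζ : MemLp ζ 2 μ)
    (h : Tendsto (fun ε => eLpNorm (fun x => G ε x - g x) 2 μ) (𝓝[>] 0) (𝓝 0)) :
    Tendsto (fun ε => ∫ x, G ε x * ζ x ∂μ) (𝓝[>] 0) (𝓝 (∫ x, g x * ζ x ∂μ)) := by
  classical
  -- Integrability is assumed only for `ε > 0`. The limit `g` serves as the default elsewhere, which
  -- does not affect the filter `𝓝[>] 0`.
  have h1 : Tendsto (fun ε => eLpNorm ((if 0 < ε then G ε else g) - g) 2 μ) (𝓝[>] 0) (𝓝 0) := by
    refine h.congr' ?_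
    filter_upwards [self_mem_nhdsWithin] with ε hε
    rw [if_pos (show 0 < ε from hε)]
    rfl
  have h2 := tendsto_integral_mul (fun ε => by split_ifs with h; exacts [hG ε h, hg])
    (fun _ => hζ) hg hζ h1 (by simp)
  refine h2.congr' ?_
  filter_upwards [self_mem_nhdsWithin] with ε hε
  rw [if_pos (show 0 < ε from hε)]

/-- The factor `α` is kept together with `G`, because for `α = 0` the integrals of the data over the
inclusions need not converge. -/
theorem eq_of_tendsto_of_eventually_eq {l : Filter ℝ} [l.NeBot] {A B C D G F : ℝ → ℝ}
    {α a b c d e f : ℝ}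
    (h : ∀ᶠ ε in l, A ε + α * (B ε - C ε) + α * (D ε - G ε) = F ε)
    (hA : Tendsto A l (𝓝 a)) (hB : Tendsto B l (𝓝 b)) (hC : Tendsto C l (𝓝 c))
    (hD : Tendsto D l (𝓝 d)) (hG : Tendsto (fun ε => α * G ε) l (𝓝 e))
    (hF : Tendsto F l (𝓝 f)) : a + α * (b - c) + (α * d - e) = f := by
  refine tendsto_nhds_unique ?_ hF
  refine ((hA.add ((hB.sub hC).const_mul α)).add ((hD.const_mul α).sub hG)).congr' ?_
  filter_upwards [h] with ε hε
  rw [← hε]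
  ring

set_option maxHeartbeats 1000000 in
-- The limit is taken along an arbitrary proper filter below `𝓝[>] 0`. Sequences and ultrafilters
-- are both instances, the first for the statement about weak limits, the second for the whole
-- family.
theorem isRobinSolution_of_weaklyTendsto (hN : 1 ≤ N) (hΩ : IsSmoothBoundedDomain Ω)
    (hr : ∀ ε > 0, 0 < r ε ∧ r ε < ε)
    (hrS : Tendsto (fun ε => ((centres Ω ε).ncard : ℝ) * r ε ^ (N - 1)) (𝓝[>] 0) (𝓝 S))
    {α hbar : ℝ} {f : E N → ℝ} (hf : MemLp f 2 (volume.restrict Ω))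
    {gε : ℝ → E N → ℝ} (hgε : ∀ ε > 0, MemLp (gε ε) 2 (perforatedSurface Ω (r ε) ε))
    {g : E N → ℝ} (hg : MemLp g 2 (outerSurface Ω))
    (hg_lim : Tendsto (fun ε => eLpNorm (fun x => gε ε x - g x) 2 (outerSurface Ω))
      (𝓝[>] 0) (𝓝 0))
    (hγ : ∀ ζ : E N → ℝ, ContDiff ℝ ∞ ζ →
      Tendsto (fun ε => α * ∫ x, gε ε x * ζ x ∂(innerSurface Ω (r ε) ε)) (𝓝[>] 0)
        (𝓝 (α * sphereArea N * S / volume.real Ω * hbar * ∫ x in Ω, ζ x)))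
    {l : Filter ℝ} [l.NeBot] (hl : l ≤ 𝓝[>] 0) {v : ∀ ε, H1 (perforated Ω (r ε) ε)}
    {w : ℝ → H1 Ω}
    (hwv : ∀ ε > 0, toFn (w ε) =ᵐ[volume.restrict (perforated Ω (r ε) ε)] toFn (v ε))
    (hsol : ∀ ε > 0, IsRobinSolution (perforated Ω (r ε) ε) (perforatedSurface Ω (r ε) ε) 0 α
        f (gε ε) (v ε))
    {M : ℝ} (hM : ∀ᶠ ε in l, ‖w ε‖ ≤ M) {u : H1 Ω} (hu : WeaklyTendsto w l u) :
    IsRobinSolution Ω (outerSurface Ω) (α * sphereArea N * S / volume.real Ω) α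
      (fun x => f x + α * sphereArea N * S / volume.real Ω * hbar) g u := by
  have hpos : ∀ᶠ ε in l, 0 < ε := hl self_mem_nhdsWithin
  have hsol' : ∀ ε, ∃ t : Lp ℝ 2 (perforatedSurface Ω (r ε) ε), 0 < ε →
      HasTrace (perforatedSurface Ω (r ε) ε) (v ε) t ∧
      ∀ (y : H1 (perforated Ω (r ε) ε)) (s : Lp ℝ 2 (perforatedSurface Ω (r ε) ε)),
      HasTrace (perforatedSurface Ω (r ε) ε) y s →
      (∫ x in perforated Ω (r ε) ε, inner ℝ (weakGrad (v ε) x) (weakGrad y x)) +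
        0 * (∫ x in perforated Ω (r ε) ε, toFn (v ε) x * toFn y x)
        + α * (∫ x, (t x - gε ε x) * s x ∂(perforatedSurface Ω (r ε) ε)) =
        ∫ x in perforated Ω (r ε) ε, f x * toFn y x := by
    intro ε
    by_cases hε : 0 < ε
    · obtain ⟨t, h1, h2⟩ := hsol ε hε
      exact ⟨t, fun _ => ⟨h1, h2⟩⟩
    · exact ⟨0, fun h => absurd h hε⟩
  choose t ht using hsol'
  obtain ⟨V, Tr, hV, hTr⟩ := exists_traceOperator hΩ
  have htr : ∀ ε > 0, w ε ∈ V ∧ Tr (w ε) =ᵐ[outerSurface Ω] t ε := by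
    intro ε hε
    obtain ⟨t₀, h1, h2⟩ := exists_outer_trace hΩ hε (hr ε hε).2 (hwv ε hε) (ht ε hε).1
    obtain ⟨h3, h4⟩ := (hTr _ _).1 h2
    exact ⟨h3, h4 ▸ h1⟩
  -- The weak limit has a trace because the extensions do and `V` is weakly closed. The boundedness
  -- of `Tr` then gives weak convergence of the boundary values in `T3`.
  have huV : u ∈ V := hu.mem_of_isClosed hV (hpos.mono fun ε hε => (htr ε hε).1)
  have hFm : MemLp (fun x => f x + α * sphereArea N * S / volume.real Ω * hbar) 2
      (volume.restrict Ω) :=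
    hf.add (memLp_restrict_of_continuous hΩ.isBounded continuous_const 2)
  refine isRobinSolution_of_smooth hΩ.isBounded (fun φ hφ => memLp_outerSurface hΩ hφ.continuous)
    hFm hg ((hTr _ _).2 ⟨huV, rfl⟩) fun ζ hζ => ?_
  have hid : ∀ᶠ ε in l, _ := hpos.mono fun ε hε =>
    IsRobinSolution.smooth_identity hΩ hε (hr ε hε).1 (hgε ε hε) (hwv ε hε) (htr ε hε).2
      (ht ε hε).2 hζ
  have hζm : MemLp ζ 2 (volume.restrict Ω) :=
    memLp_restrict_of_continuous hΩ.isBounded hζ.continuous 2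
  have hζν : MemLp ζ 2 (outerSurface Ω) := memLp_outerSurface hΩ hζ.continuous
  have hdm : MemLp (gradient ζ) 2 (volume.restrict Ω) :=
    memLp_restrict_of_continuous hΩ.isBounded (continuous_gradient hζ) 2
  have hD := (tendsto_restrict_inclusions hN hΩ hr hrS).mono_left hl
  have hDm : ∀ᶠ ε in l, MeasurableSet (inclusions Ω (r ε) ε) := hpos.mono fun ε hε =>
    (isCompact_inclusions hΩ.isBounded hε _).measurableSet
  have T1 : Tendsto (fun ε => ∫ x in perforated Ω (r ε) ε,
      inner ℝ (weakGrad (w ε) x) (gradient ζ x)) l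
      (𝓝 (∫ x in Ω, inner ℝ (weakGrad u x) (gradient ζ x))) := by
    refine (tendsto_setIntegral_inner_of_weak (hM.mono fun ε h => (norm_weakGrad_le _).trans h)
      hdm (hu.inner_clm (weakGradCLM Ω) _) hDm hD).congr' ?_
    filter_upwards [hpos] with ε hε
    rw [restrict_perforated hΩ hε]
  have T2 : Tendsto (fun ε => ∫ x in perforated Ω (r ε) ε, f x * ζ x) l
      (𝓝 (∫ x in Ω, f x * ζ x)) := by
    have hi : Integrable (fun x => f x * ζ x) (volume.restrict Ω) := hf.integrable_mul hζm
    have h0 := (tendsto_const_nhds (x := ∫ x in Ω, f x * ζ x)).sub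
      (hi.tendsto_setIntegral_nhds_zero hD)
    rw [sub_zero] at h0
    refine h0.congr' ?_
    filter_upwards [hpos, hDm] with ε hε h1
    rw [← restrict_perforated hΩ hε, ← integral_add_compl h1 hi, add_sub_cancel_left]
  have T3 : Tendsto (fun ε => ∫ x, Tr (w ε) x * ζ x ∂(outerSurface Ω)) l
      (𝓝 (∫ x, Tr u x * ζ x ∂(outerSurface Ω))) := by
    have := hu.inner_clm Tr (hζν.toLp ζ)
    have e : ∀ y : Lp ℝ 2 (outerSurface Ω), inner ℝ y (hζν.toLp ζ) =
        ∫ x, y x * ζ x ∂(outerSurface Ω) := by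
      intro y
      rw [← integral_mul_eq_inner]
      refine integral_congr_ae ?_
      filter_upwards [hζν.coeFn_toLp] with x hx
      rw [hx]
    simpa only [e] using this
  have T4 : Tendsto (fun ε => ∫ x, gε ε x * ζ x ∂(outerSurface Ω)) l
      (𝓝 (∫ x, g x * ζ x ∂(outerSurface Ω))) := by
    refine (tendsto_integral_mul_of_pos (fun ε hε => (hgε ε hε).mono_measure outerSurface_le)
      hg hζν hg_lim).mono_left hl
  have T5 := tendsto_integral_innerSurface_trace hN hΩ hr hrS hl hwv (fun ε hε => (ht ε hε).1)
    hM hu hζ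
  have T6 := (hγ ζ hζ).mono_left hl
  have hlim := eq_of_tendsto_of_eventually_eq hid T1 T3 T4 T5 T6 T2
  have i1 : ∫ x in Ω, (f x + α * sphereArea N * S / volume.real Ω * hbar) * ζ x =
      (∫ x in Ω, f x * ζ x) + α * sphereArea N * S / volume.real Ω * hbar * ∫ x in Ω, ζ x := by
    have := isFiniteMeasure_restrict_of_isBounded hΩ.isBounded
    have j1 : Integrable (fun x => f x * ζ x) (volume.restrict Ω) := hf.integrable_mul hζm
    rw [← integral_const_mul, ← integral_add j1 ((hζm.integrable (by norm_num)).const_mul _)]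
    exact integral_congr_ae (ae_of_all _ fun x => add_mul _ _ _)
  have i2 : ∫ x, (Tr u x - g x) * ζ x ∂(outerSurface Ω) =
      (∫ x, Tr u x * ζ x ∂(outerSurface Ω)) - ∫ x, g x * ζ x ∂(outerSurface Ω) := by
    have j1 : Integrable (fun x => Tr u x * ζ x) (outerSurface Ω) :=
      (Lp.memLp (Tr u)).integrable_mul hζν
    have j2 : Integrable (fun x => g x * ζ x) (outerSurface Ω) := hg.integrable_mul hζν
    rw [← integral_sub j1 j2]
    exact integral_congr_ae (ae_of_all _ fun x => sub_mul _ _ _)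
  rw [i1, i2, ← hlim]
  ring

end Limit

/-! ### Uniqueness and constant shifts -/

section Solutions

variable {N : ℕ} {U : Set (E N)} {ν : Measure (E N)} {k α : ℝ} {F g : E N → ℝ}

theorem IsRobinSolution.congr_data {F' g' : E N → ℝ} {u : H1 U}
    (h : IsRobinSolution U ν k α F g u) (hF : F =ᵐ[volume.restrict U] F') (hg : g =ᵐ[ν] g') :
    IsRobinSolution U ν k α F' g' u := by
  obtain ⟨t, ht, h⟩ := h
  refine ⟨t, ht, fun v s hs => ?_⟩
  have e1 : ∫ x, (t x - g' x) * s x ∂ν = ∫ x, (t x - g x) * s x ∂ν :=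
    integral_congr_ae (by filter_upwards [hg] with x hx; rw [hx])
  have e2 : ∫ x in U, F' x * toFn v x = ∫ x in U, F x * toFn v x :=
    integral_congr_ae (by filter_upwards [hF] with x hx; rw [hx])
  rw [e1, e2]
  exact h v s hs

theorem integral_inner_sub_integral_inner {X F : Type*} [MeasurableSpace X]
    [NormedAddCommGroup F] [InnerProductSpace ℝ F] {μ : Measure X} (a b : Lp F 2 μ) :
    (∫ x, inner ℝ (a x) ((a - b) x) ∂μ) - ∫ x, inner ℝ (b x) ((a - b) x) ∂μ = ‖a - b‖ ^ 2 := by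
  rw [← L2.inner_def, ← L2.inner_def, ← inner_sub_left, real_inner_self_eq_norm_sq]

theorem integral_mul_sub_integral_mul {X : Type*} [MeasurableSpace X] {μ : Measure X}
    (a b : Lp ℝ 2 μ) :
    (∫ x, a x * (a - b) x ∂μ) - ∫ x, b x * (a - b) x ∂μ = ‖a - b‖ ^ 2 := by
  rw [integral_mul_eq_inner, integral_mul_eq_inner, ← inner_sub_left, real_inner_self_eq_norm_sq]

theorem eq_zero_and_eq_zero_of_add_eq_zero {k α a b c : ℝ} (hk : 0 < k) (hα : 0 ≤ α)
    (h : a ^ 2 + k * b ^ 2 + α * c ^ 2 = 0) : b ^ 2 = 0 ∧ a ^ 2 = 0 := by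
  have p1 := mul_nonneg hk.le (sq_nonneg b)
  have p2 := mul_nonneg hα (sq_nonneg c)
  have p3 := sq_nonneg a
  exact ⟨(mul_eq_zero.1 (by linarith : k * b ^ 2 = 0)).resolve_left hk.ne', by linarith⟩

/-- Both problems are tested with the difference of the solutions, which has a trace. Subtraction
leaves a sum of nonnegative terms equal to zero, and `k > 0` makes it control the `H¹` norm. -/
theorem IsRobinSolution.unique (hν : ∀ φ : E N → ℝ, ContDiff ℝ ∞ φ → MemLp φ 2 ν) (hk : 0 < k)
    (hα : 0 ≤ α) (hg : MemLp g 2 ν) {u w : H1 U}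
    (hu : IsRobinSolution U ν k α F g u) (hw : IsRobinSolution U ν k α F g w) : u = w := by
  obtain ⟨t, ht, hu⟩ := hu
  obtain ⟨s, hs, hw⟩ := hw
  have h1 := hu _ _ (ht.sub hν hs)
  have h2 := hw _ _ (ht.sub hν hs)
  have e1 : (∫ x in U, inner ℝ (weakGrad u x) (weakGrad (u - w) x)) -
      ∫ x in U, inner ℝ (weakGrad w x) (weakGrad (u - w) x) = ‖weakGrad (u - w)‖ ^ 2 :=
    integral_inner_sub_integral_inner (weakGrad u) (weakGrad w)
  have e2 : (∫ x in U, toFn u x * toFn (u - w) x) -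
      ∫ x in U, toFn w x * toFn (u - w) x = ‖toFn (u - w)‖ ^ 2 :=
    integral_mul_sub_integral_mul (toFn u) (toFn w)
  have e3 : (∫ x, (t x - g x) * (t - s) x ∂ν) - ∫ x, (s x - g x) * (t - s) x ∂ν =
      ‖t - s‖ ^ 2 := by
    have i : ∀ q : Lp ℝ 2 ν, Integrable (fun x => (q x - g x) * (t - s) x) ν := fun q =>
      ((Lp.memLp q).sub hg).integrable_mul (Lp.memLp _)
    rw [← integral_sub (i _) (i _), ← integral_sq_eq_norm_sq]
    refine integral_congr_ae ?_
    filter_upwards [Lp.coeFn_sub t s] with x hx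
    rw [hx, Pi.sub_apply, Real.norm_eq_abs, sq_abs]
    ring
  have key : ‖weakGrad (u - w)‖ ^ 2 + k * ‖toFn (u - w)‖ ^ 2 + α * ‖t - s‖ ^ 2 = 0 := by
    rw [← e1, ← e2, ← e3]
    linear_combination h1 - h2
  have q := eq_zero_and_eq_zero_of_add_eq_zero hk hα key
  have q3 : ‖u - w‖ ^ 2 = 0 := by rw [H1.norm_sq, q.1, q.2, add_zero]
  exact sub_eq_zero.1 (norm_eq_zero.1 (pow_eq_zero_iff two_ne_zero |>.1 q3))

/-- A constant has zero gradient, so it enters only through the zeroth-order term and cancels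
against the shift of `g` on the boundary. -/
theorem IsRobinSolution.add_const (hU : Bornology.IsBounded U)
    (hν : ∀ φ : E N → ℝ, ContDiff ℝ ∞ φ → MemLp φ 2 ν) (hF : MemLp F 2 (volume.restrict U))
    {u : H1 U} (hu : IsRobinSolution U ν k α F g u) (c : ℝ) :
    IsRobinSolution U ν k α (fun x => F x + k * c) (fun x => g x + c)
      (u + ofSmooth hU (contDiff_const (c := c))) := by
  obtain ⟨t, ht, hu⟩ := hu
  have hc : ContDiff ℝ ∞ fun _ : E N => c := contDiff_const
  refine ⟨_, ht.add hν (hasTrace_ofSmooth hU hc (hν _ hc)), fun v s hs => ?_⟩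
  have e1 : ∫ x in U, inner ℝ (weakGrad (u + ofSmooth hU hc) x) (weakGrad v x) =
      ∫ x in U, inner ℝ (weakGrad u x) (weakGrad v x) := by
    refine integral_congr_ae ?_
    rw [weakGrad_add]
    filter_upwards [Lp.coeFn_add (weakGrad u) (weakGrad (ofSmooth hU hc)),
      weakGrad_ofSmooth hU hc] with x h1 h2
    rw [h1, Pi.add_apply, h2, gradient_const', add_zero]
  have := isFiniteMeasure_restrict_of_isBounded hU
  have i1 := integrableOn_toFn_mul subset_rfl u v
  have i2 : Integrable (toFn v) (volume.restrict U) := (Lp.memLp _).integrable (by norm_num)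
  have i3 : Integrable (fun x => F x * toFn v x) (volume.restrict U) :=
    hF.integrable_mul (Lp.memLp _)
  have e2 : ∫ x in U, toFn (u + ofSmooth hU hc) x * toFn v x =
      (∫ x in U, toFn u x * toFn v x) + c * ∫ x in U, toFn v x := by
    rw [← integral_const_mul, ← integral_add i1 (i2.const_mul c)]
    refine integral_congr_ae ?_
    rw [toFn_add]
    filter_upwards [Lp.coeFn_add (toFn u) (toFn (ofSmooth hU hc)),
      toFn_ofSmooth hU hc] with x h1 h2
    rw [h1, Pi.add_apply, h2, add_mul]
  have e3 : ∫ x, ((t + (hν _ hc).toLp _) x - (g x + c)) * s x ∂ν =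
      ∫ x, (t x - g x) * s x ∂ν := by
    refine integral_congr_ae ?_
    filter_upwards [Lp.coeFn_add t ((hν _ hc).toLp _), (hν _ hc).coeFn_toLp] with x h1 h2
    rw [h1, Pi.add_apply, h2, add_sub_add_right_eq_sub]
  have e4 : ∫ x in U, (F x + k * c) * toFn v x =
      (∫ x in U, F x * toFn v x) + k * c * ∫ x in U, toFn v x := by
    rw [← integral_const_mul, ← integral_add i3 (i2.const_mul _)]
    exact integral_congr_ae (ae_of_all _ fun x => add_mul _ _ _)
  rw [e1, e2, e3, e4, ← hu v s hs]
  ring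

end Solutions

/-! ### Weak compactness -/

/-- The theorem of Banach and Alaoglu in the dual, transported to the space by the Riesz
isomorphism. -/
theorem exists_weaklyTendsto_of_bounded {ι H : Type*} [NormedAddCommGroup H]
    [InnerProductSpace ℝ H] [CompleteSpace H] (l : Ultrafilter ι) {w : ι → H} {M : ℝ}
    (h : ∀ᶠ i in l, ‖w i‖ ≤ M) : ∃ u, WeaklyTendsto w l u := by
  let J : H → WeakDual ℝ H := fun x => StrongDual.toWeakDual (InnerProductSpace.toDual ℝ H x)
  have hc := WeakDual.isCompact_closedBall (𝕜 := ℝ) (E := H) 0 M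
  obtain ⟨x, -, hx⟩ := hc.ultrafilter_le_nhds (l.map fun i => J (w i)) (by
    rw [le_principal_iff]
    refine mem_map.2 ?_
    filter_upwards [h] with i hi
    change _ ∈ Metric.closedBall _ _
    rw [mem_closedBall_zero_iff]
    simpa [J] using hi)
  refine ⟨(InnerProductSpace.toDual ℝ H).symm (WeakDual.toStrongDual x), fun L => ?_⟩
  have h1 : Tendsto (fun i => J (w i)) l (𝓝 x) := hx
  have h2 := ((WeakDual.eval_continuous ((InnerProductSpace.toDual ℝ H).symm L)).tendsto x).comp h1
  have e1 : ∀ y, L y = inner ℝ y ((InnerProductSpace.toDual ℝ H).symm L) := fun y => by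
    rw [real_inner_comm, InnerProductSpace.toDual_symm_apply]
  rw [e1, InnerProductSpace.toDual_symm_apply]
  refine h2.congr fun i => ?_
  rw [e1]
  rfl

/-! ### The a priori bound -/

/-- In the application `n` and `G` are the norms of the solution and its gradient, `x` its `H¹`
norm, `y` the norm of its extension, `I` the surface integral and `A` the annulus integral of the
square, the latter with its weight. Only the fraction `δ` of the surface term is used, so that the
cross term `2 δ n G` can be absorbed. Of the coefficient `δ κ / 2` of `n²` this costs `δ κ / 4` and
the annulus error `δ κ / 8`. Of the coefficient `1` of `G²` they cost `1 / 2` and `1 / 4`. The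
remainders form the minimum. -/
theorem le_of_coercive {α κ κ' η C n G I A W F K x y δ : ℝ} (hF : 0 ≤ F) (hK : 0 ≤ K)
    (hδ : 0 < δ) (hδα : δ ≤ α / 2) (hδκ : 8 * δ ≤ κ) (hκ : κ / 2 ≤ κ') (hη0 : 0 ≤ η)
    (hη : η * C ^ 2 ≤ κ / 8) (hη' : δ * (η * C ^ 2) ≤ 1 / 4) (hI : 0 ≤ I)
    (hx : 0 ≤ x) (hy0 : 0 ≤ y) (hxn : x ^ 2 = n ^ 2 + G ^ 2) (hy : y ≤ C * x)
    (hW : n ^ 2 ≤ W) (h1 : G ^ 2 + α / 2 * I ≤ F * n + K)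
    (h2 : |I - A| ≤ 2 * (n * G)) (h3 : |A - κ' * W| ≤ η * y ^ 2) :
    x ≤ max 1 ((F + K) / min (δ * κ / 8) (1 / 4)) := by
  have hκ0 : 0 < κ := by linarith
  have hnx : n ≤ x := by nlinarith [sq_nonneg G]
  have h4 := (abs_le.1 h2).1
  have h5 := (abs_le.1 h3).1
  have h6 : κ / 2 * n ^ 2 ≤ κ' * W := mul_le_mul hκ hW (sq_nonneg _) (by linarith)
  have h7 : η * y ^ 2 ≤ η * C ^ 2 * (n ^ 2 + G ^ 2) := by
    rw [mul_assoc, ← hxn, ← mul_pow]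
    exact mul_le_mul_of_nonneg_left (pow_le_pow_left₀ hy0 hy 2) hη0
  have h8 : κ / 2 * n ^ 2 - η * C ^ 2 * (n ^ 2 + G ^ 2) - 2 * (n * G) ≤ I := by linarith
  have h9 : δ * I ≤ α / 2 * I := mul_le_mul_of_nonneg_right hδα hI
  have h10 := mul_le_mul_of_nonneg_left h8 hδ.le
  have h11 : δ * (2 * (n * G)) ≤ G ^ 2 / 2 + 2 * (δ * δ) * n ^ 2 := by
    nlinarith [sq_nonneg (G - 2 * δ * n)]
  have h12 : 2 * (δ * δ) * n ^ 2 ≤ δ * κ / 4 * n ^ 2 := by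
    refine mul_le_mul_of_nonneg_right ?_ (sq_nonneg _)
    nlinarith
  have h13 : δ * (η * C ^ 2) * n ^ 2 ≤ δ * κ / 8 * n ^ 2 := by
    refine mul_le_mul_of_nonneg_right ?_ (sq_nonneg _)
    nlinarith
  have h14 : δ * (η * C ^ 2) * G ^ 2 ≤ 1 / 4 * G ^ 2 :=
    mul_le_mul_of_nonneg_right hη' (sq_nonneg _)
  set m := min (δ * κ / 8) (1 / 4)
  have hm : 0 < m := lt_min (by positivity) (by norm_num)
  have h15 : m * n ^ 2 ≤ δ * κ / 8 * n ^ 2 :=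
    mul_le_mul_of_nonneg_right (min_le_left _ _) (sq_nonneg _)
  have h16 : m * G ^ 2 ≤ 1 / 4 * G ^ 2 :=
    mul_le_mul_of_nonneg_right (min_le_right _ _) (sq_nonneg _)
  have h17 : m * x ^ 2 ≤ F * n + K := by
    rw [hxn]
    linarith
  -- The inequality `m x² ≤ F x + K` is linearized by treating `x ≤ 1` separately. For `x > 1` one
  -- has `K ≤ K x`, and `x` cancels.
  rcases le_or_gt x 1 with h | h
  · exact h.trans (le_max_left _ _)
  · refine le_max_of_le_right ((le_div_iff₀ hm).2 ?_)
    have h18 : F * n ≤ F * x := mul_le_mul_of_nonneg_left hnx hF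
    have h19 : K ≤ K * x := le_mul_of_one_le_right hK h.le
    have h20 : (x * m) * x ≤ (F + K) * x := by
      calc (x * m) * x = m * x ^ 2 := by ring
        _ ≤ _ := by linarith
    exact le_of_mul_le_mul_right h20 (by linarith)

theorem tendsto_integral_sq_of_pos {X : Type*} [MeasurableSpace X] {μ : Measure X}
    {G : ℝ → X → ℝ} {g : X → ℝ} (hG : ∀ ε > 0, MemLp (G ε) 2 μ) (hg : MemLp g 2 μ)
    (h : Tendsto (fun ε => eLpNorm (fun x => G ε x - g x) 2 μ) (𝓝[>] 0) (𝓝 0)) :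
    Tendsto (fun ε => ∫ x, G ε x ^ 2 ∂μ) (𝓝[>] 0) (𝓝 (∫ x, g x ^ 2 ∂μ)) := by
  classical
  have h1 : Tendsto (fun ε => eLpNorm ((if 0 < ε then G ε else g) - g) 2 μ) (𝓝[>] 0) (𝓝 0) := by
    refine h.congr' ?_
    filter_upwards [self_mem_nhdsWithin] with ε hε
    rw [if_pos (show 0 < ε from hε)]
    rfl
  have h0 : ∀ ε, MemLp (if 0 < ε then G ε else g) 2 μ := fun ε => by
    split_ifs with h; exacts [hG ε h, hg]
  have h2 := tendsto_integral_mul h0 h0 hg hg h1 h1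
  simp only [← pow_two] at h2
  refine h2.congr' ?_
  filter_upwards [self_mem_nhdsWithin] with ε hε
  rw [if_pos (show 0 < ε from hε)]

/-! ### Boundedness and convergence of the whole family -/

section Convergence

variable {N : ℕ} {Ω : Set (E N)} {r : ℝ → ℝ} {S : ℝ}

theorem norm_toLp_mono_measure {X : Type*} [MeasurableSpace X] {μ ν : Measure X} {f : X → ℝ}
    (hf : MemLp f 2 μ) (hν : ν ≤ μ) : ‖(hf.mono_measure hν).toLp f‖ ≤ ‖hf.toLp f‖ := by
  rw [Lp.norm_toLp, Lp.norm_toLp]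
  exact ENNReal.toReal_mono hf.2.ne (eLpNorm_mono_measure f hν)

/-- This is the weak formulation tested with the solution itself. On the boundary `(t - g) t ≥ (t² -
g²) / 2`, and the nonnegative contribution of `t²` on `∂Ω` is dropped. -/
theorem IsRobinSolution.energy_le {ρ ε α : ℝ} (hα : 0 ≤ α) {f g : E N → ℝ}
    (hf : MemLp f 2 (volume.restrict Ω)) (hg : MemLp g 2 (perforatedSurface Ω ρ ε))
    {v : H1 (perforated Ω ρ ε)} {t : Lp ℝ 2 (perforatedSurface Ω ρ ε)}
    (h : (∫ x in perforated Ω ρ ε, inner ℝ (weakGrad v x) (weakGrad v x)) +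
        0 * (∫ x in perforated Ω ρ ε, toFn v x * toFn v x)
        + α * (∫ x, (t x - g x) * t x ∂(perforatedSurface Ω ρ ε)) =
        ∫ x in perforated Ω ρ ε, f x * toFn v x) :
    ‖weakGrad v‖ ^ 2 + α / 2 * ∫ x, t x ^ 2 ∂(innerSurface Ω ρ ε) ≤
      ‖hf.toLp f‖ * ‖toFn v‖ + α / 2 * ((∫ x, g x ^ 2 ∂(outerSurface Ω)) +
        ∫ x, g x ^ 2 ∂(innerSurface Ω ρ ε)) := by
  have hle : volume.restrict (perforated Ω ρ ε) ≤ volume.restrict Ω :=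
    Measure.restrict_mono sdiff_subset le_rfl
  have e1 : ∫ x in perforated Ω ρ ε, inner ℝ (weakGrad v x) (weakGrad v x) = ‖weakGrad v‖ ^ 2 := by
    rw [← L2.inner_def, real_inner_self_eq_norm_sq]
  have e2 : ∫ x in perforated Ω ρ ε, f x * toFn v x ≤ ‖hf.toLp f‖ * ‖toFn v‖ := by
    have : ∫ x in perforated Ω ρ ε, f x * toFn v x =
        inner ℝ ((hf.mono_measure hle).toLp f) (toFn v) := by
      rw [← integral_mul_eq_inner]
      refine integral_congr_ae ?_
      filter_upwards [(hf.mono_measure hle).coeFn_toLp] with x hx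
      rw [hx]
    rw [this]
    exact (real_inner_le_norm _ _).trans
      (mul_le_mul_of_nonneg_right (norm_toLp_mono_measure hf hle) (norm_nonneg _))
  have it : Integrable (fun x => t x ^ 2) (perforatedSurface Ω ρ ε) := (Lp.memLp t).integrable_sq
  have ig : Integrable (fun x => g x ^ 2) (perforatedSurface Ω ρ ε) := hg.integrable_sq
  have im : Integrable (fun x => (t x - g x) * t x) (perforatedSurface Ω ρ ε) :=
    ((Lp.memLp t).sub hg).integrable_mul (Lp.memLp t)
  have e3 : 1 / 2 * (∫ x, t x ^ 2 ∂(perforatedSurface Ω ρ ε)) -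
      1 / 2 * ∫ x, g x ^ 2 ∂(perforatedSurface Ω ρ ε) ≤
      ∫ x, (t x - g x) * t x ∂(perforatedSurface Ω ρ ε) := by
    rw [← integral_const_mul, ← integral_const_mul,
      ← integral_sub (it.const_mul _) (ig.const_mul _)]
    refine integral_mono ((it.const_mul _).sub (ig.const_mul _)) im fun x => ?_
    change 1 / 2 * t x ^ 2 - 1 / 2 * g x ^ 2 ≤ (t x - g x) * t x
    nlinarith [sq_nonneg (t x - g x)]
  have e4 : ∫ x, t x ^ 2 ∂(innerSurface Ω ρ ε) ≤ ∫ x, t x ^ 2 ∂(perforatedSurface Ω ρ ε) :=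
    integral_mono_measure innerSurface_le (ae_of_all _ fun x => sq_nonneg _) it
  have e5 : ∫ x, g x ^ 2 ∂(perforatedSurface Ω ρ ε) =
      (∫ x, g x ^ 2 ∂(outerSurface Ω)) + ∫ x, g x ^ 2 ∂(innerSurface Ω ρ ε) :=
    integral_add_measure (ig.mono_measure outerSurface_le) (ig.mono_measure innerSurface_le)
  rw [e1, zero_mul, add_zero] at h
  rw [← e5]
  have e6 := mul_le_mul_of_nonneg_left e3 hα
  have e7 := mul_le_mul_of_nonneg_left e4 (by linarith : 0 ≤ α / 2)
  linarith

set_option maxHeartbeats 1000000 in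
theorem exists_norm_le (hN : 1 ≤ N) (hΩ : IsSmoothBoundedDomain Ω)
    (hr : ∀ ε > 0, 0 < r ε ∧ r ε < ε) (hS : 0 < S)
    (hrS : Tendsto (fun ε => ((centres Ω ε).ncard : ℝ) * r ε ^ (N - 1)) (𝓝[>] 0) (𝓝 S))
    {α : ℝ} (hα : 0 < α) {f : E N → ℝ} (hf : MemLp f 2 (volume.restrict Ω))
    {gε : ℝ → E N → ℝ} (hgε : ∀ ε > 0, MemLp (gε ε) 2 (perforatedSurface Ω (r ε) ε))
    {g : E N → ℝ} (hg : MemLp g 2 (outerSurface Ω))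
    (hg_lim : Tendsto (fun ε => eLpNorm (fun x => gε ε x - g x) 2 (outerSurface Ω))
      (𝓝[>] 0) (𝓝 0))
    {K : ℝ} (hK : ∀ᶠ ε in 𝓝[>] (0 : ℝ), ∫ x, gε ε x ^ 2 ∂(innerSurface Ω (r ε) ε) ≤ K)
    {T : ∀ ε : ℝ, H1 (perforated Ω (r ε) ε) →L[ℝ] H1 Ω} (hT : IsExtensionFamily Ω r T)
    {v : ∀ ε, H1 (perforated Ω (r ε) ε)}
    (hsol : ∀ ε > 0, IsRobinSolution (perforated Ω (r ε) ε) (perforatedSurface Ω (r ε) ε) 0 α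
        f (gε ε) (v ε)) :
    ∃ M : ℝ, ∀ᶠ ε in 𝓝[>] (0 : ℝ), ‖T ε (v ε)‖ ≤ M := by
  obtain ⟨hT1, C, hC⟩ := hT
  set κ := sphereArea N * S / volume.real Ω with hκdef
  have hκ : 0 < κ := div_pos (mul_pos (sphereArea_pos hN) hS) (volume_real_pos hΩ)
  set δ := min (α / 2) (κ / 8) with hδdef
  have hδ : 0 < δ := by positivity
  -- The annulus error is measured in the norm of the extension, at most `C` times that of the
  -- solution. Both smallness conditions of `le_of_coercive` are conditions on `η * C ^ 2`.
  set η := min (κ / 8) (1 / (4 * δ)) / (C ^ 2 + 1) with hηdef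
  have hη : 0 < η := by positivity
  have hηC : η * C ^ 2 ≤ min (κ / 8) (1 / (4 * δ)) := by
    rw [hηdef, div_mul_eq_mul_div, div_le_iff₀ (by positivity)]
    refine mul_le_mul_of_nonneg_left (by linarith) (by positivity)
  have hη1 : η * C ^ 2 ≤ κ / 8 := hηC.trans (min_le_left _ _)
  have hη2 : δ * (η * C ^ 2) ≤ 1 / 4 := by
    calc δ * (η * C ^ 2) ≤ δ * (1 / (4 * δ)) :=
          mul_le_mul_of_nonneg_left (hηC.trans (min_le_right _ _)) hδ.le
      _ = 1 / 4 := by field_simp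
  have hgo := tendsto_integral_sq_of_pos (fun ε hε => (hgε ε hε).mono_measure outerSurface_le)
    hg hg_lim
  set K' := α / 2 * (((∫ x, g x ^ 2 ∂(outerSurface Ω)) + 1) + max K 0)
  have hK' : 0 ≤ K' := by
    have : 0 ≤ ∫ x, g x ^ 2 ∂(outerSurface Ω) := integral_nonneg fun _ => sq_nonneg _
    positivity
  refine ⟨C * max 1 ((‖hf.toLp f‖ + K') / min (δ * κ / 8) (1 / 4)), ?_⟩
  filter_upwards [self_mem_nhdsWithin, hC, hK, hgo.eventually_le_const (lt_add_one _),
    eventually_lt_half hN hΩ hrS, eventually_abs_annuli_sub_le hN hΩ hr hrS hη,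
    (tendsto_cellDensity hN hΩ hrS).eventually_const_le (half_lt_self hκ)]
    with ε hε hCε hKε hgoε hh hann hcell
  have hε : 0 < ε := hε
  obtain ⟨t, ht, hs⟩ := hsol ε hε
  have hwv := hT1 ε hε (v ε)
  have hTv : ‖T ε (v ε)‖ ≤ C * ‖v ε‖ := (T ε).le_of_opNorm_le hCε _
  have hC0 : 0 ≤ C := (ContinuousLinearMap.opNorm_nonneg (T ε)).trans hCε
  refine hTv.trans (mul_le_mul_of_nonneg_left ?_ hC0)
  obtain ⟨t₀, -, ht₀⟩ := exists_outer_trace hΩ hε (hr ε hε).2 hwv ht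
  have b1 := IsRobinSolution.energy_le hα.le hf (hgε ε hε) (hs _ _ ht)
  have b2 := ht.abs_innerSurface_sq_sub_le hN hΩ (hr ε hε).1 hh
  have b3 := hann _ _ ht₀
  have hA := centreAnnuli_subset_perforated (Ω := Ω) hε hh
  have e : ∫ x in centreAnnuli Ω ε, toFn (T ε (v ε)) x ^ 2 =
      ∫ x in centreAnnuli Ω ε, toFn (v ε) x ^ 2 := by
    refine integral_congr_ae ?_
    filter_upwards [hwv.filter_mono (ae_mono (Measure.restrict_mono hA le_rfl))] with x hx
    rw [hx]
  rw [e] at b3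
  have b4 : ‖toFn (v ε)‖ ^ 2 ≤ ∫ x in Ω, toFn (T ε (v ε)) x ^ 2 := by
    rw [← integral_sq_eq_norm_sq]
    have hle : volume.restrict (perforated Ω (r ε) ε) ≤ volume.restrict Ω :=
      Measure.restrict_mono sdiff_subset le_rfl
    calc ∫ x in perforated Ω (r ε) ε, ‖toFn (v ε) x‖ ^ 2 =
          ∫ x in perforated Ω (r ε) ε, toFn (T ε (v ε)) x ^ 2 :=
          integral_congr_ae (by
            filter_upwards [hwv] with x hx
            rw [hx, Real.norm_eq_abs, sq_abs])
      _ ≤ _ := integral_mono_measure hle (ae_of_all _ fun _ => sq_nonneg _)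
          (Lp.memLp _).integrable_sq
  refine le_of_coercive (norm_nonneg _) hK' hδ (min_le_left _ _) ?_ hcell hη.le hη1 hη2
    (integral_nonneg fun _ => sq_nonneg _) (norm_nonneg _) (norm_nonneg _) (H1.norm_sq _) hTv b4
    (b1.trans ?_) b2 b3
  · have := min_le_right (α / 2) (κ / 8)
    linarith
  · refine add_le_add_right (mul_le_mul_of_nonneg_left ?_ (by linarith)) _
    exact add_le_add hgoε (hKε.trans (le_max_left _ _))

set_option maxHeartbeats 1000000 in
theorem exists_weaklyTendsto_solution (hN : 1 ≤ N) (hΩ : IsSmoothBoundedDomain Ω)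
    (hr : ∀ ε > 0, 0 < r ε ∧ r ε < ε) (hS : 0 < S)
    (hrS : Tendsto (fun ε => ((centres Ω ε).ncard : ℝ) * r ε ^ (N - 1)) (𝓝[>] 0) (𝓝 S))
    {α hbar : ℝ} (hα : 0 < α) {f : E N → ℝ} (hf : MemLp f 2 (volume.restrict Ω))
    {gε : ℝ → E N → ℝ} (hgε : ∀ ε > 0, MemLp (gε ε) 2 (perforatedSurface Ω (r ε) ε))
    {g : E N → ℝ} (hg : MemLp g 2 (outerSurface Ω))
    (hg_lim : Tendsto (fun ε => eLpNorm (fun x => gε ε x - g x) 2 (outerSurface Ω))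
      (𝓝[>] 0) (𝓝 0))
    {K : ℝ} (hK : ∀ᶠ ε in 𝓝[>] (0 : ℝ), ∫ x, gε ε x ^ 2 ∂(innerSurface Ω (r ε) ε) ≤ K)
    (hγ : ∀ ζ : E N → ℝ, ContDiff ℝ ∞ ζ →
      Tendsto (fun ε => α * ∫ x, gε ε x * ζ x ∂(innerSurface Ω (r ε) ε)) (𝓝[>] 0)
        (𝓝 (α * sphereArea N * S / volume.real Ω * hbar * ∫ x in Ω, ζ x)))
    {T : ∀ ε : ℝ, H1 (perforated Ω (r ε) ε) →L[ℝ] H1 Ω} (hT : IsExtensionFamily Ω r T)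
    {v : ∀ ε, H1 (perforated Ω (r ε) ε)}
    (hsol : ∀ ε > 0, IsRobinSolution (perforated Ω (r ε) ε) (perforatedSurface Ω (r ε) ε) 0 α
        f (gε ε) (v ε)) :
    ∃ u : H1 Ω, WeaklyTendsto (fun ε => T ε (v ε)) (𝓝[>] 0) u ∧
      IsRobinSolution Ω (outerSurface Ω) (α * sphereArea N * S / volume.real Ω) α
        (fun x => f x + α * sphereArea N * S / volume.real Ω * hbar) g u := by
  obtain ⟨M, hM⟩ := exists_norm_le hN hΩ hr hS hrS hα hf hgε hg hg_lim hK hT hsol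
  have hk : 0 < α * sphereArea N * S / volume.real Ω :=
    div_pos (mul_pos (mul_pos hα (sphereArea_pos hN)) hS) (volume_real_pos hΩ)
  -- Bounded families converge weakly along ultrafilters, so no subsequences have to be extracted.
  -- Uniqueness makes all these limits equal, and convergence along all finer ultrafilters is
  -- convergence along the filter.
  have key : ∀ l : Ultrafilter ℝ, (l : Filter ℝ) ≤ 𝓝[>] 0 →
      ∃ u : H1 Ω, WeaklyTendsto (fun ε => T ε (v ε)) l u ∧
        IsRobinSolution Ω (outerSurface Ω) (α * sphereArea N * S / volume.real Ω) α
          (fun x => f x + α * sphereArea N * S / volume.real Ω * hbar) g u := by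
    intro l hl
    obtain ⟨u, hu⟩ := exists_weaklyTendsto_of_bounded l (hM.filter_mono hl)
    exact ⟨u, hu, isRobinSolution_of_weaklyTendsto hN hΩ hr hrS hf hgε hg hg_lim hγ hl
      (fun ε hε => hT.1 ε hε (v ε)) hsol (hM.filter_mono hl) hu⟩
  obtain ⟨u, -, hu⟩ := key (Ultrafilter.of (𝓝[>] 0)) (Ultrafilter.of_le _)
  refine ⟨u, fun L => (tendsto_iff_ultrafilter _ _ _).2 fun l hl => ?_, hu⟩
  obtain ⟨u', h1, h2⟩ := key l hl
  rw [hu.unique (fun φ hφ => memLp_outerSurface hΩ hφ.continuous) hk hα.le hg h2]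
  exact h1 L

end Convergence

/-! ### Sequences and constant data -/

section Data

variable {N : ℕ} {Ω : Set (E N)} {r : ℝ → ℝ} {S : ℝ}

/-- The uniform boundedness principle. It supplies the norm bound for a weak limit along a sequence,
where `α = 0` is allowed and no a priori estimate is at hand. -/
theorem exists_norm_le_of_weaklyTendsto {H : Type*} [NormedAddCommGroup H]
    [InnerProductSpace ℝ H] [CompleteSpace H] {w : ℕ → H} {u : H}
    (h : WeaklyTendsto w atTop u) : ∃ M, ∀ n, ‖w n‖ ≤ M := by
  obtain ⟨M, hM⟩ := banach_steinhaus (g := fun n => innerSL ℝ (w n)) fun x => by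
    obtain ⟨C, hC⟩ := (Metric.isBounded_range_of_tendsto _ (h (innerSL ℝ x))).exists_norm_le
    refine ⟨C, fun n => ?_⟩
    have := hC _ (mem_range_self n)
    rwa [innerSL_apply_apply, real_inner_comm] at this
  exact ⟨M, fun n => by simpa using hM n⟩

theorem tendsto_mul_integral_innerSurface_data (hN : 1 ≤ N) (hΩ : IsSmoothBoundedDomain Ω)
    (hr : ∀ ε > 0, 0 < r ε ∧ r ε < ε)
    (hrS : Tendsto (fun ε => ((centres Ω ε).ncard : ℝ) * r ε ^ (N - 1)) (𝓝[>] 0) (𝓝 S))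
    {α : ℝ} (hα : 0 ≤ α) {gε : ℝ → E N → ℝ}
    (hgε : ∀ ε > 0, MemLp (gε ε) 2 (perforatedSurface Ω (r ε) ε))
    (hg_bdd : ∃ C : ℝ≥0, ∀ᶠ ε in 𝓝[>] (0 : ℝ),
      ENNReal.ofReal α * eLpNorm (gε ε) 2 (innerSurface Ω (r ε) ε) ≤ C)
    {h : ℝ → Metric.sphere (0 : E N) 1 → ℝ}
    (hgh : ∀ ε > 0, ∀ x ∈ centres Ω ε, ∀ᵐ m : Metric.sphere (0 : E N) 1 ∂(sphereMeasure N),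
      gε ε (x + r ε • (m : E N)) = h ε m)
    {hbar : ℝ}
    (hhbar : Tendsto (fun ε => (1 / sphereArea N) * ∫ m, h ε m ∂(sphereMeasure N))
      (𝓝[>] 0) (𝓝 hbar)) {ζ : E N → ℝ} (hζ : ContDiff ℝ ∞ ζ) :
    Tendsto (fun ε => α * ∫ x, gε ε x * ζ x ∂(innerSurface Ω (r ε) ε)) (𝓝[>] 0)
      (𝓝 (α * sphereArea N * S / volume.real Ω * hbar * ∫ x in Ω, ζ x)) := by
  rcases hα.eq_or_lt with rfl | hα
  · simp
  · have := (tendsto_integral_innerSurface_data hN hΩ hr hrS hα hgε hg_bdd hgh hhbar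
      hζ.continuous).const_mul α
    simp only [mul_comm (ζ _)] at this
    convert this using 2
    ring

theorem eventually_centres_nonempty (hS : 0 < S)
    (hrS : Tendsto (fun ε => ((centres Ω ε).ncard : ℝ) * r ε ^ (N - 1)) (𝓝[>] 0) (𝓝 S)) :
    ∀ᶠ ε in 𝓝[>] (0 : ℝ), (centres Ω ε).Nonempty := by
  filter_upwards [hrS.eventually_const_lt hS] with ε h
  rw [nonempty_iff_ne_empty]
  intro h0
  rw [h0] at h
  simp at h

theorem eq_of_data_const (hN : 1 ≤ N) (hΩ : IsSmoothBoundedDomain Ω)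
    (hr : ∀ ε > 0, 0 < r ε ∧ r ε < ε) (hS : 0 < S)
    (hrS : Tendsto (fun ε => ((centres Ω ε).ncard : ℝ) * r ε ^ (N - 1)) (𝓝[>] 0) (𝓝 S))
    {gε : ℝ → E N → ℝ} {h : ℝ → Metric.sphere (0 : E N) 1 → ℝ}
    (hgh : ∀ ε > 0, ∀ x ∈ centres Ω ε, ∀ᵐ m : Metric.sphere (0 : E N) 1 ∂(sphereMeasure N),
      gε ε (x + r ε • (m : E N)) = h ε m)
    {hbar : ℝ}
    (hhbar : Tendsto (fun ε => (1 / sphereArea N) * ∫ m, h ε m ∂(sphereMeasure N))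
      (𝓝[>] 0) (𝓝 hbar)) {c : ℝ}
    (hc : ∀ ε > 0, gε ε =ᵐ[perforatedSurface Ω (r ε) ε] fun _ => c) : hbar = c := by
  refine tendsto_nhds_unique (hhbar.congr' ?_) tendsto_const_nhds
  -- The data on the unit sphere are tied to `gε` only through an inclusion. One exists for small
  -- `ε`, since `S > 0` excludes an empty set of centres.
  filter_upwards [self_mem_nhdsWithin, eventually_centres_nonempty hS hrS] with ε hε hne
  obtain ⟨a, ha⟩ := hne
  have h1 : ∀ᵐ x ∂(innerSurface Ω (r ε) ε), gε ε x = c :=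
    (hc ε hε).filter_mono (ae_mono innerSurface_le)
  have h2 := (ae_innerSurface_iff hΩ.isBounded hε (hr ε hε).1).1 h1 a ha
  have h3 : ∫ m, h ε m ∂(sphereMeasure N) = ∫ _, c ∂(sphereMeasure N) := by
    refine integral_congr_ae ?_
    filter_upwards [h2, hgh ε hε a ha] with m h4 h5
    rw [← h5, h4]
  have h4 := (sphereArea_pos hN).ne'
  rw [h3, integral_const, smul_eq_mul, ← sphereArea]
  field_simp

theorem ae_eq_of_data_const {gε : ℝ → E N → ℝ} {g : E N → ℝ}
    (hg : MemLp g 2 (outerSurface Ω))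
    (hg_lim : Tendsto (fun ε => eLpNorm (fun x => gε ε x - g x) 2 (outerSurface Ω))
      (𝓝[>] 0) (𝓝 0)) {c : ℝ}
    (hc : ∀ ε > 0, gε ε =ᵐ[perforatedSurface Ω (r ε) ε] fun _ => c) :
    g =ᵐ[outerSurface Ω] fun _ => c := by
  have h1 : eLpNorm (fun x => c - g x) 2 (outerSurface Ω) = 0 := by
    refine tendsto_nhds_unique tendsto_const_nhds (hg_lim.congr' ?_)
    filter_upwards [self_mem_nhdsWithin] with ε hε
    refine eLpNorm_congr_ae ?_
    filter_upwards [(hc ε hε).filter_mono (ae_mono outerSurface_le)] with x hx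
    rw [hx]
  have hm : AEStronglyMeasurable (fun x => c - g x) (outerSurface Ω) :=
    aestronglyMeasurable_const.sub hg.1
  filter_upwards [(eLpNorm_eq_zero_iff hm (by norm_num)).1 h1] with x hx
  exact (sub_eq_zero.1 hx).symm

/-- Subtracting a constant from the solution in the perforated domain. -/
theorem IsRobinSolution.sub_const_perforated (hΩ : IsSmoothBoundedDomain Ω) {ρ ε α c : ℝ}
    (hε : 0 < ε) (hρ : 0 < ρ) {f g : E N → ℝ} (hf : MemLp f 2 (volume.restrict Ω))
    (hc : g =ᵐ[perforatedSurface Ω ρ ε] fun _ => c) {u v : H1 (perforated Ω ρ ε)}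
    (huv : toFn v =ᵐ[volume.restrict (perforated Ω ρ ε)] fun x => toFn u x - c)
    (hu : IsRobinSolution (perforated Ω ρ ε) (perforatedSurface Ω ρ ε) 0 α f g u) :
    IsRobinSolution (perforated Ω ρ ε) (perforatedSurface Ω ρ ε) 0 α f (fun _ => 0) v := by
  have hb := isBounded_perforated (ρ := ρ) (ε := ε) hΩ.isBounded
  have h1 := (hu.add_const hb (fun φ hφ => memLp_perforatedSurface hΩ hε hρ hφ.continuous)
    (hf.mono_measure (Measure.restrict_mono sdiff_subset le_rfl)) (-c)).congr_data
    (F' := f) (g' := fun _ => 0) (ae_of_all _ fun x => by simp)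
    (by filter_upwards [hc] with x hx; rw [hx, add_neg_cancel])
  have h2 : v = u + ofSmooth hb (contDiff_const (c := -c)) := by
    refine H1.eq_of_ae_eq (isOpen_perforated hΩ hε) ?_
    rw [toFn_add]
    filter_upwards [huv, Lp.coeFn_add (toFn u) (toFn (ofSmooth hb (contDiff_const (c := -c)))),
      toFn_ofSmooth hb (contDiff_const (c := -c))] with x h3 h4 h5
    rw [h3, h4, Pi.add_apply, h5, sub_eq_add_neg]
  rw [h2]
  exact h1

/-- The limit of the homogeneous problems, and its relation to the problem with constant data. -/
theorem exists_weaklyTendsto_homogeneous (hN : 1 ≤ N) (hΩ : IsSmoothBoundedDomain Ω)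
    (hr : ∀ ε > 0, 0 < r ε ∧ r ε < ε) (hS : 0 < S)
    (hrS : Tendsto (fun ε => ((centres Ω ε).ncard : ℝ) * r ε ^ (N - 1)) (𝓝[>] 0) (𝓝 S))
    {α c : ℝ} (hα : 0 < α) {f g : E N → ℝ} (hf : MemLp f 2 (volume.restrict Ω))
    (hg : MemLp g 2 (outerSurface Ω)) (hgc : g =ᵐ[outerSurface Ω] fun _ => c)
    {T : ∀ ε : ℝ, H1 (perforated Ω (r ε) ε) →L[ℝ] H1 Ω} (hT : IsExtensionFamily Ω r T)
    {v : ∀ ε, H1 (perforated Ω (r ε) ε)}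
    (hv : ∀ ε > 0, IsRobinSolution (perforated Ω (r ε) ε) (perforatedSurface Ω (r ε) ε) 0 α
        f (fun _ => 0) (v ε)) {u : H1 Ω}
    (hu : IsRobinSolution Ω (outerSurface Ω) (α * sphereArea N * S / volume.real Ω) α
      (fun x => f x + α * sphereArea N * S / volume.real Ω * c) g u) :
    ∃ v₀ : H1 Ω, WeaklyTendsto (fun ε => T ε (v ε)) (𝓝[>] 0) v₀ ∧
      IsRobinSolution Ω (outerSurface Ω) (α * sphereArea N * S / volume.real Ω) α
        f (fun _ => 0) v₀ ∧
      toFn u =ᵐ[volume.restrict Ω] fun x => toFn v₀ x + c := by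
  have hν : ∀ φ : E N → ℝ, ContDiff ℝ ∞ φ → MemLp φ 2 (outerSurface Ω) := fun φ hφ =>
    memLp_outerSurface hΩ hφ.continuous
  have hk : 0 < α * sphereArea N * S / volume.real Ω :=
    div_pos (mul_pos (mul_pos hα (sphereArea_pos hN)) hS) (volume_real_pos hΩ)
  -- The homogeneous problem is the general one with zero boundary data and zero mean, so the
  -- convergence already proved applies.
  obtain ⟨v₀, hvw, hvs⟩ := exists_weaklyTendsto_solution (gε := fun _ _ => 0) (g := fun _ => 0)
    (hbar := 0) (K := 0) hN hΩ hr hS hrS hα hf (fun _ _ => MemLp.zero) MemLp.zero (by simp)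
    (by simp) (by simp) hT hv
  have hvs' := hvs.congr_data (F' := f) (ae_of_all _ fun x => by simp) (ae_eq_refl _)
  refine ⟨v₀, hvw, hvs', ?_⟩
  have h1 := (hvs'.add_const hΩ.isBounded hν hf c).congr_data (g' := g) (ae_eq_refl _)
    (by filter_upwards [hgc] with x hx; rw [hx, zero_add])
  rw [hu.unique hν hk hα.le hg h1, toFn_add]
  filter_upwards [Lp.coeFn_add (toFn v₀) (toFn (ofSmooth hΩ.isBounded
    (contDiff_const (c := c)))), toFn_ofSmooth hΩ.isBounded (contDiff_const (c := c))]
    with x h2 h3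
  rw [h2, Pi.add_apply, h3]

end Data

end RobinHom

/-! ### Assembly of the four assertions. -/

set_option maxHeartbeats 1000000 in
open RobinHom in
theorem mainTheorem3 {N : ℕ} (hN : 2 ≤ N)
    (Ω : Set (E N)) (hΩ : IsSmoothBoundedDomain Ω)
    (α : ℝ) (hα : 0 ≤ α)
    -- radii of the inclusions, at the critical scale
    (r : ℝ → ℝ) (hr : ∀ ε > 0, 0 < r ε ∧ r ε < ε)
    (S : ℝ) (hS : 0 < S)
    (hrS : Tendsto (fun ε => ((centres Ω ε).ncard : ℝ) * r ε ^ (N - 1)) (𝓝[>] 0) (𝓝 S))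
    -- domain data
    (f : E N → ℝ) (hf : MemLp f 2 (volume.restrict Ω))
    -- boundary data
    (gε : ℝ → E N → ℝ) (hgε : ∀ ε > 0, MemLp (gε ε) 2 (perforatedSurface Ω (r ε) ε))
    (g : E N → ℝ) (hg : MemLp g 2 (outerSurface Ω))
    (hg_lim : Tendsto (fun ε => eLpNorm (fun x => gε ε x - g x) 2 (outerSurface Ω))
      (𝓝[>] 0) (𝓝 0))
    (hg_bdd : ∃ C : ℝ≥0, ∀ᶠ ε in 𝓝[>] (0 : ℝ),
      ENNReal.ofReal α * eLpNorm (gε ε) 2 (innerSurface Ω (r ε) ε) ≤ C)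
    -- the boundary data are identical on all the inclusions
    (h : ℝ → Metric.sphere (0 : E N) 1 → ℝ)
    (hh : ∀ ε > 0, MemLp (h ε) 2 (sphereMeasure N))
    (hgh : ∀ ε > 0, ∀ x ∈ centres Ω ε, ∀ᵐ m : Metric.sphere (0 : E N) 1 ∂(sphereMeasure N),
      gε ε (x + r ε • (m : E N)) = h ε m)
    (hbar : ℝ)
    (hhbar : Tendsto (fun ε => (1 / sphereArea N) * ∫ m, h ε m ∂(sphereMeasure N))
      (𝓝[>] 0) (𝓝 hbar)) :
    -- the functional `γ`
    (∀ ζ : E N → ℝ, ContDiff ℝ ∞ ζ →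
      Tendsto (fun ε => α * ∫ x, ζ x * gε ε x * auxiliary Ω α (r ε) ε x
          ∂(innerSurface Ω (r ε) ε)) (𝓝[>] 0)
        (𝓝 (α * S * sphereArea N / volume.real Ω * hbar * ∫ x in Ω, ζ x))) ∧
    -- the homogenised limit
    ∀ (T : ∀ ε : ℝ, H1 (perforated Ω (r ε) ε) →L[ℝ] H1 Ω), IsExtensionFamily Ω r T →
    ∀ (uε : ∀ ε : ℝ, H1 (perforated Ω (r ε) ε)),
      (∀ ε > 0, IsRobinSolution (perforated Ω (r ε) ε) (perforatedSurface Ω (r ε) ε) 0 α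
        f (gε ε) (uε ε)) →
      -- every weak limit along a sequence solves the homogenised problem
      (∀ (e : ℕ → ℝ) (u : H1 Ω), Tendsto e atTop (𝓝[>] 0) →
        WeaklyTendsto (fun n => T (e n) (uε (e n))) atTop u →
        IsRobinSolution Ω (outerSurface Ω) (α * sphereArea N * S / volume.real Ω) α
          (fun x => f x + α * sphereArea N * S / volume.real Ω * hbar) g u) ∧
      -- for positive `α` the whole family converges to the unique solution of that problem
      (0 < α → ∃ u : H1 Ω,
        WeaklyTendsto (fun ε => T ε (uε ε)) (𝓝[>] 0) u ∧
        IsRobinSolution Ω (outerSurface Ω) (α * sphereArea N * S / volume.real Ω) α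
          (fun x => f x + α * sphereArea N * S / volume.real Ω * hbar) g u ∧
        (∀ w : H1 Ω,
          IsRobinSolution Ω (outerSurface Ω) (α * sphereArea N * S / volume.real Ω) α
            (fun x => f x + α * sphereArea N * S / volume.real Ω * hbar) g w → w = u) ∧
        -- constant data: agreement with the limit of the homogeneous problems for `uε - c`
        (∀ c : ℝ, (∀ ε > 0, gε ε =ᵐ[perforatedSurface Ω (r ε) ε] fun _ => c) →
          hbar = c ∧ (g =ᵐ[outerSurface Ω] fun _ => c) ∧
          ∀ vε : ∀ ε : ℝ, H1 (perforated Ω (r ε) ε),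
            (∀ ε > 0, toFn (vε ε) =ᵐ[volume.restrict (perforated Ω (r ε) ε)]
              fun x => toFn (uε ε) x - c) →
            (∀ ε > 0, IsRobinSolution (perforated Ω (r ε) ε) (perforatedSurface Ω (r ε) ε) 0 α
              f (fun _ => 0) (vε ε)) ∧
            ∃ v : H1 Ω, WeaklyTendsto (fun ε => T ε (vε ε)) (𝓝[>] 0) v ∧
              IsRobinSolution Ω (outerSurface Ω) (α * sphereArea N * S / volume.real Ω) α
                f (fun _ => 0) v ∧
              toFn u =ᵐ[volume.restrict Ω] fun x => toFn v x + c)) := by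
  have hN1 : 1 ≤ N := by omega
  have hγ := fun (ζ : E N → ℝ) (hζ : ContDiff ℝ ∞ ζ) =>
    tendsto_mul_integral_innerSurface_data hN1 hΩ hr hrS hα hgε hg_bdd hgh hhbar hζ
  have hν : ∀ φ : E N → ℝ, ContDiff ℝ ∞ φ → MemLp φ 2 (outerSurface Ω) := fun φ hφ =>
    memLp_outerSurface hΩ hφ.continuous
  refine ⟨fun ζ hζ => tendsto_mul_integral_auxiliary hN hΩ hr hrS hα hgε hg_bdd hgh hhbar
    hζ.continuous, fun T hT uε huε => ⟨fun e u he hu => ?_, fun hα0 => ?_⟩⟩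
  · obtain ⟨M, hM⟩ := exists_norm_le_of_weaklyTendsto hu
    -- The sequence enters as the filter `map e atTop`, which lies below `𝓝[>] 0`.
    exact isRobinSolution_of_weaklyTendsto (l := map e atTop) (w := fun ε => T ε (uε ε)) (M := M)
      hN1 hΩ hr hrS hf hgε hg hg_lim hγ he (fun ε hε => hT.1 ε hε (uε ε)) huε
      (eventually_map.2 (Eventually.of_forall hM)) fun L => tendsto_map'_iff.2 (hu L)
  · have hk : 0 < α * sphereArea N * S / volume.real Ω :=
      div_pos (mul_pos (mul_pos hα0 (sphereArea_pos hN1)) hS) (volume_real_pos hΩ)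
    obtain ⟨K, -, -, hK⟩ := exists_integral_abs_le hΩ hr hrS hα0 hgε hg_bdd
    obtain ⟨u, hu, hsol⟩ := exists_weaklyTendsto_solution hN1 hΩ hr hS hrS hα0 hf hgε hg hg_lim hK
      hγ hT huε
    refine ⟨u, hu, hsol, fun w hw => hw.unique hν hk hα hg hsol, fun c hc => ?_⟩
    have hbc : hbar = c := eq_of_data_const hN1 hΩ hr hS hrS hgh hhbar hc
    have hgc : g =ᵐ[outerSurface Ω] fun _ => c := ae_eq_of_data_const hg hg_lim hc
    refine ⟨hbc, hgc, fun vε hvε => ?_⟩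
    have hv : ∀ ε > 0, IsRobinSolution (perforated Ω (r ε) ε) (perforatedSurface Ω (r ε) ε) 0 α
        f (fun _ => 0) (vε ε) := fun ε hε =>
      (huε ε hε).sub_const_perforated hΩ hε (hr ε hε).1 hf (hc ε hε) (hvε ε hε)
    obtain ⟨v, hv1, hv2, hv3⟩ := exists_weaklyTendsto_homogeneous hN1 hΩ hr hS hrS hα0 hf hg hgc hT
      hv (hbc ▸ hsol)
    exact ⟨hv, v, hv1, hv2, hv3⟩
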